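/- **Sequences.** Let $\sigma$ be the shift on $\{0,1\}^{\mathbb N}$. For distinct $s,t\in\{0,1\}^{\mathbb N}$ put $s\prec t$ (unimodal order) if $s_0+\dots+s_k$ is even, where $k$ is the first index with $s_k\ne t_k$. For a rational $q=m/n\in(0,1/2]$ in lowest terms, let $c_q=s_0s_1\dots s_n\in\{0,1\}^{n+1}$, where $s_i=1$ if the segment from $(0,0)$ to $(n,m)$ meets some line $y=\text{integer}$ at a point with $x\in(i-1,i+1)$, and $s_i=0$ otherwise. Let $w_q$ be $c_q$ with its last two symbols deleted, $\widehat w_q$ the reverse of $w_q$, and $$\mathrm{lhe}(q)=(w_q1)^\infty,\qquad \mathrm{NBT}(q)=(c_q1)^\infty,\qquad \mathrm{rhe}(q)=c_q(1\widehat w_q)^\infty .$$ The height of $s\in\{0,1\}^{\mathbb N}$ is $q(s)=\inf\{q\in\mathbb Q\cap(0,1/2]: q=1/2\text{ or }(c_q1)^\infty\prec s\}$. **Unimodal maps.** A unimodal map is a continuous surjection $f:[a,b]\to[a,b]$ with $f(b)=a$ for which there is $c\in(a,b)$ such that $f$ is strictly increasing on $[a,c]$ and strictly decreasing on $[c,b]$.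 The itinerary of $x$ is $i(x)=s_0s_1\dots$ with $s_j=0$ if $f^j(x)<c$ and $s_j=1$ if $f^j(x)\ge c$; the kneading sequence is $\kappa(f)=i(b)$. **Thick interval maps.** A thick interval $\mathbb I\subset S^2\setminus\{\infty\}=\mathbb R^2$ is a closed topological disk, identified with $[0,1]\times[0,1]$ by a homeomorphism, and partitioned into decomposition elements as follows: for some $N\ge1$ and $0=l_0<r_0<l_1<r_1<\dots<l_N<r_N=1$, the junctions are the sets corresponding to $[l_k,r_k]\times[0,1]$, and the leaves are the sets corresponding to $\{x\}\times[0,1]$ with $x\in(r_{k},l_{k+1})$. The strips $s_1,\dots,s_N$ are the components of the complement of the junctions in $\mathbb I$; the closure of each has coordinates in $[0,1]^2$ obtained by rescaling the horizontal coordinate affinely. Write $\partial_{\mathbb I}J$ for the boundary of a junction $J$ in $\mathbb I$. A thick interval map is an orientation-preserving homeomorphism $F$ of $S^2$, fixing $\infty$, such that 1. $F(\mathbb I)\subset\mathrm{Int}(\mathbb I)$; 2. $F$ maps each leaf into a decomposition element and each junction into a junction, and $\mathrm{diam}(F^k(\ell))\to0$ as $k\to\infty$ for each leaf $\ell$; 3.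 $\infty$ is a repelling fixed point whose basin (under $F^{-1}$) contains $S^2\setminus\mathbb I$; 4. there are constants $\lambda_j\ge1$ and $0<\mu_j<1$ such that on each connected component of $s_i\cap F^{-1}(s_j)$ the map $F$ is affine in the strip coordinates, multiplying horizontal lengths by $\lambda_j$ and vertical lengths by $\mu_j$; 5. if $J,J'$ are junctions with $F(J)\subset J'$ then $F(\partial_{\mathbb I}J)\subset\partial_{\mathbb I}J'$; 6. if $J$ is a junction and $k\ge1$ is least with $F^k(J)\subseteq J$, then $\mathrm{Int}(J)$ contains an attracting periodic point of least period $k$, whose basin under $F^k$ contains $\mathrm{Int}(J)$. Its transition matrix $M=(m_{ij})$ has as $m_{ij}$ the number of times $F(s_j)$ crosses $s_i$ (the number of components of $s_j\cap F^{-1}(s_i)$). $F$ is MIA if $M\neq(1)$ and some power $M^k$ with $k\ge1$ has only positive entries. The quotient of $F$ is the map $f:I\to I$ obtained by first collapsing each decomposition element of $\mathbb I$ to a point, which gives an interval $\tilde I$ with an induced map $\tilde f$, and then collapsing every interval in $\tilde I$ on which some iterate of $\tilde f$ is constant. $F$ is called unimodal if it is MIA and its quotient is a unimodal map $f$ of an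 interval $I=[a,b]$. **The outside map.** Let $f:[a,b]\to[a,b]$ be unimodal with turning point $c$ and $f(a)=f(p)$ with $p>c$. Coordinatize the upper and the lower half of the unit circle $S^1\subset\mathbb R^2$ by $[a,b]$, with $(-1,0)$ having coordinate $a$ and $(1,0)$ having coordinate $b$; these two points are denoted $\hat a,\hat b$, and for $x\in(a,b)$ the points with coordinate $x$ in the upper and lower half are denoted $x_u,x_l$ (also $a_u=a_l=\hat a$, $b_u=b_l=\hat b$). Define $\theta:S^1\to S^1\sqcup[a,b]$ by $\theta(\hat a)=f(a)_l$, $\theta(\hat b)=\hat a$, and, for $x\in(a,b)$, $$\theta(x_u)=\begin{cases}f(x)\in[a,b]&x<p\\ f(x)_l&x\ge p\end{cases}\qquad \theta(x_l)=\begin{cases}f(x)_l&x<c\\ \hat b&x=c\\ f(x)_u&x>c.\end{cases}$$ Let $\gamma=\{x_u:a<x<p\}$, and for $a\le x<y\le p$ let $(x_u,y_u)_\gamma=\{z_u:x<z<y\}$. Iterates $\theta^i$ are continued as long as the orbit stays in $S^1$. Let $\Lambda=\bigcap_{k\ge0}\theta^{-k}(S^1)$ be the set of points whose $\theta$-orbits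 remain in $S^1$. **Theorem.** Let $f:[a,b]\to[a,b]$ be the quotient of a unimodal thick interval map, let $s=\kappa(f)$, and suppose that $q(s)=m/n>0$ with $m/n$ rational in lowest terms. Then $\theta^i(\hat a)\in S^1\setminus\gamma$ for $0\le i<n$, while $\theta^n(\hat a)\in\overline\gamma$, with 1. $\theta^n(\hat a)=\hat a\iff s=\mathrm{lhe}(m/n)$; 2. $\theta^n(\hat a)=c_u\iff s=\mathrm{NBT}(m/n)$; 3. $\theta^n(\hat a)=p_u\iff s=\mathrm{rhe}(m/n)$; 4. $\theta^n(\hat a)\in(\hat a,c_u)_\gamma\iff \mathrm{lhe}(m/n)\prec s\prec\mathrm{NBT}(m/n)$; 5. $\theta^n(\hat a)\in(c_u,p_u)_\gamma\iff \mathrm{NBT}(m/n)\prec s\prec\mathrm{rhe}(m/n)$. Moreover $\Lambda$ contains exactly one periodic orbit $P$ of $\theta$; it has period $n$, and $\theta$ permutes its points as a rigid (counterclockwise) rotation of the circle through the angle $2\pi m/n$, i.e. moves each point of $P$ forward by $m$ places in the cyclic order of $P$. If $\mathrm{lhe}(m/n)\prec s\prec\mathrm{rhe}(m/n)$, then $\Lambda=P$.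 If $s=\mathrm{lhe}(m/n)$, then $\Lambda=P\cup\{z\in S^1:\theta^i(z)=p_u\text{ for some }i\ge0\}$. If $s=\mathrm{rhe}(m/n)$, then $\Lambda=P\cup\{z\in S^1:\theta^i(z)=\hat a\text{ for some }i\ge0\}$. -/

import Mathlib

open Set Filter Topology

noncomputable section

namespace OutsideDynamics

/-! ### Symbolic dynamics: the unimodal order, the words `c_q`, height -/

/-- The space `{0,1}^ℕ`. -/
abbrev Seq := ℕ → Fin 2

/-- The strict unimodal order: `s ≺ t` iff `s ≠ t` and `s₀ + ⋯ + sₙ` is even, where `n` is the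
first place at which `s` and `t` differ. -/
def ULt (s t : Seq) : Prop :=
  ∃ n : ℕ, (∀ j < n, s j = t j) ∧ s n ≠ t n ∧ Even (∑ j ∈ Finset.range (n + 1), (s j : ℕ))

/-- The sequence `w^∞ = www…` (for a non-empty word `w`). -/
def repeatWord (w : List (Fin 2)) : Seq := fun i => w.getD (i % w.length) 0

/-- The sequence `wt` consisting of the word `w` followed by the sequence `t`. -/
def prependWord (w : List (Fin 2)) (t : Seq) : Seq :=
  fun i => if i < w.length then w.getD i 0 else t (i - w.length)

open Classical in
/-- For `q = m/n` in lowest terms, the word `c_q = s₀s₁…sₙ`: here `sᵢ = 1` iff the straight line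
segment from `(0,0)` to `(n,m)` meets a line `y = integer` at some `x ∈ (i-1,i+1)`. -/
def cWord (q : ℚ) : List (Fin 2) :=
  List.ofFn fun i : Fin (q.den + 1) =>
    if ∃ x : ℝ, 0 ≤ x ∧ x ≤ (q.den : ℝ) ∧ ((i : ℕ) : ℝ) - 1 < x ∧ x < ((i : ℕ) : ℝ) + 1 ∧
        ∃ k : ℤ, (q : ℝ) * x = (k : ℝ)
    then 1 else 0

/-- The word `w_q`: delete the last two symbols of `c_q`. -/
def wWord (q : ℚ) : List (Fin 2) := (cWord q).dropLast.dropLast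

/-- `NBT(q) = (c_q 1)^∞`. -/
def NBT (q : ℚ) : Seq := repeatWord (cWord q ++ [1])

/-- `lhe(q) = (w_q 1)^∞`. -/
def lhe (q : ℚ) : Seq := repeatWord (wWord q ++ [1])

/-- `rhe(q) = c_q (1 ŵ_q)^∞`, where `ŵ_q` is the reverse of `w_q`. -/
def rhe (q : ℚ) : Seq := prependWord (cWord q) (repeatWord (1 :: (wWord q).reverse))

/-- The height `q(s) = inf {q ∈ ℚ ∩ (0,1/2] : q = 1/2 or (c_q 1)^∞ ≺ s}`. -/
def height (s : Seq) : ℝ :=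
  sInf {r : ℝ | ∃ q : ℚ, 0 < q ∧ q ≤ 1 / 2 ∧ (q = 1 / 2 ∨ ULt (NBT q) s) ∧ r = (q : ℝ)}

/-! ### Unimodal maps -/

/-- `f` restricts to a unimodal map of `[a,b]` with turning point `c`. -/
structure IsUnimodal (f : ℝ → ℝ) (a b c : ℝ) : Prop where
  lt_left : a < c
  lt_right : c < b
  continuousOn : ContinuousOn f (Icc a b)
  image_eq : f '' Icc a b = Icc a b
  map_right : f b = a
  strictMonoOn : StrictMonoOn f (Icc a c)
  strictAntiOn : StrictAntiOn f (Icc c b)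

open Classical in
/-- The itinerary of `x` under `f`, with symbol `0` to the left of `c` and `1` elsewhere. -/
def itinerary (f : ℝ → ℝ) (c x : ℝ) : Seq := fun j => if f^[j] x < c then 0 else 1

/-- The kneading sequence: the itinerary of the critical value `b = f c`. -/
def kneading (f : ℝ → ℝ) (b c : ℝ) : Seq := itinerary f c b

/-! ### Thick interval maps

The sphere is `ℂ ∪ {∞}`.  A homeomorphism of the sphere that fixes `∞` is the same thing as a
homeomorphism of `ℂ`. -/

/-- A homeomorphism of the plane is orientation-preserving when it has local degree one: the image
of a small circle about `z` winds exactly once, positively, around the image of `z`. -/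
def IsOrientationPreserving (F : ℂ ≃ₜ ℂ) : Prop :=
  ∀ z : ℂ, ∀ r : ℝ, 0 < r → ∃ φ : ℝ → ℝ, Continuous φ ∧
    (∀ t, φ (t + 2 * Real.pi) = φ t + 2 * Real.pi) ∧
    ∀ t : ℝ, F (z + r * Complex.exp (t * Complex.I)) - F z =
      ‖F (z + r * Complex.exp (t * Complex.I)) - F z‖ * Complex.exp (φ t * Complex.I)

/-- Asymptotically stable fixed points. -/
def IsAttractingFixedPt {X : Type*} [TopologicalSpace X] (g : X → X) (x : X) : Prop :=
  g x = x ∧ (∀ U ∈ 𝓝 x, ∃ V ∈ 𝓝 x, ∀ z ∈ V, ∀ n : ℕ, g^[n] z ∈ U) ∧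
    ∃ V ∈ 𝓝 x, ∀ z ∈ V, Tendsto (fun n : ℕ => g^[n] z) atTop (𝓝 x)

/-- The closed unit square. -/
def unitSquare : Set (ℝ × ℝ) := Icc 0 1 ×ˢ Icc 0 1

/-- A thick interval in the plane: a closed topological disk `chart '' [0,1]²` whose decomposition
elements are the images of finitely many disjoint closed columns `[left k, right k] × [0,1]` (the
junctions; the first and the last are the two 1-junctions, the others the 2-junctions) and of the
vertical segments `{x} × [0,1]` in between (the leaves).  Gluing the local charts of a thick
interval together gives such a global one, and it may be chosen to induce, up to affine
rescaling, the preferred coordinates on the closures of the strips. -/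
structure ThickInterval where
  /-- The number of strips; there is one junction more. -/
  N : ℕ
  N_pos : 0 < N
  left : Fin (N + 1) → ℝ
  right : Fin (N + 1) → ℝ
  left_first : left 0 = 0
  right_last : right (Fin.last N) = 1
  left_lt_right : ∀ k, left k < right k
  right_lt_left : ∀ i : Fin N, right i.castSucc < left i.succ
  chart : ℝ × ℝ → ℂ
  chart_continuousOn : ContinuousOn chart unitSquare
  chart_injOn : InjOn chart unitSquare

namespace ThickInterval

variable (T : ThickInterval)

/-- The disk itself. -/
def body : Set ℂ := T.chart '' unitSquare

/-- The coordinates in the unit square of a point of the disk. -/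
def coord (z : ℂ) : ℝ × ℝ := Function.invFunOn T.chart unitSquare z

/-- The `k`-th junction. -/
def junction (k : Fin (T.N + 1)) : Set ℂ :=
  T.chart '' (Icc (T.left k) (T.right k) ×ˢ Icc 0 1)

/-- The boundary of the `k`-th junction in the disk. -/
def junctionBoundary (k : Fin (T.N + 1)) : Set ℂ :=
  T.junction k ∩ closure (T.body \ T.junction k)

/-- The `i`-th strip. -/
def strip (i : Fin T.N) : Set ℂ :=
  T.chart '' (Ioo (T.right i.castSucc) (T.left i.succ) ×ˢ Icc 0 1)

/-- The coordinate map of the closure of the `i`-th strip to the unit square. -/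
def stripCoord (i : Fin T.N) (z : ℂ) : ℝ × ℝ :=
  (((T.coord z).1 - T.right i.castSucc) / (T.left i.succ - T.right i.castSucc), (T.coord z).2)

/-- `D` is a leaf. -/
def IsLeaf (D : Set ℂ) : Prop :=
  ∃ i : Fin T.N, ∃ x ∈ Ioo (T.right i.castSucc) (T.left i.succ),
    D = T.chart '' ({x} ×ˢ Icc (0 : ℝ) 1)

/-- `D` is a decomposition element. -/
def IsElement (D : Set ℂ) : Prop := T.IsLeaf D ∨ ∃ k, D = T.junction k

/-- The connected components of `sᵢ ∩ F⁻¹(sⱼ)`. -/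
def crossings (F : ℂ ≃ₜ ℂ) (i j : Fin T.N) : Set (Set ℂ) :=
  {C | ∃ z ∈ T.strip i ∩ F ⁻¹' T.strip j, C = connectedComponentIn (T.strip i ∩ F ⁻¹' T.strip j) z}

/-- The transition matrix: the `(i,j)` entry is the number of times `F(sⱼ)` crosses `sᵢ`. -/
def transitionMatrix (F : ℂ ≃ₜ ℂ) : Matrix (Fin T.N) (Fin T.N) ℕ :=
  fun i j => (T.crossings F j i).ncard

end ThickInterval

/-- `F` (extended by `F ∞ = ∞`) is a thick interval map of `(S², 𝕀)`. -/
structure IsThickIntervalMap (T : ThickInterval) (F : ℂ ≃ₜ ℂ) : Prop where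
  orientation : IsOrientationPreserving F
  image_body : F '' T.body ⊆ interior T.body
  image_leaf : ∀ D, T.IsLeaf D → ∃ D', T.IsElement D' ∧ F '' D ⊆ D'
  diam_leaf : ∀ D, T.IsLeaf D → Tendsto (fun n : ℕ => Metric.diam (F^[n] '' D)) atTop (𝓝 0)
  image_junction : ∀ k, ∃ k', F '' T.junction k ⊆ T.junction k'
  repelling_infty : IsAttractingFixedPt F.onePointCongr.symm OnePoint.infty
  basin_infty : ∀ z : ℂ, z ∉ T.body →
    Tendsto (fun n : ℕ => F.onePointCongr.symm^[n] (z : OnePoint ℂ)) atTop (𝓝 OnePoint.infty)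
  linear : ∃ lam mu : Fin T.N → ℝ, (∀ j, 1 ≤ lam j ∧ 0 < mu j ∧ mu j < 1) ∧
    ∀ i j, ∀ C ∈ T.crossings F i j, ∃ α β : ℝ, |α| = lam j ∧ |β| = mu j ∧
      ∀ z ∈ C, ∀ w ∈ C,
        (T.stripCoord j (F z)).1 - (T.stripCoord j (F w)).1 =
          α * ((T.stripCoord i z).1 - (T.stripCoord i w).1) ∧
        (T.stripCoord j (F z)).2 - (T.stripCoord j (F w)).2 =
          β * ((T.stripCoord i z).2 - (T.stripCoord i w).2)
  image_boundary : ∀ k k', F '' T.junction k ⊆ T.junction k' →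
    F '' T.junctionBoundary k ⊆ T.junctionBoundary k'
  periodic_junction : ∀ k, ∀ n : ℕ, 0 < n → F^[n] '' T.junction k ⊆ T.junction k →
    (∀ j : ℕ, 0 < j → j < n → ¬ F^[j] '' T.junction k ⊆ T.junction k) →
    ∃ x ∈ interior (T.junction k), Function.minimalPeriod F x = n ∧
      IsAttractingFixedPt (F^[n]) x ∧
      ∀ z ∈ interior (T.junction k), Tendsto (fun j : ℕ => (F^[n])^[j] z) atTop (𝓝 x)

/-- The MIA property: the transition matrix is irreducible and aperiodic, ie it is not the `1 × 1`
matrix `(1)` and some positive power of it has positive entries.  (No identity matrix of larger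
size has a positive power.) -/
def IsMIA (T : ThickInterval) (F : ℂ ≃ₜ ℂ) : Prop :=
  T.transitionMatrix F ≠ 1 ∧ ∃ k : ℕ, 0 < k ∧ ∀ i j, 0 < (T.transitionMatrix F ^ k) i j

/-- Some iterate of the map induced by `F` on the interval of decomposition elements is constant
on the closed interval bounded by the elements of `z` and `w`. -/
def Collapsed (T : ThickInterval) (F : ℂ ≃ₜ ℂ) (z w : ℂ) : Prop :=
  ∃ n : ℕ, ∃ D, T.IsElement D ∧
    ∀ u ∈ T.body, (T.coord u).1 ∈ uIcc (T.coord z).1 (T.coord w).1 → F^[n] u ∈ D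

/-- `f : [a,b] → [a,b]` is the quotient of `F : (S², 𝕀) → (S², 𝕀)`: the map induced by `F` on the
interval obtained from `𝕀` by collapsing decomposition elements, and then all intervals on which
some iterate of the induced map is constant.  The map `pr` is the projection `𝕀 → [a,b]`. -/
def IsQuotient (T : ThickInterval) (F : ℂ ≃ₜ ℂ) (f : ℝ → ℝ) (a b : ℝ) : Prop :=
  ∃ pr : ℂ → ℝ, ContinuousOn pr T.body ∧ pr '' T.body = Icc a b ∧
    (∀ z ∈ T.body, ∀ w ∈ T.body, pr z = pr w ↔ Collapsed T F z w) ∧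
    ∀ z ∈ T.body, pr (F z) = f (pr z)

/-! ### The outside map -/

/-- The point `x_u` of the upper half of the unit circle with coordinate `x ∈ [a,b]`. -/
def upper (a b x : ℝ) : Circle := Circle.exp (Real.pi * ((b - x) / (b - a)))

/-- The point `x_l` of the lower half of the unit circle with coordinate `x ∈ [a,b]`. -/
def lower (a b x : ℝ) : Circle := Circle.exp (-(Real.pi * ((b - x) / (b - a))))

/-- The point `â = (-1,0)`. -/
def hatA (a b : ℝ) : Circle := upper a b a

/-- The point `b̂ = (1,0)`. -/
def hatB (a b : ℝ) : Circle := upper a b b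

/-- The coordinate in `[a,b]` of a point of the unit circle. -/
def coordinate (a b : ℝ) (z : Circle) : ℝ := b - (b - a) * (|Complex.arg z| / Real.pi)

open Classical in
/-- The outside map `θ : S¹ → S¹ ∪ I`.  Points with `0 < arg z < π` are in the open upper half
circle, points with `-π < arg z < 0` in the open lower half circle. -/
def theta (f : ℝ → ℝ) (a b c p : ℝ) (z : Circle) : Circle ⊕ ℝ :=
  let x := coordinate a b z
  if z = hatA a b then Sum.inl (lower a b (f a))
  else if z = hatB a b then Sum.inl (hatA a b)
  else if 0 < Complex.arg z then
    if x < p then Sum.inr (f x) else Sum.inl (lower a b (f x))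
  else
    if x < c then Sum.inl (lower a b (f x))
    else if x = c then Sum.inl (hatB a b)
    else Sum.inl (upper a b (f x))

/-- The iterates `θ^k : S¹ → S¹ ∪ I`, where points that have fallen into `I` are moved by `f`. -/
def thetaIter (f : ℝ → ℝ) (a b c p : ℝ) (k : ℕ) (z : Circle) : Circle ⊕ ℝ :=
  (Sum.elim (theta f a b c p) fun x => Sum.inr (f x))^[k] (Sum.inl z)

/-- The open arc `γ = {x_u : a < x < p}` of points mapped into `I`. -/
def gammaArc (a b p : ℝ) : Set Circle := upper a b '' Ioo a p

/-- The set `Λ` of points whose `θ`-orbits remain in the circle. -/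
def staySet (f : ℝ → ℝ) (a b c p : ℝ) : Set Circle :=
  {z | ∀ k : ℕ, ∃ w : Circle, thetaIter f a b c p k z = Sum.inl w}

/-- `P` is a periodic orbit of `θ` in the circle, of least period `n`. -/
def IsPeriodicOrbit (f : ℝ → ℝ) (a b c p : ℝ) (n : ℕ) (P : Set Circle) : Prop :=
  ∃ z : Circle, 0 < n ∧ thetaIter f a b c p n z = Sum.inl z ∧
    (∀ k : ℕ, 0 < k → k < n → thetaIter f a b c p k z ≠ Sum.inl z) ∧
    ∀ w : Circle, w ∈ P ↔ ∃ k : ℕ, thetaIter f a b c p k z = Sum.inl w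

/-- `θ` permutes the `n` points of `P` as the rigid rotation through the angle `2πm/n`: if the
points are listed in counterclockwise order (by means of a strictly increasing sequence of angles,
which increases by `2π` in `n` steps), then `θ` moves each of them forward by `m` places. -/
def PermutedAsRotation (f : ℝ → ℝ) (a b c p : ℝ) (m : ℤ) (n : ℕ) (P : Set Circle) : Prop :=
  ∃ t : ℤ → ℝ, StrictMono t ∧ (∀ j, t (j + n) = t j + 2 * Real.pi) ∧
    P = range (fun j => Circle.exp (t j)) ∧
    ∀ j, theta f a b c p (Circle.exp (t j)) = Sum.inl (Circle.exp (t (j + m)))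

end OutsideDynamics

end

namespace OutsideDynamics

/-! ### The unimodal order -/

/-! Parametrize the circle by ℝ/ℤ, starting at â and running counterclockwise through the lower
half. Making θ constant on γ is possible because f(p) = f(a), and it turns θ into a continuous
monotone circle map of degree one that is injective off γ. `exists_outsideLift` constructs a lift L.
As long as an orbit avoids γ, its θ-orbit is the projection of its L-orbit and its coordinate in
[a,b] moves by f. The theorem thus becomes a statement about the rotation number of L and about the
return of â to the closure of γ.

Non-degeneracy comes from the thick interval map. Strips are never contracted horizontally, so a
segment that never met a junction would eventually be carried isometrically from strip to strip,
which MIA forbids (`exists_mem_junction`). Pigeonhole on the finite set of junctions turns this into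
absence of homtervals (`hitsTurningPoint`). Two consequences follow: itineraries are strictly
increasing in the unimodal order (`itinerary_lt`), and every interval of the circle meets γ under
iteration (`meetsArc`).

The link with symbols is a count. Two steps of L raise the integer part by one exactly when the
coordinate is at least c, so with N_i = ⌊L^i(0)⌋ the kneading sequence satisfies s_{i+1} = N_{i+2} -
N_i while the orbit avoids γ (`kneading_succ`). The same formula, with N_i replaced by the number of
integers in (0,iq), produces rhe(q) (`rhe_eq_rotSeq`). Comparing counts compares sequences
(`ULt.of_counts`), and comparison of tails settles the cases where the counts agree too long. The
outcome is that height equals rotation number (`height_kneading`).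

If the rotation number is m/n, then L^n(0) lies in the lift of the closed arc γ that ends at m
(`return_mem`), and no earlier return occurs. The five possible positions of this return determine
the position of s relative to lhe, NBT and rhe (`return_cases`); as these alternatives exclude each
other, every implication reverses. Some periodic orbit avoids γ (`exists_liftPer_liftStay`). Two
such orbits would bound an interval that γ separates at some time, and pulling this back along the
periods gives uniqueness (`exists_unique_orbit`). The orbit is ordered as a rotation orbit
(`exists_orbit_enumeration`), and a non-periodic orbit can avoid γ only by landing on an end point
of γ (`eventually_endpoint`). -/

theorem fin_two_cases (x : Fin 2) : x = 0 ∨ x = 1 := by omega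

theorem sum_congr_prefix {s t : Seq} {n : ℕ} (h : ∀ j < n, s j = t j) :
    ∑ j ∈ Finset.range n, (s j : ℕ) = ∑ j ∈ Finset.range n, (t j : ℕ) :=
  Finset.sum_congr rfl fun j hj => by rw [h j (Finset.mem_range.1 hj)]

/-- At the first difference, the smaller sequence has an even partial sum and the larger one an
odd partial sum. -/
theorem not_even_of_first_diff {s t : Seq} {n : ℕ} (h : ∀ j < n, s j = t j) (hn : s n ≠ t n)
    (he : Even (∑ j ∈ Finset.range (n + 1), (s j : ℕ))) :
    ¬ Even (∑ j ∈ Finset.range (n + 1), (t j : ℕ)) := by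
  rw [Finset.sum_range_succ] at he ⊢
  rw [← sum_congr_prefix h]
  rcases fin_two_cases (s n) with h1 | h1 <;> rcases fin_two_cases (t n) with h2 | h2 <;>
    simp_all [Nat.even_add]

theorem even_of_first_diff {s t : Seq} {n : ℕ} (h : ∀ j < n, s j = t j) (hn : s n ≠ t n)
    (he : ¬ Even (∑ j ∈ Finset.range (n + 1), (s j : ℕ))) :
    Even (∑ j ∈ Finset.range (n + 1), (t j : ℕ)) := by
  rw [Finset.sum_range_succ] at he ⊢
  rw [← sum_congr_prefix h]
  rcases fin_two_cases (s n) with h1 | h1 <;> rcases fin_two_cases (t n) with h2 | h2 <;>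
    simp_all [Nat.even_add]

theorem ULt.irrefl (s : Seq) : ¬ ULt s s := fun ⟨_, _, h, _⟩ => h rfl

theorem ULt.ne {s t : Seq} (h : ULt s t) : s ≠ t := by
  rintro rfl; exact ULt.irrefl _ h

theorem ULt.trans {s t u : Seq} (h1 : ULt s t) (h2 : ULt t u) : ULt s u := by
  obtain ⟨n, hn, hne, he⟩ := h1
  obtain ⟨k, hk, hke, hk'⟩ := h2
  rcases lt_trichotomy n k with h | h | h
  · exact ⟨n, fun j hj => (hn j hj).trans (hk j (hj.trans h)), by rwa [← hk n h], he⟩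
  · subst h
    exact absurd hk' (not_even_of_first_diff hn hne he)
  · refine ⟨k, fun j hj => (hn j (hj.trans h)).trans (hk j hj), by rwa [hn k h], ?_⟩
    rwa [sum_congr_prefix fun j hj => hn j (by omega)]

theorem ULt.asymm {s t : Seq} (h1 : ULt s t) : ¬ ULt t s := fun h2 => ULt.irrefl _ (h1.trans h2)

theorem exists_first_diff {s t : Seq} (h : s ≠ t) : ∃ n, (∀ j < n, s j = t j) ∧ s n ≠ t n := by
  classical
  have h' : ∃ n, s n ≠ t n := Function.ne_iff.1 h
  exact ⟨Nat.find h', fun j hj => not_not.1 (Nat.find_min h' hj), Nat.find_spec h'⟩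

/-- An odd prefix changes the parity of every later partial sum, so removing it reverses the order
of the tails. This is how all comparisons after the word c_q 1 are made. -/
theorem ULt.of_prefix_of_odd {s t : Seq} {l : ℕ} (h : ∀ j < l, s j = t j)
    (he : ¬ Even (∑ j ∈ Finset.range l, (s j : ℕ)))
    (ht : ULt (fun j => s (j + l)) (fun j => t (j + l))) : ULt t s := by
  obtain ⟨n, hn, hne, he'⟩ := ht
  have h1 : ∀ j < n + l, s j = t j := fun j hj => by
    rcases lt_or_ge j l with hjl | hjl
    · exact h j hjl
    · have := hn (j - l) (by omega)
      simpa [Nat.sub_add_cancel hjl] using this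
  refine ⟨n + l, fun j hj => (h1 j hj).symm, hne.symm, ?_⟩
  refine even_of_first_diff h1 hne ?_
  rw [show n + l + 1 = l + (n + 1) by omega, Finset.sum_range_add, Nat.even_add]
  simp only [he, false_iff, not_not]
  simpa [add_comm] using he'

/-- Here s = ut and N = uN. A match of t with s transports the match of s with N from one copy of u
to the next, so s follows N for as long as t follows s. -/
theorem prefix_shift_agree {s t N : Seq} {l n : ℕ} (hl : 0 < l) (hs : ∀ j < l, s j = N j)
    (hst : ∀ j, s (j + l) = t j) (hN : ∀ j, N (j + l) = N j) (h : ∀ j < n, t j = s j) :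
    ∀ i ≤ n, s i = N i := by
  intro i
  induction i using Nat.strong_induction_on with
  | _ i ih =>
    intro hi
    rcases lt_or_ge i l with hil | hil
    · exact hs i hil
    · have h1 := hst (i - l)
      have h2 := hN (i - l)
      rw [Nat.sub_add_cancel hil] at h1 h2
      rw [h1, h2, h (i - l) (by omega), ih (i - l) (by omega) (by omega)]

/-- If `s = u t` and `N = u N` for a word `u`, then `t ≺ s` implies `t ≺ N`. -/
theorem ULt.repeat_of_lt {s t N : Seq} {l : ℕ} (hl : 0 < l) (hs : ∀ j < l, s j = N j)
    (hst : ∀ j, s (j + l) = t j) (hN : ∀ j, N (j + l) = N j) (h : ULt t s) : ULt t N := by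
  obtain ⟨n, hn, hne, he⟩ := h
  have key := prefix_shift_agree hl hs hst hN hn
  exact ⟨n, fun j hj => (hn j hj).trans (key j hj.le), by rwa [← key n le_rfl], he⟩

/-- If `s = u t` and `N = u N` for a word `u`, then `s ≺ t` implies `N ≺ t`. -/
theorem ULt.repeat_of_gt {s t N : Seq} {l : ℕ} (hl : 0 < l) (hs : ∀ j < l, s j = N j)
    (hst : ∀ j, s (j + l) = t j) (hN : ∀ j, N (j + l) = N j) (h : ULt s t) : ULt N t := by
  obtain ⟨n, hn, hne, he⟩ := h
  have key := prefix_shift_agree hl hs hst hN fun j hj => (hn j hj).symm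
  refine ⟨n, fun j hj => (key j hj.le).symm.trans (hn j hj), by rwa [← key n le_rfl], ?_⟩
  rwa [← sum_congr_prefix fun j hj => key j (by omega)]

/-- Comparison of sequences coded by increments over two steps of integer sequences. -/
theorem ULt.of_counts {s t : Seq} {x y : ℕ → ℤ} {I : ℕ} (hs0 : s 0 = 1) (ht0 : t 0 = 1)
    (hx0 : x 0 = 0) (hx1 : x 1 = 0) (hy0 : y 0 = 0) (hy1 : y 1 = 0) (hx : Monotone x)
    (hs : ∀ i, i + 1 < I → ((s (i + 1) : ℕ) : ℤ) = x (i + 2) - x i)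
    (ht : ∀ i, i + 1 < I → ((t (i + 1) : ℕ) : ℤ) = y (i + 2) - y i)
    (hxy : ∀ i < I, x i = y i) (hI : x I < y I) : ULt t s := by
  -- Both counts vanish at 0 and 1, so they first differ at some k + 2; the symbols then first
  -- differ at k + 1.
  obtain ⟨k, rfl⟩ : ∃ k, I = k + 2 := by
    match I, hI with
    | 0, h => omega
    | 1, h => omega
    | k + 2, _ => exact ⟨k, rfl⟩
  have hagree : ∀ j < k + 1, s j = t j := by
    intro j hj
    rcases j with _ | j
    · rw [hs0, ht0]
    · have h1 := hs j (by omega)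
      have h2 := ht j (by omega)
      rw [hxy (j + 2) (by omega), hxy j (by omega), ← h2] at h1
      apply Fin.ext
      exact_mod_cast h1
  -- The two-step increments telescope to two consecutive counts. At the first difference s has
  -- symbol 0, which forces `x (k + 2) = x (k + 1)` and makes its partial sum odd.
  have hsum : ∀ j ≤ k + 1, (((∑ i ∈ Finset.range (j + 1), (s i : ℕ)) : ℕ) : ℤ) =
      1 + x (j + 1) + x j := by
    intro j hj
    induction j with
    | zero => simp [hs0, hx0, hx1]
    | succ j ih =>
      rw [Finset.sum_range_succ, Nat.cast_add, ih (by omega), hs j (by omega)]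
      ring
  have h1 := hs k (by omega)
  have h2 := ht k (by omega)
  have hk := hxy k (by omega)
  have hk1 := hxy (k + 1) (by omega)
  have hm1 : x k ≤ x (k + 1) := hx (by omega)
  have hm2 : x (k + 1) ≤ x (k + 2) := hx (by omega)
  have hsk : s (k + 1) = 0 := by
    rcases fin_two_cases (s (k + 1)) with h | h
    · exact h
    · have : ((t (k + 1) : ℕ) : ℤ) ≤ 1 := by have := (t (k + 1)).is_lt; omega
      rw [h] at h1; simp at h1; omega
  have htk : t (k + 1) = 1 := by
    rcases fin_two_cases (t (k + 1)) with h | h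
    · rw [h] at h2; rw [hsk] at h1; simp at h1 h2; omega
    · exact h
  refine ⟨k + 1, fun j hj => (hagree j hj).symm, by rw [hsk, htk]; decide, ?_⟩
  refine even_of_first_diff (s := s) hagree (by rw [hsk, htk]; decide) ?_
  have h3 := hsum (k + 1) le_rfl
  rw [hsk] at h1
  simp at h1
  have h4 : x (k + 2) = x (k + 1) := by omega
  intro hev
  obtain ⟨r, hr⟩ := hev
  rw [hr] at h3
  push_cast at h3
  have : x (k + 1 + 1) = x (k + 2) := rfl
  omega

/-! ### The words `c_q` and the sequences `lhe(q)`, `NBT(q)`, `rhe(q)` -/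

/-- The number of integers in `(0, iq)`. -/
def ceilCount (q : ℚ) (i : ℕ) : ℤ := if i = 0 then 0 else ⌈(i : ℚ) * q⌉ - 1

open Classical in
/-- The coding of the orbit of a point of an arc end by the rotation through `q`. -/
def rotSeq (q : ℚ) : Seq := fun i =>
  if i = 0 then 1 else if ceilCount q (i - 1) < ceilCount q (i + 1) then 1 else 0

variable {q : ℚ}

/-! ### Arithmetic of the counts of integers and of their coding. -/

theorem ceilCount_zero : ceilCount q 0 = 0 := rfl

theorem ceilCount_of_pos {i : ℕ} (hi : 0 < i) : ceilCount q i = ⌈(i : ℚ) * q⌉ - 1 :=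
  if_neg hi.ne'

theorem ceilCount_one (hq : 0 < q) (hq2 : q ≤ 1 / 2) : ceilCount q 1 = 0 := by
  rw [ceilCount_of_pos one_pos, sub_eq_zero, Int.ceil_eq_iff]
  constructor <;> norm_num <;> linarith

theorem ceilCount_two (hq : 0 < q) (hq2 : q ≤ 1 / 2) : ceilCount q 2 = 0 := by
  rw [ceilCount_of_pos two_pos, sub_eq_zero, Int.ceil_eq_iff]
  constructor <;> norm_num <;> linarith

theorem ceilCount_monotone (hq : 0 < q) : Monotone (ceilCount q) := by
  intro i j hij
  rcases Nat.eq_zero_or_pos i with rfl | hi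
  · rcases Nat.eq_zero_or_pos j with rfl | hj
    · rfl
    · rw [ceilCount_zero, ceilCount_of_pos hj]
      have : (0 : ℤ) < ⌈(j : ℚ) * q⌉ := Int.ceil_pos.2 (by positivity)
      omega
  · rw [ceilCount_of_pos hi, ceilCount_of_pos (by omega)]
    have : ⌈(i : ℚ) * q⌉ ≤ ⌈(j : ℚ) * q⌉ := by gcongr
    omega

theorem ceilCount_add_two_le (hq : 0 < q) (hq2 : q ≤ 1 / 2) (i : ℕ) :
    ceilCount q (i + 2) ≤ ceilCount q i + 1 := by
  rcases Nat.eq_zero_or_pos i with rfl | hi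
  · rw [ceilCount_zero, ceilCount_two hq hq2]; norm_num
  · rw [ceilCount_of_pos hi, ceilCount_of_pos (by omega)]
    have : ⌈((i + 2 : ℕ) : ℚ) * q⌉ ≤ ⌈(i : ℚ) * q⌉ + 1 := by
      rw [Int.ceil_le]
      have := Int.le_ceil ((i : ℚ) * q)
      push_cast
      linarith
    omega

theorem mul_den_eq (q : ℚ) : (q.den : ℚ) * q = q.num := by
  rw [mul_comm]; exact Rat.mul_den_eq_num q

/-- False at `i = 0`: the count there is 0 by convention, whereas the ceiling formula would give -1.
This is why `rotSeq` is periodic only from index 2 on. -/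
theorem ceilCount_add_den (i : ℕ) (hi : 0 < i) :
    ceilCount q (i + q.den) = ceilCount q i + q.num := by
  rw [ceilCount_of_pos hi, ceilCount_of_pos (by omega)]
  push_cast
  rw [add_mul, mul_den_eq, Int.ceil_add_intCast]
  ring

theorem ceilCount_den : ceilCount q q.den = q.num - 1 := by
  rw [ceilCount_of_pos q.den_pos, mul_den_eq, Int.ceil_intCast]

theorem ceilCount_den_succ (hq : 0 < q) (hq2 : q ≤ 1 / 2) : ceilCount q (q.den + 1) = q.num := by
  rw [add_comm, ceilCount_add_den 1 one_pos, ceilCount_one hq hq2, zero_add]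

theorem ceilCount_den_add_two (hq : 0 < q) (hq2 : q ≤ 1 / 2) :
    ceilCount q (q.den + 2) = q.num := by
  rw [add_comm, ceilCount_add_den 2 two_pos, ceilCount_two hq hq2, zero_add]

theorem dvd_of_mul_eq_int {i : ℤ} {k : ℤ} (h : (i : ℚ) * q = k) : (q.den : ℤ) ∣ i := by
  have h1 : i * q.num = k * q.den := by
    have h2 := mul_den_eq q
    have : (i : ℚ) * q.num = k * q.den := by rw [← h2, ← h]; ring
    exact_mod_cast this
  have hc : IsCoprime (q.den : ℤ) q.num := by
    have := q.reduced
    rw [Int.isCoprime_iff_gcd_eq_one, Int.gcd_comm]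
    simpa [Int.gcd, Nat.Coprime] using this
  exact hc.dvd_of_dvd_mul_right (Dvd.intro_left k h1.symm)

/-- For 0 < i < n the number iq is not an integer, since m/n is in lowest terms; at i = 0 the
convention agrees with the floor. -/
theorem ceilCount_eq_floor {i : ℕ} (hi : i < q.den) : ceilCount q i = ⌊(i : ℚ) * q⌋ := by
  rcases Nat.eq_zero_or_pos i with rfl | h0
  · simp [ceilCount_zero]
  · rw [ceilCount_of_pos h0]
    symm
    rw [Int.floor_eq_iff]
    have h1 := Int.ceil_lt_add_one ((i : ℚ) * q)
    have h2 := Int.le_ceil ((i : ℚ) * q)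
    push_cast
    refine ⟨by linarith, ?_⟩
    rw [sub_add_cancel]
    refine lt_of_le_of_ne h2 fun h => ?_
    have := dvd_of_mul_eq_int (i := (i : ℤ)) (by exact_mod_cast h)
    have := Int.le_of_dvd (by omega) this
    omega

theorem two_le_den (hq : 0 < q) (hq2 : q ≤ 1 / 2) : 2 ≤ q.den := by
  have h := mul_den_eq q
  have h1 : (1 : ℚ) ≤ q.num := by exact_mod_cast Rat.num_pos.2 hq
  have hd : (0 : ℚ) < q.den := by exact_mod_cast q.den_pos
  have : (2 : ℚ) ≤ q.den := by nlinarith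
  exact_mod_cast this

theorem rotSeq_zero : rotSeq q 0 = 1 := rfl

theorem rotSeq_succ (hq : 0 < q) (hq2 : q ≤ 1 / 2) (i : ℕ) :
    ((rotSeq q (i + 1) : ℕ) : ℤ) = ceilCount q (i + 2) - ceilCount q i := by
  have h1 := ceilCount_add_two_le hq hq2 i
  have h2 := ceilCount_monotone hq (show i ≤ i + 2 by omega)
  unfold rotSeq
  simp only [Nat.add_eq_zero_iff, one_ne_zero, and_false, if_false, Nat.add_sub_cancel,
    show i + 1 + 1 = i + 2 from rfl]
  split_ifs with h
  · simp; omega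
  · simp at h ⊢; omega

theorem rotSeq_add_den (i : ℕ) (hi : 2 ≤ i) : rotSeq q (i + q.den) = rotSeq q i := by
  unfold rotSeq
  rw [if_neg (show i + q.den ≠ 0 by omega), if_neg (show i ≠ 0 by omega), show i + q.den - 1 = (i - 1) + q.den by omega,
    show i + q.den + 1 = (i + 1) + q.den by omega, ceilCount_add_den _ (by omega),
    ceilCount_add_den _ (by omega)]
  simp

theorem rotSeq_one (hq : 0 < q) (hq2 : q ≤ 1 / 2) : rotSeq q 1 = 0 := by
  have := rotSeq_succ hq hq2 0
  rw [ceilCount_two hq hq2, ceilCount_zero] at this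
  apply Fin.ext
  simpa using this

theorem rotSeq_den_add_one (hq : 0 < q) (hq2 : q ≤ 1 / 2) : rotSeq q (q.den + 1) = 1 := by
  have := rotSeq_succ hq hq2 q.den
  rw [ceilCount_den_add_two hq hq2, ceilCount_den] at this
  apply Fin.ext
  rw [Fin.val_one]
  omega

/-! ### Words from line segments, and the symbols of NBT, lhe and rhe. -/

theorem cWord_length (q : ℚ) : (cWord q).length = q.den + 1 := by simp [cWord]

theorem cWord_getD {i : ℕ} (hi : i ≤ q.den) (d : Fin 2) :
    ((cWord q).getD i d = 1 ↔ ∃ x : ℝ, 0 ≤ x ∧ x ≤ (q.den : ℝ) ∧ (i : ℝ) - 1 < x ∧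
      x < (i : ℝ) + 1 ∧ ∃ k : ℤ, (q : ℝ) * x = (k : ℝ)) := by
  rw [List.getD_eq_getElem _ _ (by rw [cWord_length]; omega)]
  simp only [cWord, List.getElem_ofFn]
  split_ifs with h
  · exact ⟨fun _ => h, fun _ => rfl⟩
  · exact ⟨fun h' => by simp at h', fun h' => absurd h' h⟩

/-- The half turn about the midpoint of the segment preserves the horizontal integer lines and
exchanges the windows around i and n - i. -/
theorem cWord_palindrome {i : ℕ} (hi : i ≤ q.den) (d : Fin 2) :
    (cWord q).getD (q.den - i) d = (cWord q).getD i d := by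
  have key : ∀ j ≤ q.den, (cWord q).getD j d = 1 → (cWord q).getD (q.den - j) d = 1 := by
    intro j hj h
    rw [cWord_getD hj] at h
    rw [cWord_getD (by omega)]
    obtain ⟨x, h0, h1, h2, h3, k, hk⟩ := h
    refine ⟨q.den - x, by linarith, by linarith, ?_, ?_, q.num - k, ?_⟩
    · push_cast [Nat.cast_sub hj]; linarith
    · push_cast [Nat.cast_sub hj]; linarith
    · have : (q.den : ℝ) * q = q.num := by exact_mod_cast mul_den_eq q
      push_cast
      rw [mul_sub, hk, mul_comm, this]
  have h1 := key i hi
  have h2 := key (q.den - i) (by omega)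
  rw [show q.den - (q.den - i) = i by omega] at h2
  rcases fin_two_cases ((cWord q).getD i d) with h | h <;>
    rcases fin_two_cases ((cWord q).getD (q.den - i) d) with h' | h' <;> simp_all

/-- A crossing inside the window of i means an integer strictly between (i-1)q and (i+1)q. For i > 0
this says that the count of integers grows over these two steps. -/
theorem cWord_eq_rotSeq (hq : 0 < q) (hq2 : q ≤ 1 / 2) {i : ℕ} (hi : i ≤ q.den) (d : Fin 2) :
    (cWord q).getD i d = rotSeq q i := by
  have hqR : (0 : ℝ) < q := by exact_mod_cast hq
  suffices h : (cWord q).getD i d = 1 ↔ rotSeq q i = 1 by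
    rcases fin_two_cases ((cWord q).getD i d) with h' | h' <;>
      rcases fin_two_cases (rotSeq q i) with h'' | h'' <;> simp_all
  rw [cWord_getD hi]
  rcases i with _ | i
  · refine ⟨fun _ => rfl, fun _ => ⟨0, by simp, by simp, by simp, by simp, 0, by simp⟩⟩
  have hrot : rotSeq q (i + 1) = 1 ↔ ceilCount q i < ceilCount q (i + 2) := by
    have := rotSeq_succ hq hq2 i
    rcases fin_two_cases (rotSeq q (i + 1)) with h' | h' <;> rw [h'] at this ⊢ <;> simp at this ⊢ <;>
      omega
  rw [hrot, ceilCount_of_pos (by omega : 0 < i + 2), ceilCount_eq_floor (by omega : i < q.den)]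
  have hden := mul_den_eq q
  have hlt : ∀ k : ℤ, k < ⌈((i + 2 : ℕ) : ℚ) * q⌉ ↔ (k : ℝ) < (i + 2) * q := by
    intro k
    rw [Int.lt_ceil]
    exact_mod_cast Iff.rfl
  have hgt : ∀ k : ℤ, ⌊(i : ℚ) * q⌋ < k ↔ (i : ℝ) * q < k := by
    intro k
    rw [Int.floor_lt]
    exact_mod_cast Iff.rfl
  constructor
  · rintro ⟨x, h0, h1, h2, h3, k, hk⟩
    have h4 := (hlt k).2 (by rw [← hk]; push_cast at h3; nlinarith)
    have h5 := (hgt k).2 (by rw [← hk]; push_cast at h2; nlinarith)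
    omega
  · intro h
    have h4 := (hlt (⌊(i : ℚ) * q⌋ + 1)).1 (by omega)
    have h5 := (hgt (⌊(i : ℚ) * q⌋ + 1)).1 (by omega)
    -- The first integer above iq serves as the height of the crossing; it must not exceed m for the
    -- crossing to lie on the segment.
    have h6 : ⌊(i : ℚ) * q⌋ + 1 ≤ q.num := by
      have : ⌊(i : ℚ) * q⌋ < q.num := by
        rw [Int.floor_lt, ← hden]
        have : (i : ℚ) < q.den := by exact_mod_cast (by omega : i < q.den)
        nlinarith
      omega
    set k := ⌊(i : ℚ) * q⌋ + 1
    have h7 : 0 ≤ (i : ℝ) * q := by positivity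
    refine ⟨k / q, by apply div_nonneg <;> linarith, ?_, ?_, ?_, k, by field_simp⟩
    · rw [div_le_iff₀ hqR]
      have : (q.den : ℝ) * q = q.num := by exact_mod_cast hden
      rw [this]; exact_mod_cast h6
    · rw [lt_div_iff₀ hqR]; push_cast; linarith
    · rw [div_lt_iff₀ hqR]; push_cast; linarith

theorem rotSeq_palindrome (hq : 0 < q) (hq2 : q ≤ 1 / 2) {i : ℕ} (hi : i ≤ q.den) :
    rotSeq q (q.den - i) = rotSeq q i := by
  rw [← cWord_eq_rotSeq hq hq2 hi 0, ← cWord_eq_rotSeq hq hq2 (by omega) 0, cWord_palindrome hi]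

theorem sum_rotSeq (hq : 0 < q) (hq2 : q ≤ 1 / 2) (j : ℕ) :
    ((∑ i ∈ Finset.range (j + 1), (rotSeq q i : ℕ) : ℕ) : ℤ) =
      1 + ceilCount q (j + 1) + ceilCount q j := by
  induction j with
  | zero => simp [rotSeq_zero, ceilCount_zero, ceilCount_one hq hq2]
  | succ j ih =>
    rw [Finset.sum_range_succ, Nat.cast_add, ih, rotSeq_succ hq hq2]
    ring

/-- By telescoping the sum is 1 + m + (m - 1) = 2m. So c_q is an even word, while c_q 1 is odd and
reverses the order. -/
theorem even_sum_rotSeq (hq : 0 < q) (hq2 : q ≤ 1 / 2) :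
    Even (∑ i ∈ Finset.range (q.den + 1), (rotSeq q i : ℕ)) := by
  have h := sum_rotSeq hq hq2 q.den
  rw [ceilCount_den, ceilCount_den_succ hq hq2] at h
  rw [← Int.even_coe_nat, h]
  exact ⟨q.num, by ring⟩

theorem NBT_word_length : (cWord q ++ [1]).length = q.den + 2 := by simp [cWord_length]

theorem NBT_add (i : ℕ) : NBT q (i + (q.den + 2)) = NBT q i := by
  simp only [NBT, repeatWord, NBT_word_length, Nat.add_mod_right]

theorem NBT_of_le (hq : 0 < q) (hq2 : q ≤ 1 / 2) {i : ℕ} (hi : i ≤ q.den) :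
    NBT q i = rotSeq q i := by
  rw [← cWord_eq_rotSeq hq hq2 hi 0]
  simp only [NBT, repeatWord, NBT_word_length]
  rw [Nat.mod_eq_of_lt (by omega), List.getD_append _ _ _ _ (by rw [cWord_length]; omega)]

theorem NBT_den_add_one : NBT q (q.den + 1) = 1 := by
  simp only [NBT, repeatWord, NBT_word_length]
  rw [Nat.mod_eq_of_lt (by omega), List.getD_append_right _ _ _ _ (by rw [cWord_length])]
  simp [cWord_length]

theorem wWord_length : (wWord q).length = q.den - 1 := by
  simp [wWord, cWord_length]

theorem wWord_getD {i : ℕ} (hi : i < q.den - 1) (d : Fin 2) :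
    (wWord q).getD i d = (cWord q).getD i d := by
  rw [List.getD_eq_getElem _ _ (by rw [wWord_length]; omega),
    List.getD_eq_getElem _ _ (by rw [cWord_length]; omega)]
  simp [wWord, List.getElem_dropLast]

theorem lhe_word_length : (wWord q ++ [1]).length = q.den := by
  have := q.den_pos
  simp [wWord_length]; omega

theorem lhe_add (i : ℕ) : lhe q (i + q.den) = lhe q i := by
  simp only [lhe, repeatWord, lhe_word_length, Nat.add_mod_right]

theorem lhe_of_lt (hq : 0 < q) (hq2 : q ≤ 1 / 2) {i : ℕ} (hi : i < q.den - 1) :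
    lhe q i = rotSeq q i := by
  rw [← cWord_eq_rotSeq hq hq2 (by omega) 0, ← wWord_getD hi]
  simp only [lhe, repeatWord, lhe_word_length]
  rw [Nat.mod_eq_of_lt (by omega), List.getD_append _ _ _ _ (by rw [wWord_length]; omega)]

theorem lhe_den_sub_one : lhe q (q.den - 1) = 1 := by
  have := q.den_pos
  simp only [lhe, repeatWord, lhe_word_length]
  rw [Nat.mod_eq_of_lt (by omega), List.getD_append_right _ _ _ _ (by rw [wWord_length])]
  simp [wWord_length]

/-- By the palindrome property the reversed word 1ŵ_q is the block of length n read by the rotation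
coding from index n + 1, and that coding has period n from there on. -/
theorem rhe_eq_rotSeq (hq : 0 < q) (hq2 : q ≤ 1 / 2) : rhe q = rotSeq q := by
  have h2 := two_le_den hq hq2
  have hlen : (1 :: (wWord q).reverse).length = q.den := by simp [wWord_length]; omega
  have hge : ∀ j, rhe q (j + (q.den + 1)) = repeatWord (1 :: (wWord q).reverse) j := by
    intro j
    simp only [rhe, prependWord, cWord_length, Nat.add_sub_cancel]
    rw [if_neg (by omega)]
  have hper : ∀ j, rhe q (j + q.den + (q.den + 1)) = rhe q (j + (q.den + 1)) := by
    intro j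
    rw [hge, hge]
    simp only [repeatWord]
    rw [hlen, Nat.add_mod_right]
  have hmain : ∀ j, rhe q (j + (q.den + 1)) = rotSeq q (j + (q.den + 1)) := by
    intro j
    induction j using Nat.strong_induction_on with
    | _ j ih =>
      rcases lt_or_ge j q.den with hj | hj
      · rw [hge]
        simp only [repeatWord]
        rw [hlen, Nat.mod_eq_of_lt hj]
        rcases j with _ | j
        · rw [zero_add, rotSeq_den_add_one hq hq2]; rfl
        · rw [List.getD_cons_succ, show j + 1 + (q.den + 1) = (j + 2) + q.den by omega,
            rotSeq_add_den _ (by omega), ← rotSeq_palindrome hq hq2 (by omega),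
            ← cWord_eq_rotSeq hq hq2 (by omega) 0, ← wWord_getD (by omega)]
          rw [List.getD_eq_getElem _ _ (by rw [List.length_reverse, wWord_length]; omega),
            List.getD_eq_getElem _ _ (by rw [wWord_length]; omega), List.getElem_reverse]
          congr 1
          rw [wWord_length]; omega
      · obtain ⟨k, rfl⟩ := Nat.exists_eq_add_of_le' hj
        rw [hper, ih k (by omega), show k + q.den + (q.den + 1) = (k + (q.den + 1)) + q.den by omega,
          rotSeq_add_den _ (by omega)]
  funext i
  rcases lt_or_ge i (q.den + 1) with hi | hi
  · rw [← cWord_eq_rotSeq hq hq2 (by omega) 0]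
    simp [rhe, prependWord, cWord_length, hi]
  · obtain ⟨k, rfl⟩ := Nat.exists_eq_add_of_le' hi
    exact hmain k

theorem rotSeq_den_sub_one (hq : 0 < q) (hq2 : q ≤ 1 / 2) : rotSeq q (q.den - 1) = 0 := by
  rw [rotSeq_palindrome hq hq2 q.den_pos, rotSeq_one hq hq2]

theorem rotSeq_den (hq : 0 < q) (hq2 : q ≤ 1 / 2) : rotSeq q q.den = 1 := by
  simpa [rotSeq_zero] using rotSeq_palindrome hq hq2 (i := 0) (Nat.zero_le _)

/-- Every sequence beginning with `w_q 0` is larger than `lhe(q)`. -/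
theorem lhe_lt_of_prefix (hq : 0 < q) (hq2 : q ≤ 1 / 2) {s : Seq}
    (hs : ∀ i < q.den, s i = rotSeq q i) : ULt (lhe q) s := by
  have h2 := two_le_den hq hq2
  have hpre : ∀ j < q.den - 1, s j = lhe q j := fun j hj => by
    rw [lhe_of_lt hq hq2 hj, hs j (by omega)]
  have hne : s (q.den - 1) ≠ lhe q (q.den - 1) := by
    rw [lhe_den_sub_one, hs _ (by omega), rotSeq_den_sub_one hq hq2]; decide
  refine ⟨q.den - 1, fun j hj => (hpre j hj).symm, hne.symm, even_of_first_diff hpre hne ?_⟩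
  have he := even_sum_rotSeq hq hq2
  rw [Finset.sum_range_succ, rotSeq_den hq hq2, Nat.even_add] at he
  rw [show q.den - 1 + 1 = q.den by omega, sum_congr_prefix hs]
  simpa using he

/-- Every sequence beginning with `c_q 0` is smaller than `NBT(q)` and `rhe(q)`. -/
theorem lt_of_prefix_zero (hq : 0 < q) (hq2 : q ≤ 1 / 2) {s t : Seq}
    (hs : ∀ i ≤ q.den, s i = rotSeq q i) (hs1 : s (q.den + 1) = 0)
    (ht : ∀ i ≤ q.den, t i = rotSeq q i) (ht1 : t (q.den + 1) = 1) : ULt s t := by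
  refine ⟨q.den + 1, fun j hj => ?_, by rw [hs1, ht1]; decide, ?_⟩
  · rw [hs j (by omega), ht j (by omega)]
  · rw [Finset.sum_range_succ, hs1, sum_congr_prefix (t := rotSeq q) fun j hj => hs j (by omega)]
    simpa using even_sum_rotSeq hq hq2

theorem odd_sum_of_prefix (hq : 0 < q) (hq2 : q ≤ 1 / 2) {s : Seq}
    (hs : ∀ i ≤ q.den, s i = rotSeq q i) (hs1 : s (q.den + 1) = 1) :
    ¬ Even (∑ i ∈ Finset.range (q.den + 2), (s i : ℕ)) := by
  rw [Finset.sum_range_succ, hs1, sum_congr_prefix (t := rotSeq q) fun j hj => hs j (by omega),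
    Nat.even_add]
  simpa using even_sum_rotSeq hq hq2

theorem lhe_lt_NBT (hq : 0 < q) (hq2 : q ≤ 1 / 2) : ULt (lhe q) (NBT q) :=
  lhe_lt_of_prefix hq hq2 fun _ hi => NBT_of_le hq hq2 hi.le

theorem lhe_lt_rhe (hq : 0 < q) (hq2 : q ≤ 1 / 2) : ULt (lhe q) (rhe q) :=
  lhe_lt_of_prefix hq hq2 fun _ _ => by rw [rhe_eq_rotSeq hq hq2]

/-- After the common odd prefix c_q 1 it suffices that the tail of rhe(q) precedes NBT(q), which
begins with 10. That tail begins with 0 or with 11, and both precede 10. -/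
theorem NBT_lt_rhe (hq : 0 < q) (hq2 : q ≤ 1 / 2) : ULt (NBT q) (rhe q) := by
  have h2 := two_le_den hq hq2
  rw [rhe_eq_rotSeq hq hq2]
  refine ULt.of_prefix_of_odd (s := rotSeq q) (l := q.den + 2) (fun j hj => ?_)
    (odd_sum_of_prefix hq hq2 (fun _ _ => rfl) (rotSeq_den_add_one hq hq2)) ?_
  · rcases lt_or_ge j (q.den + 1) with h | h
    · rw [NBT_of_le hq hq2 (by omega)]
    · obtain rfl : j = q.den + 1 := by omega
      rw [NBT_den_add_one, rotSeq_den_add_one hq hq2]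
  have hr : ∀ j, rotSeq q (j + (q.den + 2)) = rotSeq q (j + 2) := fun j => by
    rw [show j + (q.den + 2) = (j + 2) + q.den by omega, rotSeq_add_den _ (by omega)]
  have hN0 : NBT q 0 = 1 := by rw [NBT_of_le hq hq2 (by omega), rotSeq_zero]
  have hN1 : NBT q 1 = 0 := by rw [NBT_of_le hq hq2 (by omega), rotSeq_one hq hq2]
  simp only [hr, NBT_add]
  rcases fin_two_cases (rotSeq q 2) with h | h
  · exact ⟨0, by simp, by simp [h, hN0], by simp [h]⟩
  · have h3 : rotSeq q 3 = 1 := by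
      have e1 := rotSeq_succ hq hq2 1
      have e2 := rotSeq_succ hq hq2 2
      rw [h, ceilCount_one hq hq2] at e1
      rw [ceilCount_two hq hq2] at e2
      have e3 := ceilCount_monotone hq (show 3 ≤ 4 by omega)
      have e4 := (rotSeq q 3).is_lt
      simp at e1 e2
      apply Fin.ext
      rw [Fin.val_one]
      omega
    refine ⟨1, fun j hj => ?_, by simp [h3, hN1], ?_⟩
    · obtain rfl : j = 0 := by omega
      simp [h, hN0]
    · simp [Finset.sum_range_succ, h, h3]

/-- If `q' < r` then `rhe(r)` is smaller than `NBT(q')`. -/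
theorem rotSeq_lt_NBT {q' r : ℚ} (hq : 0 < q') (hr2 : r ≤ 1 / 2) (h : q' < r) :
    ULt (rotSeq r) (NBT q') := by
  have hr : 0 < r := hq.trans h
  have hq2 : q' ≤ 1 / 2 := h.le.trans hr2
  have hle : ∀ i, ceilCount q' i ≤ ceilCount r i := by
    intro i
    rcases Nat.eq_zero_or_pos i with rfl | hi
    · rfl
    · rw [ceilCount_of_pos hi, ceilCount_of_pos hi]
      have : ⌈(i : ℚ) * q'⌉ ≤ ⌈(i : ℚ) * r⌉ := by gcongr
      omega
  -- At the denominator of q' the point is an integer, which the open interval (0,iq') excludes but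
  -- (0,ir) contains.
  have hlt : ceilCount q' q'.den < ceilCount r q'.den := by
    rw [ceilCount_den, ceilCount_of_pos q'.den_pos]
    have : q'.num < ⌈(q'.den : ℚ) * r⌉ := by
      rw [Int.lt_ceil, ← mul_den_eq q']
      have : (0 : ℚ) < q'.den := by exact_mod_cast q'.den_pos
      gcongr
    omega
  classical
  have hex : ∃ i, ceilCount q' i < ceilCount r i := ⟨_, hlt⟩
  have hI : Nat.find hex ≤ q'.den := Nat.find_min' hex hlt
  refine ULt.of_counts (x := ceilCount q') (y := ceilCount r) (I := Nat.find hex)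
    (by rw [NBT_of_le hq hq2 (by omega), rotSeq_zero]) rotSeq_zero rfl
    (ceilCount_one hq hq2) rfl (ceilCount_one hr hr2) (ceilCount_monotone hq) ?_ ?_ ?_
    (Nat.find_spec hex)
  · intro i hi
    rw [NBT_of_le hq hq2 (by omega), rotSeq_succ hq hq2]
  · intro i _
    rw [rotSeq_succ hr hr2]
  · intro i hi
    have := Nat.find_min hex hi
    have := hle i
    omega

/-! ### The quotient of a thick interval map has no homtervals -/

namespace ThickInterval

variable (T : ThickInterval)

/-- The interval of horizontal coordinates of the `i`-th strip. -/
def gap (i : Fin T.N) : Set ℝ := Ioo (T.right i.castSucc) (T.left i.succ)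

variable {T}

theorem left_strictMono : StrictMono T.left :=
  Fin.strictMono_iff_lt_succ.2 fun i => (T.left_lt_right _).trans (T.right_lt_left i)

theorem right_lt_left_of_lt {i j : Fin (T.N + 1)} (h : i < j) : T.right i < T.left j := by
  obtain ⟨i', rfl⟩ := Fin.exists_castSucc_eq.2 (h.trans_le (Fin.le_last j)).ne
  exact (T.right_lt_left i').trans_le (left_strictMono.monotone (Fin.castSucc_lt_iff_succ_le.1 h))

theorem left_nonneg (k : Fin (T.N + 1)) : 0 ≤ T.left k := by
  rw [← T.left_first]; exact left_strictMono.monotone (Fin.zero_le k)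

theorem right_le_one (k : Fin (T.N + 1)) : T.right k ≤ 1 := by
  rcases (Fin.le_last k).eq_or_lt with rfl | h
  · exact T.right_last.le
  · rw [← T.right_last]
    exact ((right_lt_left_of_lt h).trans (T.left_lt_right _)).le

theorem left_le_one (k : Fin (T.N + 1)) : T.left k ≤ 1 :=
  (T.left_lt_right k).le.trans (right_le_one k)

theorem right_nonneg (k : Fin (T.N + 1)) : 0 ≤ T.right k :=
  (left_nonneg k).trans (T.left_lt_right k).le

theorem gap_subset (i : Fin T.N) : T.gap i ⊆ Icc 0 1 := fun _ hx =>
  ⟨(right_nonneg _).trans hx.1.le, hx.2.le.trans (left_le_one _)⟩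

theorem not_mem_gap_of_mem_column {i : Fin T.N} {k : Fin (T.N + 1)} {x : ℝ}
    (hx : x ∈ Icc (T.left k) (T.right k)) : x ∉ T.gap i := by
  rintro ⟨h1, h2⟩
  rcases le_or_gt k i.castSucc with h | h
  · rcases h.eq_or_lt with rfl | h
    · exact absurd hx.2 h1.not_ge
    · have := right_lt_left_of_lt h
      have := T.left_lt_right i.castSucc
      linarith [hx.2]
  · have := left_strictMono.monotone (Fin.castSucc_lt_iff_succ_le.1 h)
    linarith [hx.1]

theorem gap_disjoint {i j : Fin T.N} {x : ℝ} (hi : x ∈ T.gap i) (hj : x ∈ T.gap j) : i = j := by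
  have key : ∀ {i j : Fin T.N}, x ∈ T.gap i → x ∈ T.gap j → ¬ i < j := by
    intro i j hi hj h
    have h1 : T.left i.succ ≤ T.left j.castSucc :=
      left_strictMono.monotone (Fin.succ_le_castSucc_iff.2 h)
    have := T.left_lt_right j.castSucc
    linarith [hi.2, hj.1]
  rcases lt_trichotomy i j with h | h | h
  · exact absurd h (key hi hj)
  · exact h
  · exact absurd h (key hj hi)

theorem mem_column_or_gap {x : ℝ} (hx : x ∈ Icc (0 : ℝ) 1) :
    (∃ k, x ∈ Icc (T.left k) (T.right k)) ∨ ∃ i, x ∈ T.gap i := by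
  by_contra! h
  have : ∀ k, T.left k ≤ x := by
    intro k
    induction k using Fin.induction with
    | zero => rw [T.left_first]; exact hx.1
    | succ i ih =>
      by_contra! h'
      refine h.2 i ⟨?_, h'⟩
      by_contra! h''
      exact h.1 _ ⟨ih, h''⟩
  exact h.1 (Fin.last _) ⟨this _, by rw [T.right_last]; exact hx.2⟩

theorem coord_chart {x : ℝ × ℝ} (hx : x ∈ unitSquare) : T.coord (T.chart x) = x :=
  T.chart_injOn.leftInvOn_invFunOn hx

theorem coord_mem {z : ℂ} (hz : z ∈ T.body) : T.coord z ∈ unitSquare :=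
  Function.invFunOn_mem hz

theorem chart_coord {z : ℂ} (hz : z ∈ T.body) : T.chart (T.coord z) = z :=
  Function.invFunOn_eq hz

theorem isCompact_unitSquare : IsCompact unitSquare := isCompact_Icc.prod isCompact_Icc

theorem coord_continuousOn : ContinuousOn T.coord T.body := by
  have : CompactSpace unitSquare := isCompact_iff_compactSpace.1 isCompact_unitSquare
  have hcont : Continuous (unitSquare.domRestrict T.chart) := T.chart_continuousOn.domRestrict
  have hemb := hcont.isClosedEmbedding (injOn_iff_injective.1 T.chart_injOn)
  rw [continuousOn_iff_isClosed]
  intro s hs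
  refine ⟨T.chart '' (unitSquare ∩ s), ?_, ?_⟩
  · have := hemb.isClosedMap _ (hs.preimage continuous_subtype_val)
    convert this using 1
    ext z
    simp only [mem_image, mem_preimage, Subtype.exists, mem_inter_iff]
    constructor
    · rintro ⟨x, ⟨h1, h2⟩, rfl⟩; exact ⟨x, h1, h2, rfl⟩
    · rintro ⟨x, h1, h2, rfl⟩; exact ⟨x, ⟨h1, h2⟩, rfl⟩
  · ext z
    constructor
    · rintro ⟨h1, h2⟩
      exact ⟨⟨T.coord z, ⟨coord_mem h2, h1⟩, chart_coord h2⟩, h2⟩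
    · rintro ⟨⟨x, ⟨h1, h2⟩, rfl⟩, h3⟩
      exact ⟨by simpa [coord_chart h1] using h2, h3⟩

theorem mem_image_column_iff {A : Set ℝ} (hA : A ⊆ Icc 0 1) {z : ℂ} :
    z ∈ T.chart '' (A ×ˢ Icc 0 1) ↔ z ∈ T.body ∧ (T.coord z).1 ∈ A := by
  constructor
  · rintro ⟨x, hx, rfl⟩
    have hx' : x ∈ unitSquare := ⟨hA hx.1, hx.2⟩
    exact ⟨mem_image_of_mem _ hx', by rw [coord_chart hx']; exact hx.1⟩
  · rintro ⟨h1, h2⟩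
    exact ⟨T.coord z, ⟨h2, (coord_mem h1).2⟩, chart_coord h1⟩

theorem mem_strip_iff {i : Fin T.N} {z : ℂ} :
    z ∈ T.strip i ↔ z ∈ T.body ∧ (T.coord z).1 ∈ T.gap i :=
  mem_image_column_iff (gap_subset i)

theorem mem_junction_iff {k : Fin (T.N + 1)} {z : ℂ} :
    z ∈ T.junction k ↔ z ∈ T.body ∧ (T.coord z).1 ∈ Icc (T.left k) (T.right k) :=
  mem_image_column_iff fun _ hx => ⟨(left_nonneg k).trans hx.1, hx.2.trans (right_le_one k)⟩

theorem base_mem {x : ℝ} (hx : x ∈ Icc (0 : ℝ) 1) : (x, (0 : ℝ)) ∈ unitSquare :=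
  ⟨hx, by simp⟩

theorem chart_base_mem {x : ℝ} (hx : x ∈ Icc (0 : ℝ) 1) : T.chart (x, 0) ∈ T.body :=
  mem_image_of_mem _ (base_mem hx)

theorem coord_chart_base {x : ℝ} (hx : x ∈ Icc (0 : ℝ) 1) : (T.coord (T.chart (x, 0))).1 = x := by
  rw [coord_chart (base_mem hx)]

theorem chart_base_continuousOn : ContinuousOn (fun x : ℝ => T.chart (x, 0)) (Icc 0 1) :=
  T.chart_continuousOn.comp (by fun_prop) fun _ hx => base_mem hx

/-- The horizontal coordinates of S form an order-connected set; leaving a gap would mean passing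
through the edge of an adjacent junction. -/
theorem exists_strip_of_preconnected {S : Set ℂ} (hS : IsPreconnected S) (hSb : S ⊆ T.body)
    (hne : S.Nonempty) (hJ : ∀ k, ∀ z ∈ S, z ∉ T.junction k) : ∃ i, S ⊆ T.strip i := by
  have hA : ((fun z => (T.coord z).1) '' S).OrdConnected :=
    (hS.image _ (continuous_fst.comp_continuousOn (coord_continuousOn.mono hSb))).ordConnected
  obtain ⟨z, hz⟩ := hne
  have hcol : ∀ w ∈ S, ∀ k, (T.coord w).1 ∉ Icc (T.left k) (T.right k) := fun w hw k h =>
    hJ k w hw (mem_junction_iff.2 ⟨hSb hw, h⟩)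
  rcases mem_column_or_gap (T := T) (coord_mem (hSb hz)).1 with ⟨k, hk⟩ | ⟨i, hi⟩
  · exact absurd hk (hcol z hz k)
  refine ⟨i, fun w hw => mem_strip_iff.2 ⟨hSb hw, ?_⟩⟩
  constructor
  · by_contra! h
    obtain ⟨w', hw', he⟩ := hA.out (mem_image_of_mem _ hw) (mem_image_of_mem _ hz) ⟨h, hi.1.le⟩
    refine hcol w' hw' i.castSucc ?_
    simp only at he
    rw [he]
    exact ⟨(T.left_lt_right _).le, le_rfl⟩
  · by_contra! h
    obtain ⟨w', hw', he⟩ := hA.out (mem_image_of_mem _ hz) (mem_image_of_mem _ hw) ⟨hi.2.le, h⟩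
    refine hcol w' hw' i.succ ?_
    simp only at he
    rw [he]
    exact ⟨le_rfl, (T.left_lt_right _).le⟩

theorem strip_nonempty (i : Fin T.N) : (T.strip i).Nonempty := by
  obtain ⟨x, hx⟩ := nonempty_Ioo.2 (T.right_lt_left i)
  exact ⟨T.chart (x, 0), mem_strip_iff.2 ⟨chart_base_mem (gap_subset i hx), by
    rw [coord_chart_base (gap_subset i hx)]; exact hx⟩⟩

theorem strip_isPreconnected (i : Fin T.N) : IsPreconnected (T.strip i) :=
  (isPreconnected_Ioo.prod isPreconnected_Icc).image _
    (T.chart_continuousOn.mono (prod_mono (gap_subset i) Subset.rfl))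

end ThickInterval

/-! ### Horizontal expansion against irreducibility of the transition matrix. -/

open ThickInterval

variable {T : ThickInterval} {F : ℂ ≃ₜ ℂ}

theorem IsThickIntervalMap.mapsTo_body (hF : IsThickIntervalMap T F) {z : ℂ} (hz : z ∈ T.body) :
    F z ∈ T.body := interior_subset (hF.image_body (mem_image_of_mem _ hz))

theorem IsThickIntervalMap.iterate_mem_body (hF : IsThickIntervalMap T F) {z : ℂ}
    (hz : z ∈ T.body) (n : ℕ) : F^[n] z ∈ T.body := by
  induction n with
  | zero => exact hz
  | succ n ih => rw [Function.iterate_succ_apply']; exact hF.mapsTo_body ih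

/-- A leaf goes into one decomposition element, and an element that meets a strip is a leaf of that
strip. So membership of images in strips can be tested on the bottom edge of the square. -/
theorem IsThickIntervalMap.mem_strip_of_leaf (hF : IsThickIntervalMap T F) {i j : Fin T.N}
    {z w : ℂ} (hz : z ∈ T.strip i) (hw : w ∈ T.body) (h : (T.coord z).1 = (T.coord w).1)
    (hFz : F z ∈ T.strip j) : F w ∈ T.strip j := by
  rw [mem_strip_iff] at hz
  obtain ⟨D', hD', hsub⟩ := hF.image_leaf (T.chart '' ({(T.coord z).1} ×ˢ Icc (0 : ℝ) 1))
    ⟨i, _, hz.2, rfl⟩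
  have hA : {(T.coord z).1} ⊆ Icc (0 : ℝ) 1 := singleton_subset_iff.2 (gap_subset i hz.2)
  have h1 : F z ∈ D' := hsub (mem_image_of_mem _ ((mem_image_column_iff hA).2 ⟨hz.1, rfl⟩))
  have h2 : F w ∈ D' := hsub (mem_image_of_mem _ ((mem_image_column_iff hA).2 ⟨hw, h.symm⟩))
  rw [mem_strip_iff] at hFz
  rcases hD' with ⟨i', x, hx, rfl⟩ | ⟨k, rfl⟩
  · rw [mem_image_column_iff (singleton_subset_iff.2 (gap_subset i' hx))] at h1 h2
    refine mem_strip_iff.2 ⟨h2.1, ?_⟩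
    rw [mem_singleton_iff.1 h2.2, ← mem_singleton_iff.1 h1.2]
    exact hFz.2
  · exact absurd hFz.2 (not_mem_gap_of_mem_column (mem_junction_iff.1 h1).2)

/-- A strip that crosses another one isometrically is mapped into it. -/
theorem IsThickIntervalMap.strip_mapsTo (hF : IsThickIntervalMap T F) {i j : Fin T.N} {x0 : ℝ}
    (hx0 : x0 ∈ T.gap i) (hj : F (T.chart (x0, 0)) ∈ T.strip j)
    (haff : ∀ C ∈ T.crossings F i j, ∃ σ : ℝ, |σ| = 1 ∧ ∀ z ∈ C, ∀ w ∈ C,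
      (T.stripCoord j (F z)).1 - (T.stripCoord j (F w)).1 =
          σ * ((T.stripCoord i z).1 - (T.stripCoord i w).1)) :
    ∀ z ∈ T.strip i, F z ∈ T.strip j := by
  set H : ℝ → ℝ := fun x => (T.coord (F (T.chart (x, 0)))).1 with hH
  have hHc : ContinuousOn H (Icc 0 1) :=
    continuous_fst.comp_continuousOn (coord_continuousOn.comp
      (F.continuous.comp_continuousOn chart_base_continuousOn)
      fun x hx => hF.mapsTo_body (chart_base_mem hx))
  have hO : IsOpen (T.gap i ∩ H ⁻¹' T.gap j) :=
    (hHc.mono (gap_subset i)).isOpen_inter_preimage isOpen_Ioo isOpen_Ioo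
  set O := T.gap i ∩ H ⁻¹' T.gap j with hOdef
  have hx0O : x0 ∈ O := ⟨hx0, (mem_strip_iff.1 hj).2⟩
  set g := T.right i.castSucc with hg
  set G := T.left i.succ with hG
  set g' := T.right j.castSucc with hg'
  set G' := T.left j.succ with hG'
  have hgG : g < G := T.right_lt_left i
  have hgG' : g' < G' := T.right_lt_left j
  have hGO : G ∉ O := fun h => lt_irrefl _ h.1.2
  have hgO : g ∉ O := fun h => lt_irrefl _ h.1.1
  -- α and β bound the maximal interval around `x0` whose points are sent into the target gap.
  have hβ := (isClosed_Ici.inter hO.isClosed_compl).csInf_mem (s := Ici x0 ∩ Oᶜ)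
    ⟨G, hx0.2.le, hGO⟩ ⟨x0, fun _ h => h.1⟩
  have hα := (isClosed_Iic.inter hO.isClosed_compl).csSup_mem (s := Iic x0 ∩ Oᶜ)
    ⟨g, hx0.1.le, hgO⟩ ⟨x0, fun _ h => h.1⟩
  have hβG : sInf (Ici x0 ∩ Oᶜ) ≤ G := csInf_le ⟨x0, fun _ h => h.1⟩ ⟨hx0.2.le, hGO⟩
  have hgα : g ≤ sSup (Iic x0 ∩ Oᶜ) := le_csSup ⟨x0, fun _ h => h.1⟩ ⟨hx0.1.le, hgO⟩
  have hβlt : ∀ x, x0 ≤ x → x < sInf (Ici x0 ∩ Oᶜ) → x ∈ O := fun x h1 h2 => by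
    by_contra h; exact h2.not_ge (csInf_le ⟨x0, fun _ h => h.1⟩ ⟨h1, h⟩)
  have hαlt : ∀ x, x ≤ x0 → sSup (Iic x0 ∩ Oᶜ) < x → x ∈ O := fun x h1 h2 => by
    by_contra h; exact h2.not_ge (le_csSup ⟨x0, fun _ h => h.1⟩ ⟨h1, h⟩)
  set β := sInf (Ici x0 ∩ Oᶜ)
  set α := sSup (Iic x0 ∩ Oᶜ)
  have hαx : α < x0 := lt_of_le_of_ne hα.1 fun h => hα.2 (h ▸ hx0O)
  have hxβ : x0 < β := lt_of_le_of_ne hβ.1 fun h => hβ.2 (h ▸ hx0O)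
  have hIoo : Ioo α β ⊆ O := fun x hx => by
    rcases le_total x x0 with h | h
    · exact hαlt x h hx.1
    · exact hβlt x h hx.2
  have hIcc : Icc α β ⊆ Icc 0 1 := Icc_subset_Icc ((right_nonneg _).trans hgα)
    (hβG.trans (left_le_one _))
  have hjunc : ∀ k, ∀ x ∈ Icc (T.left k) (T.right k), x ∈ Icc (0 : ℝ) 1 → H x ∉ T.gap j := by
    intro k x hx hx1
    obtain ⟨k', hk'⟩ := hF.image_junction k
    have h1 : F (T.chart (x, 0)) ∈ T.junction k' := hk' (mem_image_of_mem _
      (mem_junction_iff.2 ⟨chart_base_mem hx1, by rw [coord_chart_base hx1]; exact hx⟩))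
    exact not_mem_gap_of_mem_column (mem_junction_iff.1 h1).2
  have hHβ : H β ∉ T.gap j := by
    rcases hβG.eq_or_lt with h | h
    · exact hjunc i.succ β ⟨h.ge, h.le.trans (T.left_lt_right _).le⟩
        (hIcc ⟨(hαx.trans hxβ).le, le_rfl⟩)
    · exact fun h' => hβ.2 ⟨⟨hx0.1.trans hxβ, h⟩, h'⟩
  have hHα : H α ∉ T.gap j := by
    rcases hgα.eq_or_lt with h | h
    · exact hjunc i.castSucc α ⟨(T.left_lt_right _).le.trans h.le, h.ge⟩
        (hIcc ⟨le_rfl, (hαx.trans hxβ).le⟩)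
    · exact fun h' => hα.2 ⟨⟨h, hαx.trans hx0.2⟩, h'⟩
  have hclos : closure (Ioo α β) = Icc α β := closure_Ioo (hαx.trans hxβ).ne
  have hHmem : ∀ x ∈ Icc α β, H x ∈ Icc g' G' := by
    intro x hx
    have h1 : MapsTo H (Ioo α β) (Icc g' G') := fun y hy => Ioo_subset_Icc_self (hIoo hy).2
    have h2 := h1.closure_of_continuousOn (by rw [hclos]; exact hHc.mono hIcc)
    rw [hclos, isClosed_Icc.closure_eq] at h2
    exact h2 hx
  have hS : ∀ x ∈ Ioo α β, T.chart (x, 0) ∈ T.strip i ∩ F ⁻¹' T.strip j := fun x hx => by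
    have hx1 := gap_subset i (hIoo hx).1
    exact ⟨mem_strip_iff.2 ⟨chart_base_mem hx1, by rw [coord_chart_base hx1]; exact (hIoo hx).1⟩,
      mem_strip_iff.2 ⟨hF.mapsTo_body (chart_base_mem hx1), (hIoo hx).2⟩⟩
  have hx0I : x0 ∈ Ioo α β := ⟨hαx, hxβ⟩
  obtain ⟨σ, hσ, hlin⟩ := haff _ ⟨_, hS x0 hx0I, rfl⟩
  have hcomp : ∀ x ∈ Ioo α β, T.chart (x, 0) ∈
      connectedComponentIn (T.strip i ∩ F ⁻¹' T.strip j) (T.chart (x0, 0)) := by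
    have h1 : IsPreconnected ((fun x : ℝ => T.chart (x, 0)) '' Ioo α β) :=
      isPreconnected_Ioo.image _ (chart_base_continuousOn.mono (Ioo_subset_Icc_self.trans hIcc))
    have h2 := h1.subset_connectedComponentIn (mem_image_of_mem _ hx0I)
      (by rintro _ ⟨x, hx, rfl⟩; exact hS x hx)
    exact fun x hx => h2 (mem_image_of_mem _ hx)
  have hlinH : EqOn H (fun x => H x0 + σ * ((G' - g') / (G - g)) * (x - x0)) (Ioo α β) := by
    intro x hx
    have h1 := hlin _ (hcomp x hx) _ (hcomp x0 hx0I)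
    simp only [stripCoord] at h1
    rw [coord_chart_base (gap_subset i (hIoo hx).1), coord_chart_base (gap_subset i hx0)] at h1
    change (H x - g') / (G' - g') - (H x0 - g') / (G' - g') =
      σ * ((x - g) / (G - g) - (x0 - g) / (G - g)) at h1
    have e1 : G - g ≠ 0 := (sub_pos.2 hgG).ne'
    have e2 : G' - g' ≠ 0 := (sub_pos.2 hgG').ne'
    rw [← sub_div, ← sub_div, div_eq_iff e2] at h1
    simp only
    have : H x - H x0 = σ * ((G' - g') / (G - g)) * (x - x0) := by
      rw [show H x - H x0 = H x - g' - (H x0 - g') by ring, h1]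
      field_simp
      ring
    linarith
  have hlinI := hlinH.of_subset_closure (hHc.mono hIcc) (by fun_prop) Ioo_subset_Icc_self hclos.ge
  have hle : α ≤ β := (hαx.trans hxβ).le
  have hdiff : H β - H α = σ * ((G' - g') / (G - g)) * (β - α) := by
    rw [hlinI ⟨hle, le_rfl⟩, hlinI ⟨le_rfl, hle⟩]; ring
  have habs : |H β - H α| = (G' - g') / (G - g) * (β - α) := by
    rw [hdiff, abs_mul, abs_mul, hσ, one_mul, abs_of_pos (div_pos (sub_pos.2 hgG') (sub_pos.2 hgG)),
      abs_of_pos (sub_pos.2 (hαx.trans hxβ))]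
  have hpos : 0 < |H β - H α| := by
    rw [habs]
    exact mul_pos (div_pos (sub_pos.2 hgG') (sub_pos.2 hgG)) (sub_pos.2 (hαx.trans hxβ))
  have hend : ∀ x ∈ Icc α β, H x ∉ T.gap j → H x = g' ∨ H x = G' := by
    intro x hx h
    have h1 := hHmem x hx
    by_contra! h2
    exact h ⟨lt_of_le_of_ne h1.1 h2.1.symm, lt_of_le_of_ne h1.2 h2.2⟩
  -- At α and β the image has left the open gap, hence sits at its ends. As H is affine and not
  -- constant, it runs from one end to the other; unit stretch then gives the source interval full
  -- length.
  have hfull : |H β - H α| = G' - g' := by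
    rcases hend β ⟨hle, le_rfl⟩ hHβ with h1 | h1 <;> rcases hend α ⟨le_rfl, hle⟩ hHα with h2 | h2 <;>
      rw [h1, h2] at hpos ⊢
    · simp at hpos
    · rw [abs_sub_comm, abs_of_pos (sub_pos.2 hgG')]
    · rw [abs_of_pos (sub_pos.2 hgG')]
    · simp at hpos
  have hlen : β - α = G - g := by
    rw [habs, div_mul_eq_mul_div, div_eq_iff (sub_pos.2 hgG).ne'] at hfull
    exact mul_left_cancel₀ (sub_pos.2 hgG').ne' hfull
  have hαg : α = g := by linarith
  have hβG' : β = G := by linarith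
  intro z hz
  have hz' := mem_strip_iff.1 hz
  have hzc : (T.coord z).1 ∈ Ioo α β := by rw [hαg, hβG']; exact hz'.2
  exact hF.mem_strip_of_leaf (hS _ hzc).1 hz'.1 (coord_chart_base (gap_subset i hz'.2)) (hS _ hzc).2

/-- The columns of M indexed by these strips are standard basis vectors, and so are those of all its
powers. A positive power then leaves room for a single strip, and M = (1). -/
theorem IsMIA.not_permuted (h : IsMIA T F) (i : ℕ → Fin T.N)
    (hi : ∀ n, ∀ z ∈ T.strip (i n), F z ∈ T.strip (i (n + 1))) : False := by
  classical
  obtain ⟨hne, k, -, hpos⟩ := h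
  have hcol : ∀ n j, T.transitionMatrix F j (i n) = if j = i (n + 1) then 1 else 0 := by
    intro n j
    unfold transitionMatrix
    split_ifs with hj
    · subst hj
      have hS : T.strip (i n) ∩ F ⁻¹' T.strip (i (n + 1)) = T.strip (i n) :=
        inter_eq_left.2 (hi n)
      have : T.crossings F (i n) (i (n + 1)) = {T.strip (i n)} := by
        ext C
        simp only [crossings, hS, mem_ofPred_eq, mem_singleton_iff]
        constructor
        · rintro ⟨z, hz, rfl⟩
          exact (strip_isPreconnected _).connectedComponentIn hz
        · rintro rfl
          obtain ⟨z, hz⟩ := strip_nonempty (i n)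
          exact ⟨z, hz, ((strip_isPreconnected _).connectedComponentIn hz).symm⟩
      rw [this, ncard_singleton]
    · have : T.crossings F (i n) j = ∅ := by
        rw [eq_empty_iff_forall_notMem]
        rintro C ⟨z, hz, -⟩
        exact hj (gap_disjoint (mem_strip_iff.1 hz.2).2 (mem_strip_iff.1 (hi n z hz.1)).2)
      rw [this, ncard_empty]
  have hpow : ∀ k n j, (T.transitionMatrix F ^ k) j (i n) = if j = i (n + k) then 1 else 0 := by
    intro k
    induction k with
    | zero => intro n j; simp [Matrix.one_apply]
    | succ k ih =>
      intro n j
      rw [pow_succ, Matrix.mul_apply]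
      simp only [hcol, mul_ite, mul_one, mul_zero, Finset.sum_ite_eq', Finset.mem_univ, if_true]
      rw [ih, show n + 1 + k = n + (k + 1) by omega]
  have hall : ∀ j, j = i (0 + k) := by
    intro j
    by_contra hj
    have := hpos j (i 0)
    rw [hpow, if_neg hj] at this
    exact lt_irrefl _ this
  apply hne
  ext j j'
  rw [hall j', ← hall (i 0), hcol 0, Matrix.one_apply, if_pos ((hall j).trans (hall _).symm),
    if_pos ((hall j).trans (hall _).symm)]

/-- Under iteration, every horizontal segment of the thick interval meets the junctions. -/
theorem IsThickIntervalMap.exists_mem_junction (hF : IsThickIntervalMap T F) (hMIA : IsMIA T F)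
    {u v : ℝ} (hu : 0 ≤ u) (huv : u < v) (hv : v ≤ 1) :
    ∃ n k, ∃ w ∈ Icc u v, F^[n] (T.chart (w, 0)) ∈ T.junction k := by
  by_contra! hcon
  have hsub : Icc u v ⊆ Icc 0 1 := Icc_subset_Icc hu hv
  set S : ℕ → Set ℂ := fun n => (fun w => F^[n] (T.chart (w, 0))) '' Icc u v with hSdef
  have hSpre : ∀ n, IsPreconnected (S n) := fun n => isPreconnected_Icc.image _
    ((F.continuous.iterate n).comp_continuousOn (chart_base_continuousOn.mono hsub))
  have hSne : ∀ n, (S n).Nonempty := fun n => (nonempty_Icc.2 huv.le).image _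
  have hex : ∀ n, ∃ i, S n ⊆ T.strip i := fun n => exists_strip_of_preconnected (hSpre n)
    (by rintro _ ⟨w, hw, rfl⟩; exact hF.iterate_mem_body (chart_base_mem (hsub hw)) n)
    (hSne n) (by rintro k _ ⟨w, hw, rfl⟩; exact hcon n k w hw)
  choose i hi using hex
  obtain ⟨lam, mu, hlam, hlin⟩ := hF.linear
  set zu := T.chart (u, 0)
  set zv := T.chart (v, 0)
  have hSn : ∀ n, S n ⊆ T.strip (i n) ∩ F ⁻¹' T.strip (i (n + 1)) := by
    rintro n _ ⟨w, hw, rfl⟩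
    refine ⟨hi n ⟨w, hw, rfl⟩, ?_⟩
    have := hi (n + 1) ⟨w, hw, rfl⟩
    simpa only [mem_preimage, Function.iterate_succ_apply'] using this
  have hu' : ∀ n, F^[n] zu ∈ S n := fun n => ⟨u, ⟨le_rfl, huv.le⟩, rfl⟩
  have hv' : ∀ n, F^[n] zv ∈ S n := fun n => ⟨v, ⟨huv.le, le_rfl⟩, rfl⟩
  set l : ℕ → ℝ := fun n =>
    |(T.stripCoord (i n) (F^[n] zv)).1 - (T.stripCoord (i n) (F^[n] zu)).1| with hl
  -- The n-th image of the segment lies in one crossing component, so its width in strip coordinates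
  -- is multiplied by the factor of the next strip.
  have hrec : ∀ n, l (n + 1) = lam (i (n + 1)) * l n := by
    intro n
    obtain ⟨σ, τ, hσ, -, h⟩ := hlin (i n) (i (n + 1)) _ ⟨_, hSn n (hu' n), rfl⟩
    have hC := (hSpre n).subset_connectedComponentIn (hu' n) (hSn n)
    have h1 := (h _ (hC (hv' n)) _ (hC (hu' n))).1
    simp only [hl, Function.iterate_succ_apply']
    rw [h1, abs_mul, hσ]
  have hpos : ∀ n, 0 < l n := by
    intro n
    induction n with
    | zero =>
      have hg := T.right_lt_left (i 0)
      simp only [hl, stripCoord, Function.iterate_zero, id, zu, zv]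
      rw [coord_chart_base ⟨hu, huv.le.trans hv⟩, coord_chart_base ⟨hu.trans huv.le, hv⟩, ← sub_div,
        abs_pos]
      exact div_ne_zero (by linarith) (by linarith)
    | succ n ih => rw [hrec]; exact mul_pos (one_pos.trans_le (hlam _).1) ih
  have hmono : Monotone l := monotone_nat_of_le_succ fun n => by
    rw [hrec]; exact le_mul_of_one_le_left (hpos n).le (hlam _).1
  have hbdd : ∀ n, l n ≤ 1 := by
    intro n
    have hmem : ∀ z ∈ S n, (T.stripCoord (i n) z).1 ∈ Icc (0 : ℝ) 1 := by
      intro z hz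
      have h1 := (mem_strip_iff.1 (hi n hz)).2
      have hg := T.right_lt_left (i n)
      simp only [stripCoord]
      exact ⟨div_nonneg (by linarith [h1.1]) (by linarith),
        (div_le_one (by linarith)).2 (by linarith [h1.2])⟩
    have h1 := hmem _ (hu' n)
    have h2 := hmem _ (hv' n)
    simp only [hl]
    rw [abs_le]
    constructor <;> linarith [h1.1, h1.2, h2.1, h2.2]
  have hlim := tendsto_atTop_ciSup hmono ⟨1, by rintro _ ⟨n, rfl⟩; exact hbdd n⟩
  have hLpos : 0 < ⨆ n, l n :=
    (hpos 0).trans_le (le_ciSup ⟨1, by rintro _ ⟨n, rfl⟩; exact hbdd n⟩ 0)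
  have hratio : Tendsto (fun n => lam (i (n + 1))) atTop (𝓝 1) := by
    have h1 := ((tendsto_add_atTop_iff_nat 1).2 hlim).div hlim hLpos.ne'
    rw [div_self hLpos.ne'] at h1
    refine h1.congr fun n => ?_
    simp only [Pi.div_apply]
    rw [hrec, mul_div_cancel_right₀ _ (hpos n).ne']
  -- The widths increase and stay at most 1, so the ratios tend to 1; there are only finitely many
  -- factors, so they are eventually equal to 1.
  have hev : ∀ᶠ n in atTop, lam (i (n + 1)) = 1 := by
    have hfin : ({x | x ∈ range lam ∧ x ≠ 1}).Finite := (finite_range lam).subset fun _ h => h.1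
    have hnhds : {x | x ∈ range lam ∧ x ≠ 1}ᶜ ∈ 𝓝 (1 : ℝ) :=
      hfin.isClosed.isOpen_compl.mem_nhds (by simp)
    filter_upwards [hratio hnhds] with n hn
    by_contra h
    exact hn ⟨mem_range_self _, h⟩
  obtain ⟨K, hK⟩ := eventually_atTop.1 hev
  refine hMIA.not_permuted (fun n => i (K + n)) fun n => ?_
  have hlast : F^[K + n] zu ∈ T.strip (i (K + n)) := hi _ (hu' _)
  have hlast' := mem_strip_iff.1 hlast
  have hc1 := gap_subset _ hlast'.2
  refine hF.strip_mapsTo hlast'.2 ?_ ?_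
  · exact hF.mem_strip_of_leaf hlast (chart_base_mem hc1) (coord_chart_base hc1).symm
      (hSn _ (hu' _)).2
  · intro C hC
    obtain ⟨σ, τ, hσ, -, h⟩ := hlin _ _ C hC
    exact ⟨σ, by rw [hσ]; exact hK (K + n) (Nat.le_add_right _ _), fun z hz w hw => (h z hz w hw).1⟩

/-- The quotient map has a finite forward invariant set that every interval meets under
iteration. -/
theorem IsQuotient.exists_finite_invariant {f : ℝ → ℝ} {a b : ℝ} (h : IsQuotient T F f a b)
    (hF : IsThickIntervalMap T F) (hMIA : IsMIA T F) :
    ∃ A : Set ℝ, A.Finite ∧ MapsTo f A A ∧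
      ∀ x y, a ≤ x → x < y → y ≤ b → ∃ n, ∃ z ∈ Icc x y, f^[n] z ∈ A := by
  obtain ⟨pr, hprc, himg, hpr, hconj⟩ := h
  have hcol : ∀ {z w}, z ∈ T.body → w ∈ T.body → (T.coord z).1 = (T.coord w).1 → pr z = pr w := by
    intro z w hz hw hzw
    rw [hpr z hz w hw]
    refine ⟨0, ?_⟩
    rw [hzw, uIcc_self]
    rcases mem_column_or_gap (T := T) (coord_mem hw).1 with ⟨k, hk⟩ | ⟨i, hi⟩
    · refine ⟨_, Or.inr ⟨k, rfl⟩, fun u hu hu' => mem_junction_iff.2 ⟨hu, ?_⟩⟩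
      have h1 : (T.coord u).1 = (T.coord w).1 := hu'
      exact h1 ▸ hk
    · exact ⟨_, Or.inl ⟨i, _, hi, rfl⟩, fun u hu hu' =>
        (mem_image_column_iff (singleton_subset_iff.2 (gap_subset i hi))).2 ⟨hu, hu'⟩⟩
  have hjun : ∀ {k z w}, z ∈ T.junction k → w ∈ T.junction k → pr z = pr w := by
    intro k z w hz hw
    rw [mem_junction_iff] at hz hw
    rw [hpr z hz.1 w hw.1]
    refine ⟨0, _, Or.inr ⟨k, rfl⟩, fun u hu hu' => mem_junction_iff.2 ⟨hu, ?_⟩⟩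
    exact ordConnected_Icc.uIcc_subset hz.2 hw.2 hu'
  set κ : ℝ → ℝ := fun t => pr (T.chart (t, 0)) with hκ
  have hκc : ContinuousOn κ (Icc 0 1) :=
    hprc.comp chart_base_continuousOn fun _ hx => chart_base_mem hx
  have hκconst : ∀ t ∈ Icc (0 : ℝ) 1, ∀ t' ∈ Icc (0 : ℝ) 1, κ t = κ t' →
      ∀ w ∈ uIcc t t', κ w = κ t := by
    intro t ht t' ht' he w hw
    have hw1 : w ∈ Icc (0 : ℝ) 1 := ordConnected_Icc.uIcc_subset ht ht' hw
    obtain ⟨n, D, hD, hall⟩ := (hpr _ (chart_base_mem ht) _ (chart_base_mem ht')).1 he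
    refine ((hpr _ (chart_base_mem ht) _ (chart_base_mem hw1)).2 ⟨n, D, hD, fun u hu hu' => ?_⟩).symm
    refine hall u hu ?_
    rw [coord_chart_base ht, coord_chart_base ht'] at *
    rw [coord_chart_base hw1] at hu'
    exact uIcc_subset_uIcc left_mem_uIcc hw hu'
  -- The fibres of κ are intervals, so κ is monotone in one direction or the other. Since the
  -- direction is not prescribed, this is expressed as betweenness.
  have hκbet : ∀ t ∈ Icc (0 : ℝ) 1, ∀ t' ∈ Icc (0 : ℝ) 1, ∀ w ∈ uIcc t t',
      κ w ∈ uIcc (κ t) (κ t') := by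
    intro t ht t' ht' w hw
    have hw1 : w ∈ Icc (0 : ℝ) 1 := ordConnected_Icc.uIcc_subset ht ht' hw
    by_contra hn
    have h1 : κ t ∈ uIcc (κ w) (κ t') ∨ κ t' ∈ uIcc (κ w) (κ t) := by
      rw [mem_uIcc] at hn ⊢
      rw [mem_uIcc]
      by_contra! h2
      rcases le_total (κ t) (κ t') with h3 | h3 <;> rcases le_total (κ w) (κ t) with h4 | h4 <;>
        rcases le_total (κ w) (κ t') with h5 | h5 <;> grind
    rcases h1 with h1 | h1
    · obtain ⟨r, hr, hre⟩ := intermediate_value_uIcc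
        (hκc.mono (ordConnected_Icc.uIcc_subset hw1 ht')) h1
      have hr1 : r ∈ Icc (0 : ℝ) 1 := ordConnected_Icc.uIcc_subset hw1 ht' hr
      have hwr : w ∈ uIcc t r := by rw [mem_uIcc] at hw hr ⊢; grind
      rw [hκconst t ht r hr1 hre.symm w hwr] at hn
      exact hn left_mem_uIcc
    · obtain ⟨r, hr, hre⟩ := intermediate_value_uIcc
        (hκc.mono (ordConnected_Icc.uIcc_subset hw1 ht)) h1
      have hr1 : r ∈ Icc (0 : ℝ) 1 := ordConnected_Icc.uIcc_subset hw1 ht hr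
      have hwr : w ∈ uIcc t' r := by rw [mem_uIcc] at hw hr ⊢; grind
      rw [hκconst t' ht' r hr1 hre.symm w hwr] at hn
      exact hn right_mem_uIcc
  have hiter : ∀ n, ∀ z ∈ T.body, f^[n] (pr z) = pr (F^[n] z) := by
    intro n
    induction n with
    | zero => intro z _; rfl
    | succ n ih =>
      intro z hz
      rw [Function.iterate_succ_apply, ← hconj z hz, ih _ (hF.mapsTo_body hz),
        Function.iterate_succ_apply]
  have hbase : ∀ k, T.chart (T.left k, 0) ∈ T.junction k := fun k => by
    have h1 : T.left k ∈ Icc (0 : ℝ) 1 := ⟨left_nonneg k, left_le_one k⟩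
    exact mem_junction_iff.2 ⟨chart_base_mem h1, by
      rw [coord_chart_base h1]; exact ⟨le_rfl, (T.left_lt_right k).le⟩⟩
  -- The invariant set consists of the points to which the junctions collapse.
  refine ⟨range fun k => κ (T.left k), finite_range _, ?_, ?_⟩
  · rintro _ ⟨k, rfl⟩
    obtain ⟨k', hk'⟩ := hF.image_junction k
    refine ⟨k', ?_⟩
    simp only [hκ]
    rw [← hconj _ (mem_junction_iff.1 (hbase k)).1]
    exact hjun (hbase k') (hk' (mem_image_of_mem _ (hbase k)))
  · intro x y hx hxy hy
    have hsurj : ∀ r ∈ Icc a b, ∃ t ∈ Icc (0 : ℝ) 1, κ t = r := by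
      intro r hr
      rw [← himg] at hr
      obtain ⟨z, hz, rfl⟩ := hr
      have h1 := (coord_mem hz).1
      exact ⟨_, h1, hcol (chart_base_mem h1) hz (coord_chart_base h1)⟩
    obtain ⟨t, ht, htx⟩ := hsurj x ⟨hx, hxy.le.trans hy⟩
    obtain ⟨t', ht', hty⟩ := hsurj y ⟨hx.trans hxy.le, hy⟩
    have hne : t ≠ t' := by rintro rfl; exact hxy.ne (htx.symm.trans hty)
    obtain ⟨n, k, w, hw, hwk⟩ := hF.exists_mem_junction hMIA (u := min t t') (v := max t t')
      (le_min ht.1 ht'.1) (min_lt_max.2 hne) (max_le ht.2 ht'.2)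
    have hw1 : w ∈ Icc (0 : ℝ) 1 := ordConnected_Icc.uIcc_subset ht ht' hw
    refine ⟨n, κ w, ?_, k, ?_⟩
    · have := hκbet t ht t' ht' w hw
      rwa [htx, hty, uIcc_of_le hxy.le] at this
    · rw [hiter n _ (chart_base_mem hw1)]
      exact hjun (hbase k) hwk

/-! ### Itineraries of unimodal maps without homtervals -/

/-- Every interval contains a preimage of the turning point in its interior. -/
def HitsTurningPoint (f : ℝ → ℝ) (a b c : ℝ) : Prop :=
  ∀ x y, a ≤ x → x < y → y ≤ b → ∃ n, ∃ z ∈ Ioo x y, f^[n] z = c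

namespace IsUnimodal

variable {f : ℝ → ℝ} {a b c : ℝ}

theorem lt (hf : IsUnimodal f a b c) : a < b := hf.lt_left.trans hf.lt_right

theorem mapsTo (hf : IsUnimodal f a b c) : MapsTo f (Icc a b) (Icc a b) := by
  rw [mapsTo_iff_image_subset, hf.image_eq]

theorem iterate_mem (hf : IsUnimodal f a b c) {x : ℝ} (hx : x ∈ Icc a b) (n : ℕ) :
    f^[n] x ∈ Icc a b := hf.mapsTo.iterate n hx

theorem iterate_continuousOn (hf : IsUnimodal f a b c) (n : ℕ) :
    ContinuousOn f^[n] (Icc a b) := by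
  induction n with
  | zero => exact continuousOn_id
  | succ n ih =>
    rw [Function.iterate_succ']
    exact hf.continuousOn.comp ih fun x hx => hf.iterate_mem hx n

theorem le_map_turning (hf : IsUnimodal f a b c) {x : ℝ} (hx : x ∈ Icc a b) : f x ≤ f c := by
  rcases le_total x c with h | h
  · exact hf.strictMonoOn.monotoneOn ⟨hx.1, h⟩ ⟨hf.lt_left.le, le_rfl⟩ h
  · exact hf.strictAntiOn.antitoneOn ⟨le_rfl, hf.lt_right.le⟩ ⟨h, hx.2⟩ h

theorem map_turning (hf : IsUnimodal f a b c) : f c = b := by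
  refine le_antisymm (hf.mapsTo ⟨hf.lt_left.le, hf.lt_right.le⟩).2 ?_
  have hb : b ∈ f '' Icc a b := by rw [hf.image_eq]; exact ⟨hf.lt.le, le_rfl⟩
  obtain ⟨x, hx, hxb⟩ := hb
  rw [← hxb]
  exact hf.le_map_turning hx

theorem map_lt (hf : IsUnimodal f a b c) {x : ℝ} (hx : x ∈ Icc a b) (hxc : x ≠ c) : f x < b := by
  rw [← hf.map_turning]
  rcases lt_or_gt_of_ne hxc with h | h
  · exact hf.strictMonoOn ⟨hx.1, h.le⟩ ⟨hf.lt_left.le, le_rfl⟩ h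
  · exact hf.strictAntiOn ⟨le_rfl, hf.lt_right.le⟩ ⟨h.le, hx.2⟩ h

theorem turning_mem_of_map_eq (hf : IsUnimodal f a b c) {x y : ℝ} (hx : x ∈ Icc a b)
    (hy : y ∈ Icc a b) (hxy : x < y) (h : f x = f y) : x < c ∧ c < y := by
  constructor
  · by_contra! h1
    exact (hf.strictAntiOn ⟨h1, hx.2⟩ ⟨h1.trans hxy.le, hy.2⟩ hxy).ne' h
  · by_contra! h1
    exact (hf.strictMonoOn ⟨hx.1, hxy.le.trans h1⟩ ⟨hy.1, h1⟩ hxy).ne h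

/-- A unimodal map identifies two points only when they lie on opposite sides of c. The intermediate
value theorem would then produce a point of the open interval that hits c at that time. -/
theorem iterate_injOn (hf : IsUnimodal f a b c) {x y : ℝ} (hx : a ≤ x) (hy : y ≤ b) (n : ℕ)
    (h : ∀ i < n, ∀ z ∈ Ioo x y, f^[i] z ≠ c) : InjOn f^[n] (Icc x y) := by
  have hsub : Icc x y ⊆ Icc a b := Icc_subset_Icc hx hy
  induction n with
  | zero => exact injOn_id _
  | succ n ih =>
    have key : ∀ u ∈ Icc x y, ∀ v ∈ Icc x y, f^[n + 1] u = f^[n + 1] v → ¬ f^[n] u < f^[n] v := by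
      intro u hu v hv he hlt
      rw [Function.iterate_succ_apply', Function.iterate_succ_apply'] at he
      obtain ⟨h1, h2⟩ := hf.turning_mem_of_map_eq (hf.iterate_mem (hsub hu) n)
        (hf.iterate_mem (hsub hv) n) hlt he
      have hcont : ContinuousOn f^[n] (uIcc u v) :=
        (hf.iterate_continuousOn n).mono ((ordConnected_Icc.uIcc_subset hu hv).trans hsub)
      obtain ⟨z, hz, hzc⟩ := intermediate_value_uIcc hcont
        (mem_uIcc_of_le h1.le h2.le)
      have hzu : z ≠ u := by rintro rfl; exact h1.ne hzc
      have hzv : z ≠ v := by rintro rfl; exact h2.ne' hzc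
      refine h n (by omega) z ?_ hzc
      rcases mem_uIcc.1 hz with hz | hz
      · exact ⟨hu.1.trans_lt (lt_of_le_of_ne hz.1 hzu.symm), (lt_of_le_of_ne hz.2 hzv).trans_le hv.2⟩
      · exact ⟨hv.1.trans_lt (lt_of_le_of_ne hz.1 hzv.symm), (lt_of_le_of_ne hz.2 hzu).trans_le hu.2⟩
    intro u hu v hv he
    refine ih (fun i hi => h i (by omega)) hu hv ?_
    exact le_antisymm (not_lt.1 (key v hv u hu he.symm)) (not_lt.1 (key u hu v hv he))

/-- On an interval that never hits c all iterates are injective. It contains infinitely many points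
that land in A, so |A| + 1 of them can be pushed to a common time and would inject into A. -/
theorem hitsTurningPoint (hf : IsUnimodal f a b c) {A : Set ℝ} (hA : A.Finite)
    (hfA : MapsTo f A A)
    (h : ∀ x y, a ≤ x → x < y → y ≤ b → ∃ n, ∃ z ∈ Icc x y, f^[n] z ∈ A) :
    HitsTurningPoint f a b c := by
  intro x y hx hxy hy
  by_contra! hcon
  have hinj : ∀ n, InjOn f^[n] (Icc x y) := fun n =>
    hf.iterate_injOn hx hy n fun i _ => hcon i
  set E : Set ℝ := {z | z ∈ Icc x y ∧ ∃ n, f^[n] z ∈ A} with hE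
  have hinf : E.Infinite := by
    intro hfin
    have h1 : (Ioo x y \ E).Nonempty := ((Ioo_infinite hxy).sdiff hfin).nonempty
    obtain ⟨r, hr, hrE⟩ := h1
    have hopen : IsOpen (Ioo x y \ E) := isOpen_Ioo.sdiff hfin.isClosed
    obtain ⟨l, u, hlu, hsub⟩ := mem_nhds_iff_exists_Ioo_subset.1 (hopen.mem_nhds ⟨hr, hrE⟩)
    obtain ⟨r', hr'⟩ := nonempty_Ioo.2 hlu.2
    have hsub' : Icc r r' ⊆ Ioo l u := fun t ht => ⟨hlu.1.trans_le ht.1, ht.2.trans_lt hr'.2⟩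
    have hr'2 := hsub (hsub' ⟨hr'.1.le, le_rfl⟩)
    obtain ⟨n, z, hz, hzA⟩ := h r r' (hx.trans hr.1.le) hr'.1 (hr'2.1.2.le.trans hy)
    have hz2 := hsub (hsub' hz)
    exact hz2.2 ⟨Ioo_subset_Icc_self hz2.1, n, hzA⟩
  obtain ⟨S, hSE, hcard⟩ := hinf.exists_subset_card_eq (hA.toFinset.card + 1)
  have hex : ∀ z ∈ S, ∃ n, f^[n] z ∈ A := fun z hz => (hSE hz).2
  choose! n hn using hex
  set M := S.sup n
  have hmem : ∀ z ∈ S, f^[M] z ∈ A := by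
    intro z hz
    have h1 : n z ≤ M := Finset.le_sup hz
    rw [show M = (M - n z) + n z by omega, Function.iterate_add_apply]
    exact hfA.iterate _ (hn z hz)
  have := Finset.card_le_card_of_injOn f^[M] (fun z hz => hA.mem_toFinset.2 (hmem z hz))
    ((hinj M).mono fun z hz => (hSE hz).1)
  omega

end IsUnimodal

section Itinerary

variable {f : ℝ → ℝ} {a b c : ℝ}

theorem itinerary_eq_zero {x : ℝ} {j : ℕ} : itinerary f c x j = 0 ↔ f^[j] x < c := by
  unfold itinerary; split_ifs with h <;> simp [h]

theorem itinerary_eq_one {x : ℝ} {j : ℕ} : itinerary f c x j = 1 ↔ c ≤ f^[j] x := by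
  unfold itinerary; split_ifs with h
  · simpa using h
  · simpa using h

theorem itinerary_add (x : ℝ) (j n : ℕ) :
    itinerary f c x (j + n) = itinerary f c (f^[n] x) j := by
  unfold itinerary; rw [Function.iterate_add_apply]

/-- Each symbol 1 means that the decreasing branch is applied and reverses the order once, so the
parity of the common prefix decides. -/
theorem IsUnimodal.lt_of_itinerary (hf : IsUnimodal f a b c) (k : ℕ) :
    ∀ x ∈ Icc a b, ∀ y ∈ Icc a b, (∀ j < k, itinerary f c x j = itinerary f c y j) →
      itinerary f c x k = 0 → itinerary f c y k = 1 →
      (Even (∑ j ∈ Finset.range k, (itinerary f c x j : ℕ)) → x < y) ∧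
      (¬ Even (∑ j ∈ Finset.range k, (itinerary f c x j : ℕ)) → y < x) := by
  induction k with
  | zero =>
    intro x _ y _ _ h0 h1
    rw [itinerary_eq_zero] at h0
    rw [itinerary_eq_one] at h1
    exact ⟨fun _ => h0.trans_le h1, fun h => by simp at h⟩
  | succ k ih =>
    intro x hx y hy hj h0 h1
    have hxs : ∀ j, itinerary f c x (j + 1) = itinerary f c (f x) j := fun j => itinerary_add x j 1
    have hys : ∀ j, itinerary f c y (j + 1) = itinerary f c (f y) j := fun j => itinerary_add y j 1
    have ih' := ih (f x) (hf.mapsTo hx) (f y) (hf.mapsTo hy)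
      (fun j hjk => by rw [← hxs, ← hys]; exact hj _ (by omega)) (by rw [← hxs]; exact h0)
      (by rw [← hys]; exact h1)
    have h00 := hj 0 (by omega)
    rw [Finset.sum_range_succ']
    simp only [hxs]
    rcases fin_two_cases (itinerary f c x 0) with hx0 | hx0
    · have hy0 := h00.symm.trans hx0
      have hxc : x < c := itinerary_eq_zero.1 hx0
      have hyc : y < c := itinerary_eq_zero.1 hy0
      have hmono := hf.strictMonoOn.lt_iff_lt ⟨hx.1, hxc.le⟩ ⟨hy.1, hyc.le⟩
      have hmono' := hf.strictMonoOn.lt_iff_lt ⟨hy.1, hyc.le⟩ ⟨hx.1, hxc.le⟩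
      rw [hx0]
      exact ⟨fun h => hmono.1 (ih'.1 (by simpa using h)), fun h => hmono'.1 (ih'.2 (by simpa using h))⟩
    · have hy0 := h00.symm.trans hx0
      have hxc : c ≤ x := itinerary_eq_one.1 hx0
      have hyc : c ≤ y := itinerary_eq_one.1 hy0
      have hanti := hf.strictAntiOn.lt_iff_gt ⟨hxc, hx.2⟩ ⟨hyc, hy.2⟩
      have hanti' := hf.strictAntiOn.lt_iff_gt ⟨hyc, hy.2⟩ ⟨hxc, hx.2⟩
      rw [hx0]
      constructor
      · intro h
        refine hanti'.1 (ih'.2 ?_)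
        rw [Nat.even_add] at h
        simpa using h
      · intro h
        refine hanti.1 (ih'.1 ?_)
        rw [Nat.even_add] at h
        simpa using h

/-- At the first time an interior point hits c, the iterate is still injective on [x,y], hence
strictly monotone, and puts the end points strictly on opposite sides of c. -/
theorem itinerary_ne (hf : IsUnimodal f a b c) (hc : HitsTurningPoint f a b c) {x y : ℝ}
    (hx : a ≤ x) (hxy : x < y) (hy : y ≤ b) : itinerary f c x ≠ itinerary f c y := by
  classical
  intro he
  have hex : ∃ n, ∃ z ∈ Ioo x y, f^[n] z = c := hc x y hx hxy hy
  obtain ⟨z, hz, hzc⟩ := Nat.find_spec hex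
  have hmin : ∀ i < Nat.find hex, ∀ z ∈ Ioo x y, f^[i] z ≠ c := fun i hi z hz h =>
    Nat.find_min hex hi ⟨z, hz, h⟩
  have hinj := hf.iterate_injOn hx hy _ hmin
  set n := Nat.find hex
  have hcont : ContinuousOn f^[n] (Icc x y) :=
    (hf.iterate_continuousOn n).mono (Icc_subset_Icc hx hy)
  have hside : (f^[n] x < c ∧ c < f^[n] y) ∨ (f^[n] y < c ∧ c < f^[n] x) := by
    rcases hcont.strictMonoOn_of_injOn_Icc' hxy.le hinj with h | h
    · left
      rw [← hzc]
      exact ⟨h ⟨le_rfl, hxy.le⟩ ⟨hz.1.le, hz.2.le⟩ hz.1, h ⟨hz.1.le, hz.2.le⟩ ⟨hxy.le, le_rfl⟩ hz.2⟩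
    · right
      rw [← hzc]
      exact ⟨h ⟨hz.1.le, hz.2.le⟩ ⟨hxy.le, le_rfl⟩ hz.2, h ⟨le_rfl, hxy.le⟩ ⟨hz.1.le, hz.2.le⟩ hz.1⟩
  have hn := congrFun he n
  rcases hside with ⟨h1, h2⟩ | ⟨h1, h2⟩
  · rw [itinerary_eq_zero.2 h1, itinerary_eq_one.2 h2.le] at hn
    simp at hn
  · rw [itinerary_eq_zero.2 h1, itinerary_eq_one.2 h2.le] at hn
    simp at hn

/-- Itineraries are strictly increasing in the unimodal order. -/
theorem itinerary_lt (hf : IsUnimodal f a b c) (hc : HitsTurningPoint f a b c) {x y : ℝ}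
    (hx : a ≤ x) (hxy : x < y) (hy : y ≤ b) : ULt (itinerary f c x) (itinerary f c y) := by
  have hx' : x ∈ Icc a b := ⟨hx, hxy.le.trans hy⟩
  have hy' : y ∈ Icc a b := ⟨hx.trans hxy.le, hy⟩
  obtain ⟨k, hk, hne⟩ := exists_first_diff (itinerary_ne hf hc hx hxy hy)
  refine ⟨k, hk, hne, ?_⟩
  rw [Finset.sum_range_succ]
  rcases fin_two_cases (itinerary f c x k) with h0 | h0 <;>
    rcases fin_two_cases (itinerary f c y k) with h1 | h1
  · exact absurd (h0.trans h1.symm) hne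
  · have := hf.lt_of_itinerary k x hx' y hy' hk h0 h1
    rw [h0]
    by_contra h
    exact hxy.asymm (this.2 (by simpa using h))
  · have := hf.lt_of_itinerary k y hy' x hx' (fun j hj => (hk j hj).symm) h1 h0
    rw [h0, sum_congr_prefix hk, Nat.even_add]
    by_contra h
    exact hxy.asymm (this.1 (by simpa using h))
  · exact absurd (h0.trans h1.symm) hne

end Itinerary

/-! ### Lifts of the outside map -/

/-- The lift of `S¹ → S¹` obtained from the outside map by making it constant on `γ`: the points
`k` are lifts of `â`, the points `1/2 + k` of `b̂`, the points `C + k` of `c_l`, the points `P + k`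
of `p_u`, and the intervals `(k + P - 1, k)` of `γ`. -/
structure IsOutsideLift (L : CircleDeg1Lift) (C P : ℝ) : Prop where
  cont : Continuous L
  C_pos : 0 < C
  C_lt : C < 1 / 2
  half_le : 1 / 2 ≤ P
  P_lt : P < 1
  map_C : L C = 1 / 2
  map_half : L (1 / 2) = 1
  strictMonoOn : StrictMonoOn L (Icc 0 P)
  map_P : L P = L 1

/-- The lift of the arc `γ`. -/
def liftArc (P : ℝ) : Set ℝ := {t | ∃ k : ℤ, k + P - 1 < t ∧ t < k}

/-- The points whose orbits avoid the lift of the arc `γ`. -/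
def liftStay (L : CircleDeg1Lift) (P : ℝ) : Set ℝ := {t | ∀ i : ℕ, (L ^ i) t ∉ liftArc P}

/-- Every interval meets the lift of `γ` under iteration. -/
def MeetsArc (L : CircleDeg1Lift) (P : ℝ) : Prop :=
  ∀ u v : ℝ, u < v → ∃ i : ℕ, ∃ t ∈ Ioo u v, (L ^ i) t ∈ liftArc P

/-- The periodic points with rotation number `q`. -/
def liftPer (L : CircleDeg1Lift) (q : ℚ) : Set ℝ := {t | (L ^ q.den) t = t + q.num}

section Powers

variable (L : CircleDeg1Lift)

theorem lift_pow_succ (i : ℕ) (t : ℝ) : (L ^ (i + 1)) t = L ((L ^ i) t) := by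
  rw [pow_succ', CircleDeg1Lift.mul_apply]

theorem lift_pow_add (i j : ℕ) (t : ℝ) : (L ^ (i + j)) t = (L ^ i) ((L ^ j) t) := by
  rw [pow_add, CircleDeg1Lift.mul_apply]

variable {L}

theorem mul_translationNumber_le {i : ℕ} {k : ℤ} {x : ℝ} (h : (L ^ i) x ≤ x + k) :
    i * L.translationNumber ≤ k := by
  rw [← CircleDeg1Lift.translationNumber_pow]
  exact CircleDeg1Lift.translationNumber_le_of_le_add_int _ h

theorem le_mul_translationNumber {i : ℕ} {k : ℤ} {x : ℝ} (h : x + k ≤ (L ^ i) x) :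
    k ≤ i * L.translationNumber := by
  rw [← CircleDeg1Lift.translationNumber_pow]
  exact CircleDeg1Lift.le_translationNumber_of_add_int_le _ h

theorem pow_mul_le {i : ℕ} {k : ℤ} {x : ℝ} (h : (L ^ i) x ≤ x + k) (j : ℕ) :
    (L ^ (i * j)) x ≤ x + j * k := by
  rw [pow_mul, CircleDeg1Lift.coe_pow]
  exact CircleDeg1Lift.iterate_le_of_map_le_add_int _ h j

theorem le_pow_mul {i : ℕ} {k : ℤ} {x : ℝ} (h : x + k ≤ (L ^ i) x) (j : ℕ) :
    x + j * k ≤ (L ^ (i * j)) x := by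
  rw [pow_mul, CircleDeg1Lift.coe_pow]
  exact CircleDeg1Lift.le_iterate_of_add_int_le_map _ h j

theorem pow_mul_eq {i : ℕ} {k : ℤ} {x : ℝ} (h : (L ^ i) x = x + k) (j : ℕ) :
    (L ^ (i * j)) x = x + j * k := by
  rw [pow_mul, CircleDeg1Lift.coe_pow]
  exact CircleDeg1Lift.iterate_eq_of_map_eq_add_int _ h j

theorem pow_mul_eq_iff {i : ℕ} {k : ℤ} {x : ℝ} {j : ℕ} (hj : 0 < j) :
    (L ^ (i * j)) x = x + j * k ↔ (L ^ i) x = x + k := by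
  rw [pow_mul, CircleDeg1Lift.coe_pow]
  exact CircleDeg1Lift.iterate_pos_eq_iff _ hj

end Powers

namespace IsOutsideLift

variable {L : CircleDeg1Lift} {C P : ℝ}

theorem P_pos (H : IsOutsideLift L C P) : 0 < P := by linarith [H.half_le]

theorem map_eq_of_flat (H : IsOutsideLift L C P) {k : ℤ} {t : ℝ} (h1 : k + P - 1 ≤ t)
    (h2 : t ≤ k) : L t = L 0 + k := by
  have e1 : L (k : ℝ) = L 0 + k := CircleDeg1Lift.map_int_of_map_zero L k
  have e2 : L (P + ((k - 1 : ℤ) : ℝ)) = L 0 + k := by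
    have := L.map_one_add 0
    rw [add_zero] at this
    rw [L.map_add_int, H.map_P, this]; push_cast; ring
  have h3 : L t ≤ L 0 + k := by rw [← e1]; exact L.monotone h2
  have h4 : L 0 + k ≤ L t := by rw [← e2]; exact L.monotone (by push_cast; linarith)
  exact le_antisymm h3 h4

theorem pow_eq_of_flat (H : IsOutsideLift L C P) {k : ℤ} {t : ℝ} (h1 : k + P - 1 ≤ t)
    (h2 : t ≤ k) {i : ℕ} (hi : 0 < i) : (L ^ i) t = (L ^ i) 0 + k := by
  obtain ⟨j, rfl⟩ : ∃ j, i = j + 1 := ⟨i - 1, by omega⟩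
  rw [lift_pow_add, lift_pow_add, pow_one, H.map_eq_of_flat h1 h2, CircleDeg1Lift.map_add_int]

theorem pow_eq_zero_of_flat (H : IsOutsideLift L C P) {t : ℝ} (h1 : P - 1 ≤ t)
    (h2 : t ≤ 0) {i : ℕ} (hi : 0 < i) : (L ^ i) t = (L ^ i) 0 := by
  simpa using H.pow_eq_of_flat (k := 0) (t := t) (by push_cast; linarith) (by push_cast; linarith) hi

/-- L is strictly increasing on [0,P] and its translates, so a coincidence of values can only occur
inside a single closed lift of γ. -/
theorem flat_of_map_eq (H : IsOutsideLift L C P) {t t' : ℝ} (h : t < t') (he : L t = L t') :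
    ∃ k : ℤ, k + P - 1 ≤ t ∧ t' ≤ k := by
  have hP := H.P_pos
  have h1 := Int.floor_le t
  have h2 := Int.lt_floor_add_one t
  set j := ⌊t⌋
  rcases lt_or_ge (t - j) P with h3 | h3
  · exfalso
    have h4 : t - j < min (t' - j) P := lt_min (by linarith) h3
    have h5 := H.strictMonoOn ⟨by linarith, h3.le⟩ ⟨by linarith, min_le_right _ _⟩ h4
    have h6 : L (min (t' - j) P) ≤ L (t' - j) := L.monotone (min_le_left _ _)
    rw [L.map_sub_int] at h5 h6
    linarith
  · refine ⟨j + 1, by push_cast; linarith, ?_⟩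
    by_contra! h4
    push_cast at h4
    have h5 : 0 < min (t' - (j + 1 : ℤ)) P := lt_min (by push_cast; linarith) hP
    have h6 := H.strictMonoOn ⟨le_rfl, hP.le⟩ ⟨h5.le, min_le_right _ _⟩ h5
    have h7 : L (min (t' - (j + 1 : ℤ)) P) ≤ L (t' - (j + 1 : ℤ)) := L.monotone (min_le_left _ _)
    have h8 := H.map_eq_of_flat (k := j + 1) (t := t) (by push_cast; linarith)
      (by push_cast; linarith)
    rw [L.map_sub_int] at h7
    linarith

theorem exists_flat_of_pow_eq (H : IsOutsideLift L C P) {t t' : ℝ} (h : t < t') :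
    ∀ n : ℕ, (L ^ n) t = (L ^ n) t' →
      ∃ j < n, ∃ k : ℤ, (L ^ j) t < (L ^ j) t' ∧ k + P - 1 ≤ (L ^ j) t ∧ (L ^ j) t' ≤ k := by
  intro n
  induction n with
  | zero => intro he; exact absurd he h.ne
  | succ n ih =>
    intro he
    by_cases heq : (L ^ n) t = (L ^ n) t'
    · obtain ⟨j, hj, hk⟩ := ih heq
      exact ⟨j, hj.trans n.lt_succ_self, hk⟩
    · have hlt : (L ^ n) t < (L ^ n) t' := lt_of_le_of_ne ((L ^ n).monotone h.le) heq
      rw [lift_pow_succ, lift_pow_succ] at he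
      obtain ⟨k, hk⟩ := H.flat_of_map_eq hlt he
      exact ⟨n, n.lt_succ_self, k, hlt, hk⟩

theorem pow_continuous (H : IsOutsideLift L C P) (n : ℕ) : Continuous (L ^ n) :=
  CircleDeg1Lift.continuous_pow _ H.cont n

/-- An interval whose iterates avoid the lift of `γ` is never collapsed. -/
theorem pow_lt_of_avoids (H : IsOutsideLift L C P) {u v : ℝ} (huv : u < v)
    (h : ∀ i, ∀ t ∈ Ioo u v, (L ^ i) t ∉ liftArc P) (n : ℕ) : (L ^ n) u < (L ^ n) v := by
  refine lt_of_le_of_ne ((L ^ n).monotone huv.le) fun he => ?_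
  obtain ⟨j, -, k, hlt, h1, h2⟩ := H.exists_flat_of_pow_eq huv n he
  obtain ⟨r, hr⟩ := exists_between hlt
  obtain ⟨t, ht, rfl⟩ := intermediate_value_Icc huv.le (H.pow_continuous j).continuousOn
    ⟨hr.1.le, hr.2.le⟩
  have htu : t ≠ u := by rintro rfl; exact lt_irrefl _ hr.1
  have htv : t ≠ v := by rintro rfl; exact lt_irrefl _ hr.2
  exact h j t ⟨lt_of_le_of_ne ht.1 htu.symm, lt_of_le_of_ne ht.2 htv⟩
    ⟨k, h1.trans_lt hr.1, hr.2.trans_le h2⟩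

/-- All of the closed arc has the same image under L^i. If L^i(0) returns to a lift of it, the
translate of that point back to the initial arc is periodic, and its displacement gives the rotation
number. -/
theorem mul_translationNumber_of_return (H : IsOutsideLift L C P) {i : ℕ} (hi : 0 < i) {k : ℤ}
    (h1 : k + P - 1 ≤ (L ^ i) 0) (h2 : (L ^ i) 0 ≤ k) : i * L.translationNumber = k := by
  have h3 := H.pow_eq_zero_of_flat (t := (L ^ i) 0 - k) (by linarith) (by linarith) hi
  rw [← CircleDeg1Lift.translationNumber_pow]
  refine CircleDeg1Lift.translationNumber_of_eq_add_int _ (x := (L ^ i) 0 - k) ?_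
  rw [h3]; ring

end IsOutsideLift

/-! ### Periodic orbits of the lift -/

section Periodic

variable {L : CircleDeg1Lift} {C P : ℝ} {q : ℚ}

theorem liftPer_pow {t : ℝ} (ht : t ∈ liftPer L q) (i : ℕ) : (L ^ i) t ∈ liftPer L q := by
  have ht' : (L ^ q.den) t = t + q.num := ht
  change (L ^ q.den) ((L ^ i) t) = (L ^ i) t + q.num
  rw [← lift_pow_add, add_comm, lift_pow_add, ht', CircleDeg1Lift.map_add_int]

theorem liftPer_add_int {t : ℝ} (ht : t ∈ liftPer L q) (k : ℤ) : t + k ∈ liftPer L q := by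
  have ht' : (L ^ q.den) t = t + q.num := ht
  change (L ^ q.den) (t + k) = t + k + q.num
  rw [CircleDeg1Lift.map_add_int, ht']; ring

theorem liftPer_sub_int {t : ℝ} (ht : t ∈ liftPer L q) (k : ℤ) : t - k ∈ liftPer L q := by
  have := liftPer_add_int ht (-k)
  simpa [sub_eq_add_neg] using this

theorem liftPer_pow_mul {t : ℝ} (ht : t ∈ liftPer L q) (j : ℕ) :
    (L ^ (q.den * j)) t = t + j * q.num := pow_mul_eq ht j

/-- Completing i steps to a multiple of the period gives a translation, which is injective. -/
theorem liftPer_injOn (i : ℕ) : InjOn (L ^ i) (liftPer L q) := by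
  intro x hx y hy he
  have h1 : (L ^ (q.den * i)) x = (L ^ (q.den * i)) y := by
    obtain ⟨r, hr⟩ : ∃ r, q.den * i = r + i := ⟨q.den * i - i, by
      have := Nat.le_mul_of_pos_left i q.den_pos; omega⟩
    rw [hr, lift_pow_add, lift_pow_add, he]
  rw [liftPer_pow_mul hx, liftPer_pow_mul hy] at h1
  linarith

theorem liftPer_isClosed (hL : Continuous L) : IsClosed (liftPer L q) :=
  isClosed_eq (CircleDeg1Lift.continuous_pow _ hL _) (by fun_prop)

theorem liftPer_nonempty (hL : Continuous L) (hq : L.translationNumber = q) :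
    (liftPer L q).Nonempty := by
  refine (CircleDeg1Lift.translationNumber_eq_rat_iff L hL q.den_pos).1 ?_
  rw [hq]; exact_mod_cast (Rat.num_div_den q).symm

theorem liftArc_isOpen (P : ℝ) : IsOpen (liftArc P) := by
  have : liftArc P = ⋃ k : ℤ, Ioo (k + P - 1) (k : ℝ) := by
    ext t; simp [liftArc]
  rw [this]
  exact isOpen_iUnion fun _ => isOpen_Ioo

theorem liftArc_add_int {t : ℝ} (k : ℤ) : t + k ∈ liftArc P ↔ t ∈ liftArc P := by
  constructor
  · rintro ⟨j, h1, h2⟩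
    exact ⟨j - k, by push_cast; linarith, by push_cast; linarith⟩
  · rintro ⟨j, h1, h2⟩
    exact ⟨j + k, by push_cast; linarith, by push_cast; linarith⟩

theorem liftStay_isClosed (hL : Continuous L) : IsClosed (liftStay L P) := by
  have : liftStay L P = ⋂ i : ℕ, (L ^ i) ⁻¹' (liftArc P)ᶜ := by
    ext t; simp [liftStay]
  rw [this]
  exact isClosed_iInter fun i => (liftArc_isOpen P).isClosed_compl.preimage
    (CircleDeg1Lift.continuous_pow _ hL i)

theorem liftStay_pow {t : ℝ} (ht : t ∈ liftStay L P) (i : ℕ) : (L ^ i) t ∈ liftStay L P := by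
  intro j; rw [← lift_pow_add]; exact ht _

theorem liftStay_add_int {t : ℝ} (ht : t ∈ liftStay L P) (k : ℤ) : t + k ∈ liftStay L P := by
  intro j; rw [CircleDeg1Lift.map_add_int, liftArc_add_int]; exact ht _

theorem liftStay_sub_int {t : ℝ} (ht : t ∈ liftStay L P) (k : ℤ) : t - k ∈ liftStay L P := by
  have := liftStay_add_int ht (-k)
  simpa [sub_eq_add_neg] using this

theorem le_or_ge_of_stay {t : ℝ} (ht : t ∉ liftArc P) (k : ℤ) : t ≤ k + P - 1 ∨ k ≤ t := by
  by_contra! h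
  exact ht ⟨k, h⟩

/-- Lowest terms: times at which the rotation by q closes up are multiples of the denominator. -/
theorem exists_of_mul_eq {i : ℕ} {k : ℤ} (h : (i : ℝ) * q = k) :
    ∃ j : ℕ, i = q.den * j ∧ k = j * q.num := by
  have h' : ((i : ℤ) : ℚ) * q = k := by exact_mod_cast h
  obtain ⟨j, hj⟩ := dvd_of_mul_eq_int h'
  have hj0 : 0 ≤ j := by
    by_contra! h0
    have := q.den_pos
    have : (q.den : ℤ) * j < 0 := mul_neg_of_pos_of_neg (by exact_mod_cast this) h0
    omega
  lift j to ℕ using hj0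
  refine ⟨j, by exact_mod_cast hj, ?_⟩
  have h1 := mul_den_eq q
  rw [hj] at h'
  have : (k : ℚ) = j * q.num := by rw [← h1, ← h']; push_cast; ring
  exact_mod_cast this

/-- The first return of the orbit of `â` to the closure of `γ`. -/
theorem return_mem (H : IsOutsideLift L C P) (hW : MeetsArc L P) (hq : L.translationNumber = q) :
    q.num + P - 1 ≤ (L ^ q.den) 0 ∧ (L ^ q.den) 0 ≤ q.num := by
  obtain ⟨y0, hy0⟩ := liftPer_nonempty H.cont hq
  have hPpos := H.P_pos
  have hPlt := H.P_lt
  constructor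
  · by_contra! h
    -- The arc has a single image under L^n, which by assumption misses the arc shifted by m.
    have hflat : ∀ t, P - 1 ≤ t → t ≤ 0 → t ∉ liftPer L q := by
      intro t h1 h2 ht
      have ht' : (L ^ q.den) t = t + q.num := ht
      rw [H.pow_eq_zero_of_flat h1 h2 q.den_pos] at ht'
      linarith
    have hne : (liftPer L q ∩ Icc (P - 2) (P - 1)).Nonempty := by
      refine ⟨Int.fract (y0 - P) + P - 2, ?_, ?_, ?_⟩
      · have := liftPer_sub_int hy0 (⌊y0 - P⌋ + 2)
        rw [Int.fract]
        push_cast at this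
        convert this using 1; ring
      · linarith [Int.fract_nonneg (y0 - P)]
      · linarith [Int.fract_lt_one (y0 - P)]
    obtain ⟨y, ⟨hy, hyI⟩, hmax⟩ :=
      (isCompact_Icc.inter_left (liftPer_isClosed H.cont)).exists_isGreatest hne
    have hymax : ∀ t ∈ liftPer L q, t ≤ P - 1 → t ≤ y := by
      intro t ht h1
      rcases le_or_gt (P - 2) t with h2 | h2
      · exact hmax ⟨ht, h2, h1⟩
      · linarith [hyI.1]
    have hyP : y < P - 1 := lt_of_le_of_ne hyI.2 fun h1 => hflat y h1.ge (by linarith) hy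
    have hret : (L ^ q.den) (P - 1) = (L ^ q.den) 0 :=
      H.pow_eq_zero_of_flat le_rfl (by linarith) q.den_pos
    have hy' : (L ^ q.den) y = y + q.num := hy
    obtain ⟨i, z, hz, k, hk1, hk2⟩ := hW ((L ^ q.den) 0 - q.num) (P - 1) (by linarith)
    have h1 : (L ^ i) z ≤ (L ^ i) (P - 1) := (L ^ i).monotone hz.2.le
    -- The orbit of P - 1 gives k as a lower bound for i times the rotation number, and the orbit of
    -- y gives it as an upper bound. So i is a multiple of n, and then P - 1 has moved too little
    -- for the arc to have been reached.
    have h2 : (k : ℝ) ≤ i * L.translationNumber :=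
      le_mul_translationNumber (x := P - 1) (by linarith)
    have hyz : y ≤ z := by
      have : (L ^ q.den) y ≤ (L ^ q.den) (P - 1) := (L ^ q.den).monotone hyP.le
      linarith [hz.1]
    have h3 : (L ^ i) y ≤ (L ^ i) z := (L ^ i).monotone hyz
    have h4 : (L ^ i) y - k ≤ y := by
      have hper := liftPer_sub_int (liftPer_pow hy i) k
      refine hymax _ hper ?_
      by_contra! h5
      exact hflat _ h5.le (by linarith) hper
    have h5 : i * L.translationNumber ≤ k := mul_translationNumber_le (x := y) (by linarith)
    rw [hq] at h2 h5
    obtain ⟨j, rfl, rfl⟩ := exists_of_mul_eq (le_antisymm h5 h2)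
    have h6 := pow_mul_le (L := L) (i := q.den) (k := q.num) (x := P - 1) (by linarith) j
    push_cast at hk1
    linarith
  · by_contra! h
    have hflat : ∀ t, P - 1 ≤ t → t ≤ 0 → t ∉ liftPer L q := by
      intro t h1 h2 ht
      have ht' : (L ^ q.den) t = t + q.num := ht
      rw [H.pow_eq_zero_of_flat h1 h2 q.den_pos] at ht'
      linarith
    have hne : (liftPer L q ∩ Icc 0 1).Nonempty :=
      ⟨Int.fract y0, liftPer_sub_int hy0 _, Int.fract_nonneg _, (Int.fract_lt_one _).le⟩
    -- The mirror image: y is now the first periodic point after the arc, and the contradiction is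
    -- that 0 has moved too far.
    obtain ⟨y, ⟨hy, hyI⟩, hmin⟩ :=
      (isCompact_Icc.inter_left (liftPer_isClosed H.cont)).exists_isLeast hne
    have hymin : ∀ t ∈ liftPer L q, 0 ≤ t → y ≤ t := by
      intro t ht h1
      rcases le_or_gt t 1 with h2 | h2
      · exact hmin ⟨ht, h1, h2⟩
      · linarith [hyI.2]
    have hy0' : 0 < y := lt_of_le_of_ne hyI.1 fun h1 => hflat y (by linarith) h1.ge hy
    have hyP : y < P := by
      by_contra! h1
      have := liftPer_sub_int hy 1
      push_cast at this
      exact hflat (y - 1) (by linarith) (by linarith [hyI.2]) this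
    have hy' : (L ^ q.den) y = y + q.num := hy
    obtain ⟨i, z, hz, k, hk1, hk2⟩ := hW 0 ((L ^ q.den) 0 - q.num) (by linarith)
    have h1 : (L ^ i) 0 ≤ (L ^ i) z := (L ^ i).monotone hz.1.le
    have h2 : i * L.translationNumber ≤ k :=
      mul_translationNumber_le (x := 0) (by linarith)
    have hyz : z ≤ y := by
      have : (L ^ q.den) 0 ≤ (L ^ q.den) y := (L ^ q.den).monotone hy0'.le
      linarith [hz.2]
    have h3 : (L ^ i) z ≤ (L ^ i) y := (L ^ i).monotone hyz
    have h4 : y ≤ (L ^ i) y - k := by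
      have hper := liftPer_sub_int (liftPer_pow hy i) k
      refine hymin _ hper ?_
      by_contra! h5
      exact hflat _ (by linarith) h5.le hper
    have h5 : (k : ℝ) ≤ i * L.translationNumber := le_mul_translationNumber (x := y) (by linarith)
    rw [hq] at h2 h5
    obtain ⟨j, rfl, rfl⟩ := exists_of_mul_eq (le_antisymm h2 h5)
    have h6 := le_pow_mul (L := L) (i := q.den) (k := q.num) (x := 0) (by linarith) j
    push_cast at hk2
    linarith

/-- A return at time i makes i times the rotation number an integer, hence n divides i. -/
theorem not_flat_of_lt_den (H : IsOutsideLift L C P) (hq : L.translationNumber = q) {i : ℕ}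
    (hi : 0 < i) (hin : i < q.den) {k : ℤ} (h1 : k + P - 1 ≤ (L ^ i) 0) (h2 : (L ^ i) 0 ≤ k) :
    False := by
  have h := H.mul_translationNumber_of_return hi h1 h2
  rw [hq] at h
  obtain ⟨j, hj, -⟩ := exists_of_mul_eq h
  rcases Nat.eq_zero_or_pos j with rfl | hj0
  · omega
  · have := Nat.le_mul_of_pos_right q.den hj0
    omega

theorem eq_of_liftPer_of_flat (H : IsOutsideLift L C P) {t : ℝ} (ht : t ∈ liftPer L q) {k : ℤ}
    (h1 : k + P - 1 ≤ t) (h2 : t ≤ k) : t = (L ^ q.den) 0 - q.num + k := by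
  have ht' : (L ^ q.den) t = t + q.num := ht
  rw [H.pow_eq_of_flat h1 h2 q.den_pos] at ht'
  linarith

/-- If the orbit of `â` returns to an end point of `γ` then all periodic orbits avoid `γ`. -/
theorem liftPer_subset_liftStay (H : IsOutsideLift L C P)
    (hend : (L ^ q.den) 0 = q.num ∨ (L ^ q.den) 0 = q.num + P - 1) :
    liftPer L q ⊆ liftStay L P := by
  rintro t ht i ⟨k, h1, h2⟩
  have := eq_of_liftPer_of_flat H (liftPer_pow ht i) h1.le h2.le
  rcases hend with h | h <;> rw [h] at this <;> linarith

/-- When the return is interior to γ, a periodic orbit through γ is superstable. The first periodic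
point to the right of the arc is not of this kind, because points just below it move away. -/
theorem exists_liftPer_liftStay (H : IsOutsideLift L C P) (hW : MeetsArc L P)
    (hq : L.translationNumber = q) : (liftPer L q ∩ liftStay L P).Nonempty := by
  obtain ⟨hr1, hr2⟩ := return_mem H hW hq
  have hPpos := H.P_pos
  have hPlt := H.P_lt
  by_cases hend : (L ^ q.den) 0 = q.num ∨ (L ^ q.den) 0 = q.num + P - 1
  · obtain ⟨t, ht⟩ := liftPer_nonempty H.cont hq
    exact ⟨t, ht, liftPer_subset_liftStay H hend ht⟩
  push Not at hend
  have h0 : (L ^ q.den) 0 < q.num := lt_of_le_of_ne hr2 hend.1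
  have hP : P + q.num ≤ (L ^ q.den) P := by
    have := H.pow_eq_of_flat (k := 1) (t := P) (by push_cast; linarith) (by push_cast; linarith)
      q.den_pos
    push_cast at this
    linarith
  have hcont : Continuous fun t : ℝ => (L ^ q.den) t - t :=
    (H.pow_continuous _).sub continuous_id
  have hne : (liftPer L q ∩ Icc 0 P).Nonempty := by
    obtain ⟨t, ht, he⟩ := intermediate_value_Icc hPpos.le hcont.continuousOn
      (show (q.num : ℝ) ∈ Icc ((L ^ q.den) 0 - 0) ((L ^ q.den) P - P) from
        ⟨by linarith, by linarith⟩)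
    simp only at he
    exact ⟨t, by change (L ^ q.den) t = t + q.num; linarith, ht⟩
  obtain ⟨y, ⟨hy, hyI⟩, hmin⟩ :=
    (isCompact_Icc.inter_left (liftPer_isClosed H.cont)).exists_isLeast hne
  have hy' : (L ^ q.den) y = y + q.num := hy
  have hy0 : 0 < y := lt_of_le_of_ne hyI.1 fun h1 => by rw [← h1] at hy'; linarith
  have hbelow : ∀ t, 0 ≤ t → t < y → (L ^ q.den) t < t + q.num := by
    intro t h1 h2
    by_contra! h3
    obtain ⟨r, hr, he⟩ := intermediate_value_Icc h1 hcont.continuousOn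
      (show (q.num : ℝ) ∈ Icc ((L ^ q.den) 0 - 0) ((L ^ q.den) t - t) from
        ⟨by linarith, by linarith⟩)
    simp only at he
    have := hmin ⟨show (L ^ q.den) r = r + q.num by linarith, hr.1, by linarith [hr.2, hyI.2]⟩
    linarith [hr.2]
  refine ⟨y, hy, fun i hi => ?_⟩
  obtain ⟨k, hk1, hk2⟩ := hi
  have hnhds' : (L ^ i) ⁻¹' Ioo (k + P - 1) (k : ℝ) ∈ 𝓝 y :=
    (isOpen_Ioo.preimage (H.pow_continuous i)).mem_nhds ⟨hk1, hk2⟩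
  obtain ⟨l, u, hlu, hsub⟩ := mem_nhds_iff_exists_Ioo_subset.1 hnhds'
  obtain ⟨t, ht1, ht2⟩ := exists_between (max_lt hlu.1 hy0)
  have ht : (L ^ i) t ∈ Ioo (k + P - 1) (k : ℝ) :=
    hsub ⟨(le_max_left _ _).trans_lt ht1, ht2.trans hlu.2⟩
  -- If the orbit of y entered γ, a point t just below y would share its later orbit and so catch up
  -- with y. But `hbelow` makes t advance by at most m in each period.
  have h1 : L ((L ^ i) t) = L ((L ^ i) y) := by
    rw [H.map_eq_of_flat ht.1.le ht.2.le, H.map_eq_of_flat hk1.le hk2.le]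
  have h2 : (L ^ (q.den * (i + 1))) t = (L ^ (q.den * (i + 1))) y := by
    obtain ⟨r, hr⟩ : ∃ r, q.den * (i + 1) = r + (i + 1) := ⟨q.den * (i + 1) - (i + 1), by
      have := Nat.le_mul_of_pos_left (i + 1) q.den_pos; omega⟩
    rw [hr, lift_pow_add L r, lift_pow_add L r, lift_pow_succ, lift_pow_succ, h1]
  have h3 := pow_mul_le (hbelow t ((le_max_right _ _).trans ht1.le) ht2).le (i + 1)
  rw [h2, liftPer_pow_mul hy] at h3
  linarith

/-- The lifted periodic orbits are ordered as the orbits of the rotation. -/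
theorem exists_orbit_enumeration (hq : L.translationNumber = q) {y : ℝ} (hy : y ∈ liftPer L q) :
    ∃ t : ℤ → ℝ, StrictMono t ∧
      (∀ (i : ℕ) (k : ℤ), t (i * q.num - k * q.den) = (L ^ i) y - k) ∧
      ∀ j : ℤ, ∃ (i : ℕ) (k : ℤ), j = i * q.num - k * q.den := by
  have hd : (0 : ℤ) < q.den := by exact_mod_cast q.den_pos
  -- Adding i full periods to i' makes the difference r of the two times nonnegative; the rotation
  -- number then bounds the displacement over r steps.
  have hmono : ∀ (i i' : ℕ) (k k' : ℤ), (L ^ i') y - k' ≤ (L ^ i) y - k →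
      (i' : ℤ) * q.num - k' * q.den ≤ i * q.num - k * q.den := by
    intro i i' k k' h
    have h1 : (L ^ (i' + q.den * i)) y = (L ^ i') y + i * q.num := by
      rw [lift_pow_add, liftPer_pow_mul hy]
      exact_mod_cast (L ^ i').map_add_int y (i * q.num)
    obtain ⟨r, hr⟩ : ∃ r, i' + q.den * i = r + i := ⟨i' + q.den * i - i, by
      have := Nat.le_mul_of_pos_left i q.den_pos; omega⟩
    rw [hr, lift_pow_add] at h1
    have h2 : r * L.translationNumber ≤ ((k' - k + i * q.num : ℤ) : ℝ) :=
      mul_translationNumber_le (x := (L ^ i) y) (by rw [h1]; push_cast; linarith)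
    rw [hq] at h2
    have h3 : (r : ℚ) * q ≤ ((k' - k + i * q.num : ℤ) : ℚ) := by exact_mod_cast h2
    have h4 : (r : ℤ) * q.num ≤ (k' - k + i * q.num) * q.den := by
      have h5 := mul_le_mul_of_nonneg_right h3 (show (0 : ℚ) ≤ q.den by positivity)
      rw [mul_assoc, mul_comm q, mul_den_eq] at h5
      exact_mod_cast h5
    have h6 : (i' : ℤ) + q.den * i = r + i := by exact_mod_cast hr
    have h7 : (r : ℤ) = i' + q.den * i - i := by linarith
    rw [h7] at h4
    linarith
  have hex : ∀ j : ℤ, ∃ (i : ℕ) (k : ℤ), j = i * q.num - k * q.den := by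
    intro j
    have hc : IsCoprime q.num (q.den : ℤ) := by
      have := q.reduced
      rw [Int.isCoprime_iff_gcd_eq_one]
      simpa [Int.gcd, Nat.Coprime] using this
    obtain ⟨u, v, huv⟩ := hc
    -- A Bézout solution may have a negative exponent; adding a multiple of n to it corrects this
    -- and is compensated in k.
    have hnn : 0 ≤ j * u + q.den * |j * u| := by
      have h1 := neg_abs_le (j * u)
      have h2 := abs_nonneg (j * u)
      nlinarith
    refine ⟨(j * u + q.den * |j * u|).toNat, q.num * |j * u| - j * v, ?_⟩
    rw [Int.toNat_of_nonneg hnn]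
    linear_combination -j * huv
  choose i k hik using hex
  have hval : ∀ (i' : ℕ) (k' : ℤ), (L ^ i (i' * q.num - k' * q.den)) y -
      k (i' * q.num - k' * q.den) = (L ^ i') y - k' := by
    intro i' k'
    have hj := hik (i' * q.num - k' * q.den)
    set a := i (i' * q.num - k' * q.den)
    set b := k (i' * q.num - k' * q.den)
    have key : ∀ (a i' : ℕ) (b k' : ℤ), (i' : ℤ) * q.num - k' * q.den = a * q.num - b * q.den →
        a ≤ i' → (L ^ a) y - b = (L ^ i') y - k' := by
      intro a i' b k' hj hle
      obtain ⟨d, rfl⟩ := Nat.exists_eq_add_of_le hle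
      have h1 : (d : ℤ) * q.num = (k' - b) * q.den := by push_cast at hj; linarith
      have h2 : (d : ℝ) * q = ((k' - b : ℤ) : ℝ) := by
        have h3 : (d : ℚ) * q = ((k' - b : ℤ) : ℚ) := by
          have hd' : (q.den : ℚ) ≠ 0 := by positivity
          apply mul_right_cancel₀ hd'
          rw [mul_assoc, mul_comm q, mul_den_eq]
          exact_mod_cast h1
        exact_mod_cast h3
      obtain ⟨r, rfl, hr⟩ := exists_of_mul_eq h2
      rw [lift_pow_add, liftPer_pow_mul hy]
      have h4 : (L ^ a) (y + r * q.num) = (L ^ a) y + r * q.num := by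
        exact_mod_cast (L ^ a).map_add_int y (r * q.num)
      have h5 : (k' : ℝ) - b = r * q.num := by exact_mod_cast hr
      rw [h4]; linarith
    rcases le_total a i' with h | h
    · exact key _ _ _ _ hj h
    · exact (key _ _ _ _ hj.symm h).symm
  refine ⟨fun j => (L ^ i j) y - k j, ?_, hval, fun j => ⟨i j, k j, hik j⟩⟩
  intro j j' hjj
  by_contra! h
  have := hmono _ _ _ _ h
  rw [← hik, ← hik] at this
  omega

/-- All periodic orbits avoiding `γ` are lifts of the same orbit. -/
theorem exists_unique_orbit (H : IsOutsideLift L C P) (hW : MeetsArc L P)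
    (hq : L.translationNumber = q) :
    ∃ y ∈ liftPer L q ∩ liftStay L P, ∀ t ∈ liftPer L q ∩ liftStay L P,
      ∃ (i : ℕ) (k : ℤ), t = (L ^ i) y - k := by
  obtain ⟨y0, hy0⟩ := exists_liftPer_liftStay H hW hq
  have hclosed : IsClosed (liftPer L q ∩ liftStay L P) :=
    (liftPer_isClosed H.cont).inter (liftStay_isClosed H.cont)
  -- Taking y least makes every lifted arc ending at an integer k be followed first by y + k among
  -- the periodic points that avoid γ.
  obtain ⟨y, ⟨hy, hyI⟩, hmin⟩ :=
    (isCompact_Icc.inter_left hclosed).exists_isLeast (s := _ ∩ Icc (0 : ℝ) 1)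
    ⟨Int.fract y0, ⟨liftPer_sub_int hy0.1 _, liftStay_sub_int hy0.2 _⟩, Int.fract_nonneg _,
      (Int.fract_lt_one _).le⟩
  have hymin : ∀ t ∈ liftPer L q ∩ liftStay L P, 0 ≤ t → y ≤ t := by
    intro t ht h1
    rcases le_or_gt t 1 with h2 | h2
    · exact hmin ⟨ht, h1, h2⟩
    · linarith [hyI.2]
  refine ⟨y, hy, fun t ht => ?_⟩
  by_contra! hcon
  obtain ⟨o, ho, hoval, -⟩ := exists_orbit_enumeration hq hy.1
  have hint : ∀ j : ℤ, o (j * q.den) = y + j := by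
    intro j
    have := hoval 0 (-j)
    simpa using this
  have hbd : ∀ j : ℤ, o j ≤ t → j ≤ (⌊t - y⌋ + 1) * q.den := by
    intro j hj
    by_contra! h
    have := ho h
    rw [hint] at this
    have := Int.lt_floor_add_one (t - y)
    push_cast at *
    linarith
  -- `o j` is the neighbour of t from below in the lifted orbit of y.
  obtain ⟨j, hj, hjmax⟩ := Int.exists_greatest_of_bdd (P := fun j => o j ≤ t) ⟨_, hbd⟩
    ⟨⌊t - y⌋ * q.den, by rw [hint]; linarith [Int.floor_le (t - y)]⟩
  obtain ⟨i0, k0, hjk⟩ : ∃ (i : ℕ) (k : ℤ), o j = (L ^ i) y - k := by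
    obtain ⟨o', -, -, hex⟩ := exists_orbit_enumeration hq hy.1
    obtain ⟨i, k, rfl⟩ := hex j
    exact ⟨i, k, hoval i k⟩
  have hjper : o j ∈ liftPer L q := by
    rw [hjk]; exact liftPer_sub_int (liftPer_pow hy.1 _) _
  have hjstay : o j ∈ liftStay L P := by
    rw [hjk]; exact liftStay_sub_int (liftStay_pow hy.2 _) _
  have hlt : o j < t := lt_of_le_of_ne hj fun h => hcon i0 k0 (by rw [← h, hjk])
  obtain ⟨i, z, hz, k, hk1, hk2⟩ := hW _ _ hlt
  have h1 : (L ^ i) (o j) ≤ k + P - 1 := by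
    have h2 : (L ^ i) (o j) ≤ (L ^ i) z := (L ^ i).monotone hz.1.le
    rcases le_or_ge_of_stay (hjstay i) k with h | h
    · exact h
    · linarith
  have h2 : (k : ℝ) ≤ (L ^ i) t := by
    have h2 : (L ^ i) z ≤ (L ^ i) t := (L ^ i).monotone hz.2.le
    rcases le_or_ge_of_stay (ht.2 i) k with h | h
    · linarith
    · exact h
  have h3 : y + k ≤ (L ^ i) t := by
    have := hymin ((L ^ i) t - k) ⟨liftPer_sub_int (liftPer_pow ht.1 _) _,
      liftStay_sub_int (liftStay_pow ht.2 _) _⟩ (by linarith)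
    linarith
  obtain ⟨r, hr⟩ : ∃ r, q.den * i = r + i := ⟨q.den * i - i, by
    have := Nat.le_mul_of_pos_left i q.den_pos; omega⟩
  have e1 : (L ^ r) ((L ^ i) (o j)) = o j + i * q.num := by
    rw [← lift_pow_add, ← hr, liftPer_pow_mul hjper]
  have e2 : (L ^ r) ((L ^ i) t) = t + i * q.num := by
    rw [← lift_pow_add, ← hr, liftPer_pow_mul ht.1]
  have hlt1 : (L ^ i) (o j) < y + k := by linarith [H.P_lt, hyI.1]
  -- At time i the arc separates the two orbits, and y + k lies between them. Completing i full
  -- periods and translating back places a point of the orbit of y strictly above `o j` and at most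
  -- t, against maximality.
  have h4 : (L ^ r) ((L ^ i) (o j)) < (L ^ r) (y + k) :=
    lt_of_le_of_ne ((L ^ r).monotone hlt1.le) fun h =>
      hlt1.ne (liftPer_injOn r (liftPer_pow hjper i) (liftPer_add_int hy.1 k) h)
  have h5 : (L ^ r) (y + k) ≤ (L ^ r) ((L ^ i) t) := (L ^ r).monotone h3
  have e3 : (L ^ r) (y + k) - i * q.num = o (r * q.num - (i * q.num - k) * q.den) := by
    rw [hoval, CircleDeg1Lift.map_add_int]; push_cast; ring
  have h6 := hjmax (r * q.num - (i * q.num - k) * q.den) (by rw [← e3]; linarith)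
  have h7 := ho.monotone h6
  rw [← e3] at h7
  linarith

/-- The orbits that avoid `γ` and are not periodic end in an end point of `γ`. -/
theorem eventually_endpoint (H : IsOutsideLift L C P) (hW : MeetsArc L P)
    (hq : L.translationNumber = q) {t : ℝ} (ht : t ∈ liftStay L P) (hper : t ∉ liftPer L q) :
    ((L ^ q.den) 0 = q.num ∧ ∃ (i : ℕ) (k : ℤ), (L ^ i) t = P - 1 + k) ∨
    ((L ^ q.den) 0 = q.num + P - 1 ∧ ∃ (i : ℕ) (k : ℤ), (L ^ i) t = k) := by
  obtain ⟨hr1, hr2⟩ := return_mem H hW hq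
  have hPpos := H.P_pos
  have hPlt := H.P_lt
  have hret : (L ^ q.den) (P - 1) = (L ^ q.den) 0 :=
    H.pow_eq_zero_of_flat le_rfl (by linarith) q.den_pos
  have hstay : ∀ i : ℕ, (L ^ i) ((L ^ q.den) t - q.num) = (L ^ q.den) ((L ^ i) t) - q.num := by
    intro i
    rw [CircleDeg1Lift.map_sub_int, ← lift_pow_add, ← lift_pow_add, add_comm]
  have hstay' : (L ^ q.den) t - q.num ∈ liftStay L P := liftStay_sub_int (liftStay_pow ht _) _
  have hper' : (L ^ q.den) t ≠ t + q.num := hper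
  rcases lt_or_gt_of_ne hper' with h | h
  · right
    -- The point and its return both avoid γ forever, so when the interval between them meets γ they
    -- lie on opposite sides of it. With `return_mem` this forces the return of 0 to be the left end
    -- of the arc.
    obtain ⟨i, z, hz, k, hk1, hk2⟩ := hW ((L ^ q.den) t - q.num) t (by linarith)
    have h1 : (L ^ i) z ≤ (L ^ i) t := (L ^ i).monotone hz.2.le
    have h2 : (L ^ i) ((L ^ q.den) t - q.num) ≤ (L ^ i) z := (L ^ i).monotone hz.1.le
    have h3 : (k : ℝ) ≤ (L ^ i) t := by
      rcases le_or_ge_of_stay (ht i) k with h | h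
      · linarith
      · exact h
    have h4 : (L ^ i) ((L ^ q.den) t - q.num) ≤ k + P - 1 := by
      rcases le_or_ge_of_stay (hstay' i) k with h | h
      · exact h
      · linarith
    rw [hstay] at h4
    have h5 : (L ^ q.den) 0 ≤ (L ^ q.den) ((L ^ i) t - k) := (L ^ q.den).monotone (by linarith)
    have h6 : (L ^ q.den) ((L ^ i) t - k) = (L ^ q.den) ((L ^ i) t) - k :=
      CircleDeg1Lift.map_sub_int _ _ _
    refine ⟨by linarith, i, k, ?_⟩
    by_contra hne
    have h7 : 0 < (L ^ i) t - k := by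
      rcases h3.eq_or_lt with h | h
      · exact absurd h.symm hne
      · linarith
    -- Otherwise L^n would collapse an interval starting at 0. This cannot happen at time 0, as 0 is
    -- the right end of its arc, nor at times between 0 and n, as there is no earlier return.
    obtain ⟨j, hj, k', hlt, hk1', hk2'⟩ := H.exists_flat_of_pow_eq h7 q.den (by linarith)
    rcases Nat.eq_zero_or_pos j with rfl | hj0
    · simp only [pow_zero, CircleDeg1Lift.coe_one, id] at hk1' hk2'
      have h8 : (0 : ℝ) < k' := by linarith
      have h9 : (1 : ℝ) ≤ k' := by exact_mod_cast h8
      linarith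
    · exact not_flat_of_lt_den H hq hj0 hj hk1' (hlt.le.trans hk2')
  · left
    obtain ⟨i, z, hz, k, hk1, hk2⟩ := hW t ((L ^ q.den) t - q.num) (by linarith)
    have h1 : (L ^ i) t ≤ (L ^ i) z := (L ^ i).monotone hz.1.le
    have h2 : (L ^ i) z ≤ (L ^ i) ((L ^ q.den) t - q.num) := (L ^ i).monotone hz.2.le
    have h3 : (L ^ i) t ≤ k + P - 1 := by
      rcases le_or_ge_of_stay (ht i) k with h | h
      · exact h
      · linarith
    have h4 : (k : ℝ) ≤ (L ^ i) ((L ^ q.den) t - q.num) := by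
      rcases le_or_ge_of_stay (hstay' i) k with h | h
      · linarith
      · exact h
    rw [hstay] at h4
    have h5 : (L ^ q.den) ((L ^ i) t - k) ≤ (L ^ q.den) (P - 1) :=
      (L ^ q.den).monotone (by linarith)
    have h6 : (L ^ q.den) ((L ^ i) t - k) = (L ^ q.den) ((L ^ i) t) - k :=
      CircleDeg1Lift.map_sub_int _ _ _
    refine ⟨by linarith, i, k, ?_⟩
    by_contra hne
    have h7 : (L ^ i) t - k < P - 1 := by
      refine lt_of_le_of_ne (by linarith) fun h => hne (by linarith)
    obtain ⟨j, hj, k', hlt, hk1', hk2'⟩ := H.exists_flat_of_pow_eq h7 q.den (by linarith)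
    rcases Nat.eq_zero_or_pos j with rfl | hj0
    · simp only [pow_zero, CircleDeg1Lift.coe_one, id] at hk1' hk2'
      have h8 : (k' : ℝ) < 0 := by linarith
      have h9 : (k' : ℝ) ≤ -1 := by
        have : k' < 0 := by exact_mod_cast h8
        have : k' ≤ -1 := by omega
        exact_mod_cast this
      linarith
    · rw [H.pow_eq_zero_of_flat (t := P - 1) le_rfl (by linarith) hj0] at hlt hk2'
      exact not_flat_of_lt_den H hq hj0 hj (hk1'.trans hlt.le) hk2'

end Periodic

/-! ### The lift of the outside map of a unimodal map -/

/-- The affine map from `[a,b]` to `[0,1/2]`. -/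
noncomputable def halfScale (a b x : ℝ) : ℝ := (x - a) / (2 * (b - a))

/-- The coordinate in `[a,b]` of the point of the circle with lift `t`. -/
noncomputable def liftCoord (a b t : ℝ) : ℝ := a + 2 * (b - a) * min (Int.fract t) (1 - Int.fract t)

/-- The unimodal map in the coordinates of the lower half circle. -/
noncomputable def halfMap (f : ℝ → ℝ) (a b t : ℝ) : ℝ := halfScale a b (f (a + 2 * (b - a) * t))

section Lift

variable {f : ℝ → ℝ} {a b c p : ℝ}

theorem halfScale_strictMono (hab : a < b) : StrictMono (halfScale a b) := by
  intro x y h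
  unfold halfScale
  have : 0 < 2 * (b - a) := by linarith
  gcongr

theorem add_mul_halfScale (hab : a < b) (x : ℝ) : a + 2 * (b - a) * halfScale a b x = x := by
  unfold halfScale
  have : b - a ≠ 0 := (sub_pos.2 hab).ne'
  field_simp
  ring

theorem halfScale_add_mul (hab : a < b) (t : ℝ) : halfScale a b (a + 2 * (b - a) * t) = t := by
  unfold halfScale
  have : b - a ≠ 0 := (sub_pos.2 hab).ne'
  field_simp
  ring

theorem halfScale_left : halfScale a b a = 0 := by simp [halfScale]

theorem halfScale_right (hab : a < b) : halfScale a b b = 1 / 2 := by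
  unfold halfScale
  have : b - a ≠ 0 := (sub_pos.2 hab).ne'
  field_simp

theorem halfScale_mem (hab : a < b) {x : ℝ} (hx : x ∈ Icc a b) :
    halfScale a b x ∈ Icc (0 : ℝ) (1 / 2) := by
  rw [← halfScale_left (a := a) (b := b), ← halfScale_right hab]
  exact ⟨(halfScale_strictMono hab).monotone hx.1, (halfScale_strictMono hab).monotone hx.2⟩

theorem unscale_mem (hab : a < b) {t : ℝ} (ht : t ∈ Icc (0 : ℝ) (1 / 2)) :
    a + 2 * (b - a) * t ∈ Icc a b := by
  have := sub_pos.2 hab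
  constructor <;> nlinarith [ht.1, ht.2]

theorem liftCoord_add_int (t : ℝ) (k : ℤ) : liftCoord a b (t + k) = liftCoord a b t := by
  simp [liftCoord]

theorem liftCoord_int_add (t : ℝ) (k : ℤ) : liftCoord a b (k + t) = liftCoord a b t := by
  rw [add_comm, liftCoord_add_int]

theorem liftCoord_of_le_half {t : ℝ} (h0 : 0 ≤ t) (h1 : t ≤ 1 / 2) :
    liftCoord a b t = a + 2 * (b - a) * t := by
  unfold liftCoord
  rw [Int.fract_eq_self.2 ⟨h0, by linarith⟩, min_eq_left (by linarith)]

theorem liftCoord_of_half_le {t : ℝ} (h0 : 1 / 2 ≤ t) (h1 : t ≤ 1) :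
    liftCoord a b t = a + 2 * (b - a) * (1 - t) := by
  rcases h1.eq_or_lt with rfl | h1
  · simp [liftCoord]
  · unfold liftCoord
    rw [Int.fract_eq_self.2 ⟨by linarith, h1⟩, min_eq_right (by linarith)]

/-- The branches of f, read around the circle, fit together: f on the left lower part, 1 - f on the
right lower part and 1 + f on the upper part up to p. The hypothesis f(p) = f(a) lets the constant
piece close up. -/
theorem exists_outsideLift (hf : IsUnimodal f a b c) (hcp : c < p) (hpb : p ≤ b)
    (hp : f p = f a) : ∃ L : CircleDeg1Lift,
      IsOutsideLift L (halfScale a b c) (1 - halfScale a b p) ∧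
      (∀ t ∈ Icc 0 (halfScale a b c), L t = halfMap f a b t) ∧
      (∀ t ∈ Icc (halfScale a b c) (1 / 2), L t = 1 - halfMap f a b t) ∧
      (∀ t ∈ Icc (1 / 2) (1 - halfScale a b p), L t = 1 + halfMap f a b (1 - t)) := by
  have hab := hf.lt
  have hsm := halfScale_strictMono hab
  set C := halfScale a b c with hC
  set P := 1 - halfScale a b p with hP
  set g := halfMap f a b with hg
  have hC0 : 0 < C := by rw [← halfScale_left (a := a) (b := b)]; exact hsm hf.lt_left
  have hC2 : C < 1 / 2 := by rw [← halfScale_right hab]; exact hsm hf.lt_right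
  have hPC : 1 - P = halfScale a b p := by rw [hP]; ring
  have hP1 : C < 1 - P := by rw [hPC]; exact hsm hcp
  have hP2 : 1 - P ≤ 1 / 2 := by rw [hPC, ← halfScale_right hab]; exact hsm.monotone hpb
  have hu : StrictMono fun t : ℝ => a + 2 * (b - a) * t := by
    intro x y h
    have := sub_pos.2 hab
    simp only
    nlinarith
  have huC : a + 2 * (b - a) * C = c := add_mul_halfScale hab c
  have huP : a + 2 * (b - a) * (1 - P) = p := by rw [hPC]; exact add_mul_halfScale hab p
  have hub : a + 2 * (b - a) * (1 / 2) = b := by ring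
  have hgc : ContinuousOn g (Icc 0 (1 / 2)) := by
    have h1 : ContinuousOn (fun t : ℝ => f (a + 2 * (b - a) * t)) (Icc 0 (1 / 2)) :=
      hf.continuousOn.comp (by fun_prop) fun t ht => unscale_mem hab ht
    have h2 : Continuous (halfScale a b) := by unfold halfScale; fun_prop
    exact h2.comp_continuousOn h1
  have hgm : StrictMonoOn g (Icc 0 C) := by
    intro x hx y hy hxy
    refine hsm (hf.strictMonoOn ?_ ?_ (hu hxy))
    · exact ⟨(unscale_mem hab ⟨hx.1, by linarith [hx.2]⟩).1, by
        rw [← huC]; exact hu.monotone hx.2⟩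
    · exact ⟨(unscale_mem hab ⟨hy.1, by linarith [hy.2]⟩).1, by
        rw [← huC]; exact hu.monotone hy.2⟩
  have hga : StrictAntiOn g (Icc C (1 / 2)) := by
    intro x hx y hy hxy
    refine hsm (hf.strictAntiOn ?_ ?_ (hu hxy))
    · exact ⟨by rw [← huC]; exact hu.monotone hx.1,
        (unscale_mem hab ⟨by linarith [hx.1], hx.2⟩).2⟩
    · exact ⟨by rw [← huC]; exact hu.monotone hy.1,
        (unscale_mem hab ⟨by linarith [hy.1], hy.2⟩).2⟩
  have hgC : g C = 1 / 2 := by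
    simp only [hg, halfMap]
    rw [huC, hf.map_turning, halfScale_right hab]
  have hgh : g (1 / 2) = 0 := by
    simp only [hg, halfMap]
    rw [hub, hf.map_right, halfScale_left]
  have hgP : g (1 - P) = g 0 := by
    simp only [hg, halfMap]
    rw [huP, mul_zero, add_zero, hp]
  -- A sum of clamped branches: each term varies only on its own interval and is increasing there,
  -- so monotonicity and continuity need no case distinction.
  set l : ℝ → ℝ := fun t => g (max 0 (min t C)) + (g C - g (max C (min t (1 / 2)))) +
    (g (1 - max (1 / 2) (min t P)) - g (1 / 2)) with hl
  have hlm : Monotone l := by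
    intro x y hxy
    have h1 : g (max 0 (min x C)) ≤ g (max 0 (min y C)) :=
      hgm.monotoneOn ⟨le_max_left _ _, max_le hC0.le (min_le_right _ _)⟩
        ⟨le_max_left _ _, max_le hC0.le (min_le_right _ _)⟩ (by gcongr)
    have h2 : g (max C (min y (1 / 2))) ≤ g (max C (min x (1 / 2))) :=
      hga.antitoneOn ⟨le_max_left _ _, max_le hC2.le (min_le_right _ _)⟩
        ⟨le_max_left _ _, max_le hC2.le (min_le_right _ _)⟩ (by gcongr)
    have hm : ∀ t, 1 - max (1 / 2) (min t P) ∈ Icc C (1 / 2) := fun t => by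
      have e1 : max (1 / 2) (min t P) ≤ P := max_le (by linarith) (min_le_right _ _)
      have e2 : (1 / 2 : ℝ) ≤ max (1 / 2) (min t P) := le_max_left _ _
      constructor <;> linarith
    have h3 : g (1 - max (1 / 2) (min x P)) ≤ g (1 - max (1 / 2) (min y P)) :=
      hga.antitoneOn (hm y) (hm x) (by gcongr)
    simp only [hl]
    linarith
  have hlc : Continuous l := by
    have h1 : Continuous fun t : ℝ => g (max 0 (min t C)) :=
      hgc.comp_continuous (by fun_prop) fun t =>
        ⟨le_max_left _ _, (max_le hC0.le (min_le_right _ _)).trans hC2.le⟩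
    have h2 : Continuous fun t : ℝ => g (max C (min t (1 / 2))) :=
      hgc.comp_continuous (by fun_prop) fun t =>
        ⟨hC0.le.trans (le_max_left _ _), max_le hC2.le (min_le_right _ _)⟩
    have h3 : Continuous fun t : ℝ => g (1 - max (1 / 2) (min t P)) :=
      hgc.comp_continuous (by fun_prop) fun t => by
        have e1 : max (1 / 2) (min t P) ≤ P := max_le (by linarith) (min_le_right _ _)
        have e2 : (1 / 2 : ℝ) ≤ max (1 / 2) (min t P) := le_max_left _ _
        constructor <;> linarith
    exact (h1.add (continuous_const.sub h2)).add (h3.sub continuous_const)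
  have hl1 : ∀ t ∈ Icc 0 C, l t = g t := by
    intro t ht
    simp only [hl]
    rw [min_eq_left ht.2, max_eq_right ht.1, min_eq_left (by linarith [ht.2]), max_eq_left ht.2,
      min_eq_left (by linarith [ht.2]), max_eq_left (by linarith [ht.2])]
    norm_num
  have hl2 : ∀ t ∈ Icc C (1 / 2), l t = 1 - g t := by
    intro t ht
    simp only [hl]
    rw [min_eq_right ht.1, max_eq_right hC0.le, min_eq_left ht.2, max_eq_right ht.1,
      min_eq_left (by linarith [ht.2]), max_eq_left ht.2, hgC]
    norm_num
    ring
  have hl3 : ∀ t ∈ Icc (1 / 2) P, l t = 1 + g (1 - t) := by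
    intro t ht
    simp only [hl]
    rw [min_eq_right (by linarith [ht.1]), max_eq_right hC0.le, min_eq_right ht.1,
      max_eq_right hC2.le, min_eq_left ht.2, max_eq_right ht.1, hgC, hgh]
    ring
  have hl4 : ∀ t, P ≤ t → l t = 1 + g 0 := by
    intro t ht
    simp only [hl]
    rw [min_eq_right (by linarith), max_eq_right hC0.le, min_eq_right (by linarith),
      max_eq_right hC2.le, min_eq_right ht, max_eq_right (by linarith), hgC, hgh, hgP]
    ring
  have hl0 : l 0 = g 0 := hl1 0 ⟨le_rfl, hC0.le⟩
  have hl11 : l 1 = l 0 + 1 := by rw [hl4 1 (by linarith), hl0]; ring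
  have hLm : Monotone fun t : ℝ => (⌊t⌋ : ℝ) + l (Int.fract t) := by
    intro x y hxy
    simp only
    rcases (Int.floor_mono hxy).eq_or_lt with h | h
    · rw [h]
      have : Int.fract x ≤ Int.fract y := by unfold Int.fract; rw [h]; linarith
      have := hlm this
      linarith
    · have h1 : ((⌊x⌋ : ℤ) : ℝ) + 1 ≤ ⌊y⌋ := by exact_mod_cast h
      have h2 : l (Int.fract x) ≤ l 1 := hlm (Int.fract_lt_one x).le
      have h3 : l 0 ≤ l (Int.fract y) := hlm (Int.fract_nonneg y)
      linarith
  set L : CircleDeg1Lift := ⟨⟨fun t : ℝ => (⌊t⌋ : ℝ) + l (Int.fract t), hLm⟩, fun t => by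
    simp only [Int.floor_add_one, Int.fract_add_one]; push_cast; ring⟩ with hL
  have hLval : ∀ t, L t = (⌊t⌋ : ℝ) + l (Int.fract t) := fun _ => rfl
  have hLl : ∀ t ∈ Icc (0 : ℝ) 1, L t = l t := by
    intro t ht
    rw [hLval]
    rcases ht.2.eq_or_lt with rfl | h
    · simp [hl11]; ring
    · rw [Int.fract_eq_self.2 ⟨ht.1, h⟩, Int.floor_eq_zero_iff.2 ⟨ht.1, h⟩]; simp
  have hLc : Continuous L := by
    have h1 : Continuous fun t : ℝ => t + ((fun s => l s - s) ∘ Int.fract) t :=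
      continuous_id.add (ContinuousOn.comp_fract'' (by fun_prop) (by rw [hl11]; ring))
    convert h1 using 1
    funext t
    rw [hLval]
    simp only [Function.comp_apply]
    have := Int.self_sub_floor t
    linarith
  have hL1 : ∀ t ∈ Icc 0 C, L t = g t := fun t ht => by
    rw [hLl t ⟨ht.1, by linarith [ht.2]⟩, hl1 t ht]
  have hL2 : ∀ t ∈ Icc C (1 / 2), L t = 1 - g t := fun t ht => by
    rw [hLl t ⟨by linarith [ht.1], by linarith [ht.2]⟩, hl2 t ht]
  have hL3 : ∀ t ∈ Icc (1 / 2) P, L t = 1 + g (1 - t) := fun t ht => by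
    rw [hLl t ⟨by linarith [ht.1], by linarith [ht.2]⟩, hl3 t ht]
  refine ⟨L, ⟨hLc, hC0, hC2, by linarith, by linarith, ?_, ?_, ?_, ?_⟩, hL1, hL2, hL3⟩
  · rw [hL1 C ⟨hC0.le, le_rfl⟩, hgC]
  · rw [hL2 _ ⟨hC2.le, le_rfl⟩, hgh, sub_zero]
  · have s1 : StrictMonoOn L (Icc 0 C) := hgm.congr fun t ht => (hL1 t ht).symm
    have s2 : StrictMonoOn L (Icc C (1 / 2)) := by
      intro x hx y hy hxy
      rw [hL2 x hx, hL2 y hy]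
      linarith [hga hx hy hxy]
    have s3 : StrictMonoOn L (Icc (1 / 2) P) := by
      intro x hx y hy hxy
      rw [hL3 x hx, hL3 y hy]
      have := hga (a := 1 - y) (b := 1 - x) ⟨by linarith [hy.2], by linarith [hy.1]⟩
        ⟨by linarith [hx.2], by linarith [hx.1]⟩ (by linarith)
      linarith
    have s12 : StrictMonoOn L (Icc 0 (1 / 2)) := by
      rw [← Icc_union_Icc_eq_Icc hC0.le hC2.le]
      exact s1.union s2 (isGreatest_Icc hC0.le) (isLeast_Icc hC2.le)
    rw [← Icc_union_Icc_eq_Icc (show (0 : ℝ) ≤ 1 / 2 by norm_num) (show 1 / 2 ≤ P by linarith)]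
    exact s12.union s3 (isGreatest_Icc (by norm_num)) (isLeast_Icc (by linarith))
  · rw [hLl P ⟨by linarith, by linarith⟩, hLl 1 ⟨by norm_num, le_rfl⟩, hl4 P le_rfl,
      hl4 1 (by linarith)]

/-! ### Coordinates of lifted orbits that avoid γ. -/

theorem fract_le_of_not_mem_liftArc {P t : ℝ} (ht : t ∉ liftArc P) : Int.fract t ≤ P := by
  rcases le_or_ge_of_stay ht (⌊t⌋ + 1) with h | h
  · push_cast at h
    have := Int.self_sub_floor t
    linarith
  · push_cast at h
    linarith [Int.lt_floor_add_one t]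

/-- The data of a lift of the outside map of `f`. -/
structure IsLiftOf (f : ℝ → ℝ) (a b c p : ℝ) (L : CircleDeg1Lift) : Prop where
  lift : IsOutsideLift L (halfScale a b c) (1 - halfScale a b p)
  eq_left : ∀ t ∈ Icc 0 (halfScale a b c), L t = halfMap f a b t
  eq_middle : ∀ t ∈ Icc (halfScale a b c) (1 / 2), L t = 1 - halfMap f a b t
  eq_right : ∀ t ∈ Icc (1 / 2) (1 - halfScale a b p), L t = 1 + halfMap f a b (1 - t)
  unimodal : IsUnimodal f a b c
  lt_p : c < p
  p_le : p ≤ b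
  map_p : f p = f a

namespace IsLiftOf

variable {L : CircleDeg1Lift}

theorem liftCoord_map (h : IsLiftOf f a b c p L) {t : ℝ}
    (ht : t ∉ liftArc (1 - halfScale a b p)) : liftCoord a b (L t) = f (liftCoord a b t) := by
  have hab := h.unimodal.lt
  have hr := fract_le_of_not_mem_liftArc ht
  have h0 := Int.fract_nonneg t
  have hdec : t = Int.fract t + ⌊t⌋ := (Int.fract_add_floor t).symm
  have hC2 := h.lift.C_lt
  have hC0 := h.lift.C_pos
  have hP1 := h.lift.P_lt
  rw [hdec, L.map_add_int, liftCoord_add_int, liftCoord_add_int]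
  set r := Int.fract t
  have hg : ∀ s ∈ Icc (0 : ℝ) (1 / 2), halfMap f a b s ∈ Icc (0 : ℝ) (1 / 2) := fun s hs =>
    halfScale_mem hab (h.unimodal.mapsTo (unscale_mem hab hs))
  have hinv : ∀ s, a + 2 * (b - a) * halfMap f a b s = f (a + 2 * (b - a) * s) := fun s =>
    add_mul_halfScale hab _
  rcases le_or_gt r (1 / 2) with h1 | h1
  · have hgr := hg r ⟨h0, h1⟩
    rw [liftCoord_of_le_half h0 h1]
    rcases le_or_gt r (halfScale a b c) with h2 | h2
    · rw [h.eq_left r ⟨h0, h2⟩, liftCoord_of_le_half hgr.1 hgr.2, hinv]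
    · rw [h.eq_middle r ⟨h2.le, h1⟩, liftCoord_of_half_le (by linarith [hgr.2])
        (by linarith [hgr.1]), sub_sub_cancel, hinv]
  · have hgr := hg (1 - r) ⟨by linarith, by linarith⟩
    rw [h.eq_right r ⟨h1.le, hr⟩, liftCoord_of_half_le h1.le (by linarith)]
    have := liftCoord_int_add (a := a) (b := b) (halfMap f a b (1 - r)) 1
    push_cast at this
    rw [this, liftCoord_of_le_half hgr.1 hgr.2, hinv]

theorem liftCoord_pow (h : IsLiftOf f a b c p L) {t : ℝ} (i : ℕ)
    (ht : ∀ j < i, (L ^ j) t ∉ liftArc (1 - halfScale a b p)) :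
    liftCoord a b ((L ^ i) t) = f^[i] (liftCoord a b t) := by
  induction i with
  | zero => simp
  | succ i ih =>
    rw [lift_pow_succ, h.liftCoord_map (ht i i.lt_succ_self), ih fun j hj => ht j (by omega),
      Function.iterate_succ_apply']

/-- Outside γ every upper point has coordinate at least p > c, so only on the lower half does the
side of c have to be decided. -/
theorem turning_le_liftCoord_iff (h : IsLiftOf f a b c p L) {t : ℝ}
    (ht : t ∉ liftArc (1 - halfScale a b p)) :
    c ≤ liftCoord a b t ↔ halfScale a b c ≤ Int.fract t := by
  have hab := h.unimodal.lt
  have hr := fract_le_of_not_mem_liftArc ht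
  have h0 := Int.fract_nonneg t
  have hm := (halfScale_strictMono hab).le_iff_le (a := c) (b := liftCoord a b t)
  rw [← hm]
  have hdec : t = Int.fract t + ⌊t⌋ := (Int.fract_add_floor t).symm
  nth_rw 1 [hdec]
  rw [liftCoord_add_int]
  rcases le_or_gt (Int.fract t) (1 / 2) with h1 | h1
  · rw [liftCoord_of_le_half h0 h1, halfScale_add_mul hab]
  · rw [liftCoord_of_half_le h1.le (by linarith [Int.fract_lt_one t]), halfScale_add_mul hab]
    have hcp := halfScale_strictMono hab h.lt_p
    have := h.lift.C_lt
    constructor <;> intro _ <;> linarith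

theorem liftCoord_eq_turning (h : IsLiftOf f a b c p L) {t : ℝ}
    (ht : t ∉ liftArc (1 - halfScale a b p)) (hc : liftCoord a b t = c) :
    Int.fract t = halfScale a b c := by
  have hab := h.unimodal.lt
  have hr := fract_le_of_not_mem_liftArc ht
  have h0 := Int.fract_nonneg t
  have hdec : t = Int.fract t + ⌊t⌋ := (Int.fract_add_floor t).symm
  rw [hdec, liftCoord_add_int] at hc
  rcases le_or_gt (Int.fract t) (1 / 2) with h1 | h1
  · rw [liftCoord_of_le_half h0 h1] at hc
    rw [← hc, halfScale_add_mul hab]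
  · rw [liftCoord_of_half_le h1.le (by linarith [Int.fract_lt_one t])] at hc
    have hcp := halfScale_strictMono hab h.lt_p
    rw [← hc, halfScale_add_mul hab] at hcp
    linarith

/-- An interval avoiding γ contains a point whose coordinate reaches c. That point sits at c_l, and
two further steps take it through b̂ to â, an end point of γ. Nearby points on its left are not
collapsed onto it and fall into γ. -/
theorem meetsArc (h : IsLiftOf f a b c p L) (hc : HitsTurningPoint f a b c) :
    MeetsArc L (1 - halfScale a b p) := by
  have hab := h.unimodal.lt
  have hba := sub_pos.2 hab
  intro u v huv
  by_contra! hcon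
  obtain ⟨i, t, ht, htc⟩ : ∃ i, ∃ t ∈ Ioo u v, f^[i] (liftCoord a b t) = c := by
    have h1 := Int.floor_le u
    have h2 := Int.lt_floor_add_one u
    set k := ⌊u⌋
    -- The coordinate is injective only on a half circle, so the interval is cut at 1/2 or at 1.
    rcases lt_or_ge (u - k) (1 / 2) with h3 | h3
    · have h4 : u - k < min (v - k) (1 / 2) := lt_min (by linarith) h3
      obtain ⟨i, z, hz, hzc⟩ := hc (a + 2 * (b - a) * (u - k))
        (a + 2 * (b - a) * min (v - k) (1 / 2)) (by nlinarith) (by nlinarith)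
        (by nlinarith [min_le_right (v - k) (1 / 2)])
      rw [← add_mul_halfScale hab z] at hz
      have h5 : u - k < halfScale a b z := by nlinarith [hz.1]
      have h6 : halfScale a b z < min (v - k) (1 / 2) := by nlinarith [hz.2]
      refine ⟨i, halfScale a b z + k, ⟨by linarith, by linarith [min_le_left (v - k) (1 / 2)]⟩, ?_⟩
      rw [liftCoord_add_int, liftCoord_of_le_half (by linarith)
        (by linarith [min_le_right (v - k) (1 / 2)]), add_mul_halfScale hab, hzc]
    · have h4 : u - k < min (v - k) 1 := lt_min (by linarith) (by linarith)
      obtain ⟨i, z, hz, hzc⟩ := hc (a + 2 * (b - a) * (1 - min (v - k) 1))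
        (a + 2 * (b - a) * (1 - (u - k))) (by nlinarith [min_le_right (v - k) 1]) (by nlinarith)
        (by nlinarith)
      rw [← add_mul_halfScale hab z] at hz
      have h5 : 1 - min (v - k) 1 < halfScale a b z := by nlinarith [hz.1]
      have h6 : halfScale a b z < 1 - (u - k) := by nlinarith [hz.2]
      refine ⟨i, (1 - halfScale a b z) + k, ⟨by linarith, by linarith [min_le_left (v - k) 1]⟩, ?_⟩
      rw [liftCoord_add_int, liftCoord_of_half_le (by linarith)
        (by linarith [min_le_right (v - k) 1]), sub_sub_cancel, add_mul_halfScale hab, hzc]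
  rw [← h.liftCoord_pow i fun j _ => hcon j t ht] at htc
  have h1 := h.liftCoord_eq_turning (hcon i t ht) htc
  have h2 : (L ^ i) t = halfScale a b c + ⌊(L ^ i) t⌋ := by
    rw [← h1]; exact (Int.fract_add_floor _).symm
  set k := ⌊(L ^ i) t⌋
  have h3 : (L ^ (i + 2)) t = 1 + k := by
    rw [show i + 2 = (i + 1) + 1 by ring, lift_pow_succ, lift_pow_succ, h2, L.map_add_int,
      h.lift.map_C, L.map_add_int, h.lift.map_half]
  have hnhds : (L ^ (i + 2)) ⁻¹' Ioi (k + (1 - halfScale a b p)) ∈ 𝓝 t :=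
    (isOpen_Ioi.preimage (h.lift.pow_continuous _)).mem_nhds (by
      rw [mem_preimage, h3, mem_Ioi]; linarith [h.lift.P_lt])
  obtain ⟨l, r, hlr, hsub⟩ := mem_nhds_iff_exists_Ioo_subset.1 hnhds
  obtain ⟨t', ht1, ht2⟩ := exists_between (max_lt hlr.1 ht.1)
  have hut' : u < t' := (le_max_right _ _).trans_lt ht1
  have h4 := hsub ⟨(le_max_left _ _).trans_lt ht1, ht2.trans hlr.2⟩
  have h5 := h.lift.pow_lt_of_avoids ht2 (fun j s hs =>
    hcon j s ⟨hut'.trans hs.1, hs.2.trans ht.2⟩) (i + 2)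
  rw [h3] at h5
  refine hcon (i + 2) t' ⟨hut', ht2.trans ht.2⟩ ⟨k + 1, ?_, ?_⟩
  · rw [mem_preimage, mem_Ioi] at h4
    push_cast
    linarith
  · push_cast; linarith

end IsLiftOf

end Lift

/-! ### The kneading sequence and the rotation number -/

section Kneading

variable {f : ℝ → ℝ} {a b c p : ℝ} {L : CircleDeg1Lift} {C P : ℝ} {q : ℚ}

theorem IsOutsideLift.map_zero_nonneg (H : IsOutsideLift L C P) : 0 ≤ L 0 := by
  have h1 : L (1 / 2) ≤ L P := L.monotone H.half_le
  have h2 := L.map_one_add 0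
  rw [add_zero] at h2
  rw [H.map_half, H.map_P, h2] at h1
  linarith

theorem IsOutsideLift.map_lt_half (H : IsOutsideLift L C P) {r : ℝ} (h0 : 0 ≤ r) (h : r < C) :
    L r < 1 / 2 := by
  rw [← H.map_C]
  exact H.strictMonoOn ⟨h0, by linarith [H.C_lt, H.half_le]⟩
    ⟨H.C_pos.le, by linarith [H.C_lt, H.half_le]⟩ h

theorem IsOutsideLift.map_map_lt_one (H : IsOutsideLift L C P) {r : ℝ} (h0 : 0 ≤ r) (h : r < C) :
    L (L r) < 1 := by
  have h1 := H.map_lt_half h0 h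
  have h2 : 0 ≤ L r := H.map_zero_nonneg.trans (L.monotone h0)
  rw [← H.map_half]
  exact H.strictMonoOn ⟨h2, by linarith [H.half_le]⟩ ⟨by norm_num, H.half_le⟩ h1

open Classical in
-- C is the point that L² sends to 1, so on [0,1) the value of L² is at least 1 exactly from C on;
-- it stays below 2 because L²(0) < 1.
theorem IsOutsideLift.floor_map_map (H : IsOutsideLift L C P) (t : ℝ) :
    ⌊L (L t)⌋ - ⌊t⌋ = if C ≤ Int.fract t then 1 else 0 := by
  have h0 := Int.fract_nonneg t
  have h1 := Int.fract_lt_one t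
  have hdec : L (L t) = L (L (Int.fract t)) + ⌊t⌋ := by
    rw [← L.map_add_int, ← L.map_add_int, Int.fract_add_floor]
  rw [hdec, Int.floor_add_intCast, add_sub_cancel_right]
  set r := Int.fract t
  split_ifs with h
  · rw [Int.floor_eq_iff]
    constructor
    · have : L (L C) ≤ L (L r) := L.monotone (L.monotone h)
      rw [H.map_C, H.map_half] at this
      exact_mod_cast this
    · have h2 : L r ≤ L (1 + 0) := L.monotone (by linarith)
      rw [L.map_one_add] at h2
      have h3 : L (L r) ≤ L (1 + L 0) := L.monotone h2
      rw [L.map_one_add] at h3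
      have := H.map_map_lt_one le_rfl H.C_pos
      push_cast
      linarith
  · rw [Int.floor_eq_zero_iff]
    have h2 : 0 ≤ L r := H.map_zero_nonneg.trans (L.monotone h0)
    exact ⟨H.map_zero_nonneg.trans (L.monotone h2), H.map_map_lt_one h0 (not_le.1 h)⟩

/-- The number of turns around the circle made by the orbit of `â`. -/
noncomputable def turns (L : CircleDeg1Lift) (i : ℕ) : ℤ := ⌊(L ^ i) 0⌋

theorem turns_zero : turns L 0 = 0 := by simp [turns]

theorem IsOutsideLift.turns_one (H : IsOutsideLift L C P) : turns L 1 = 0 := by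
  rw [turns, pow_one, Int.floor_eq_zero_iff]
  exact ⟨H.map_zero_nonneg, by linarith [H.map_lt_half le_rfl H.C_pos]⟩

theorem IsOutsideLift.turns_monotone (H : IsOutsideLift L C P) : Monotone (turns L) :=
  monotone_nat_of_le_succ fun i => Int.floor_mono (by
    rw [lift_pow_add, pow_one]; exact (L ^ i).monotone H.map_zero_nonneg)

theorem int_not_mem_liftArc (hP : 0 < P) (k : ℤ) : (k : ℝ) ∉ liftArc P := by
  rintro ⟨j, h1, h2⟩
  have h3 : k < j := by exact_mod_cast h2
  have h4 : (k : ℝ) + 1 ≤ j := by exact_mod_cast h3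
  linarith

theorem liftCoord_zero : liftCoord a b 0 = a := by simp [liftCoord]

namespace IsLiftOf

theorem kneading_zero (h : IsLiftOf f a b c p L) : kneading f b c 0 = 1 := by
  unfold kneading
  rw [itinerary_eq_one]
  exact h.unimodal.lt_right.le

theorem kneading_add_succ (h : IsLiftOf f a b c p L) (j i : ℕ) :
    kneading f b c (j + (i + 1)) = itinerary f c (f^[i] a) j := by
  unfold kneading
  rw [itinerary_add, Function.iterate_succ_apply, h.unimodal.map_right]

/-- The symbols of the kneading sequence count the turns of the orbit of `â`. -/
theorem kneading_succ (h : IsLiftOf f a b c p L) {i : ℕ}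
    (hi : ∀ j ≤ i, (L ^ j) 0 ∉ liftArc (1 - halfScale a b p)) :
    ((kneading f b c (i + 1) : ℕ) : ℤ) = turns L (i + 2) - turns L i := by
  classical
  have h1 := h.lift.floor_map_map ((L ^ i) 0)
  rw [← lift_pow_succ, ← lift_pow_succ] at h1
  unfold turns
  rw [h1, ← zero_add (i + 1), h.kneading_add_succ]
  have h2 := h.liftCoord_pow i (t := 0) fun j hj => hi j hj.le
  rw [liftCoord_zero] at h2
  have h3 := h.turning_le_liftCoord_iff (hi i le_rfl)
  rw [h2] at h3
  split_ifs with h4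
  · rw [itinerary_eq_one.2 (by simpa using h3.2 h4)]; rfl
  · rw [itinerary_eq_zero.2 (by simpa using not_le.1 fun h5 => h4 (h3.1 h5))]; rfl

end IsLiftOf

theorem cast_mul_den (q : ℚ) : (q.den : ℝ) * q = q.num := by exact_mod_cast mul_den_eq q

theorem ceilCount_lt {i : ℕ} (hi : 0 < i) : (ceilCount q i : ℝ) < i * q := by
  rw [ceilCount_of_pos hi]
  have : ((⌈(i : ℚ) * q⌉ - 1 : ℤ) : ℚ) < i * q := by
    push_cast; linarith [Int.ceil_lt_add_one ((i : ℚ) * q)]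
  exact_mod_cast this

theorem le_ceilCount {i : ℕ} (hi : 0 < i) {k : ℤ} (h : (k : ℝ) < i * q) : k ≤ ceilCount q i := by
  rw [ceilCount_of_pos hi]
  have : k < ⌈(i : ℚ) * q⌉ := by rw [Int.lt_ceil]; exact_mod_cast h
  omega

namespace IsLiftOf

/-- The orbit of â turns at most as often as the rotation through q. If it falls behind by time n +
1, the counts give the order. Otherwise s begins with the odd word c_q 1, and the order is read from
the tail, which is the itinerary of a point below b. -/
theorem NBT_lt_kneading (h : IsLiftOf f a b c p L) (hc : HitsTurningPoint f a b c) (hq0 : 0 < q)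
    (hq2 : q ≤ 1 / 2) (hq : L.translationNumber < q) : ULt (NBT q) (kneading f b c) := by
  classical
  have H := h.lift
  have hle : ∀ i, turns L i ≤ ceilCount q i := by
    intro i
    rcases Nat.eq_zero_or_pos i with rfl | hi
    · rw [turns_zero, ceilCount_zero]
    · refine le_ceilCount hi ?_
      have h1 : (turns L i : ℝ) ≤ i * L.translationNumber :=
        le_mul_translationNumber (x := 0) (by rw [zero_add]; exact Int.floor_le _)
      have hi' : (0 : ℝ) < i := by exact_mod_cast hi
      nlinarith
  have hvalid : ∀ j, turns L j = ceilCount q j → (L ^ j) 0 ∉ liftArc (1 - halfScale a b p) := by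
    intro j hj
    rcases Nat.eq_zero_or_pos j with rfl | hj0
    · have := int_not_mem_liftArc H.P_pos 0
      simpa using this
    · rintro ⟨k, h1, h2⟩
      have h3 := H.mul_translationNumber_of_return hj0 h1.le h2.le
      have h4 : turns L j < k := Int.floor_lt.2 h2
      have hj' : (0 : ℝ) < j := by exact_mod_cast hj0
      have := le_ceilCount (q := q) hj0 (k := k) (by rw [← h3]; gcongr)
      omega
  by_cases hex : ∃ I, I ≤ q.den + 1 ∧ turns L I < ceilCount q I
  · obtain ⟨hI1, hI2⟩ := Nat.find_spec hex
    have hmin : ∀ i < Nat.find hex, turns L i = ceilCount q i := fun i hi => by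
      have := Nat.find_min hex hi
      have := hle i
      push Not at *
      have := ‹i ≤ q.den + 1 → _› (by omega)
      omega
    refine ULt.of_counts (x := turns L) (y := ceilCount q) (I := Nat.find hex) h.kneading_zero
      (by rw [NBT_of_le hq0 hq2 (by omega), rotSeq_zero]) turns_zero H.turns_one rfl
      (ceilCount_one hq0 hq2) H.turns_monotone ?_ ?_ hmin hI2
    · intro i hi
      exact h.kneading_succ fun j hj => hvalid j (hmin j (by omega))
    · intro i hi
      rw [NBT_of_le hq0 hq2 (by omega), rotSeq_succ hq0 hq2]
  · push Not at hex
    have heq : ∀ i ≤ q.den + 1, turns L i = ceilCount q i := fun i hi =>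
      le_antisymm (hle i) (hex i hi)
    have hpre : ∀ i ≤ q.den, kneading f b c i = rotSeq q i := by
      intro i hi
      rcases i with _ | i
      · rw [h.kneading_zero, rotSeq_zero]
      · have h1 := h.kneading_succ (i := i) fun j hj => hvalid j (heq j (by omega))
        rw [heq _ (by omega), heq _ (by omega), ← rotSeq_succ hq0 hq2] at h1
        exact Fin.ext (by exact_mod_cast h1)
    have hlast : kneading f b c (q.den + 1) = 1 := by
      have h1 := h.kneading_succ (i := q.den) fun j hj => hvalid j (heq j (by omega))
      have h2 : turns L (q.den + 1) ≤ turns L (q.den + 2) := H.turns_monotone (by omega)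
      rw [heq _ (by omega), ceilCount_den_succ hq0 hq2] at h2
      rw [heq _ (by omega : q.den ≤ q.den + 1), ceilCount_den] at h1
      have h3 := (kneading f b c (q.den + 1)).is_lt
      apply Fin.ext
      rw [Fin.val_one]
      omega
    have ha : a ∈ Icc a b := ⟨le_rfl, h.unimodal.lt.le⟩
    have hmem := h.unimodal.iterate_mem ha q.den
    -- A hit at c would put the next point at b̂, half a turn short of the count required at time n
    -- + 1.
    have hne : f^[q.den] a ≠ c := by
      intro he
      have h1 := h.liftCoord_pow q.den (t := 0) fun j hj => hvalid j (heq j (by omega))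
      rw [liftCoord_zero, he] at h1
      have h2 := h.liftCoord_eq_turning (hvalid _ (heq _ (by omega))) h1
      have h3 := heq (q.den + 1) le_rfl
      have h4 := heq q.den (by omega)
      rw [ceilCount_den_succ hq0 hq2] at h3
      rw [ceilCount_den] at h4
      have h5 : (L ^ (q.den + 1)) 0 = 1 / 2 + ((q.num - 1 : ℤ) : ℝ) := by
        rw [lift_pow_succ, ← Int.fract_add_floor ((L ^ q.den) 0), h2, L.map_add_int, H.map_C]
        rw [turns] at h4
        rw [h4]
      rw [turns, h5, Int.floor_add_intCast] at h3
      norm_num at h3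
    have hlt : f^[q.den + 1] a < b := by
      rw [Function.iterate_succ_apply']; exact h.unimodal.map_lt hmem hne
    have hu := itinerary_lt h.unimodal hc (h.unimodal.iterate_mem ha (q.den + 1)).1 hlt le_rfl
    have hagree : ∀ j < q.den + 2, kneading f b c j = NBT q j := fun j hj => by
      rcases lt_or_ge j (q.den + 1) with hj' | hj'
      · rw [hpre j (by omega), NBT_of_le hq0 hq2 (by omega)]
      · obtain rfl : j = q.den + 1 := by omega
        rw [hlast, NBT_den_add_one]
    have hu' := ULt.repeat_of_lt (s := kneading f b c) (N := NBT q) (l := q.den + 2) (by omega) hagree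
      (fun j => h.kneading_add_succ j _) NBT_add hu
    refine ULt.of_prefix_of_odd hagree (odd_sum_of_prefix hq0 hq2 hpre hlast) ?_
    simp only [NBT_add]
    convert hu' using 2 with j
    exact h.kneading_add_succ j (q.den + 1)

/-! ### The kneading sequence when the rotation number is rational. -/

section Rational

variable (h : IsLiftOf f a b c p L) (hc : HitsTurningPoint f a b c) (hq0 : 0 < q)
  (hq2 : q ≤ 1 / 2) (hq : L.translationNumber = q)

include h hq in
theorem pow_not_mem_liftArc {i : ℕ} (hi : i < q.den) :
    (L ^ i) 0 ∉ liftArc (1 - halfScale a b p) := by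
  rcases Nat.eq_zero_or_pos i with rfl | hi0
  · have := int_not_mem_liftArc h.lift.P_pos 0
    simpa using this
  · rintro ⟨k, h1, h2⟩
    exact not_flat_of_lt_den h.lift hq hi0 hi h1.le h2.le

omit h in
include hq in
theorem turns_eq_ceilCount {i : ℕ} (hi : i < q.den) : turns L i = ceilCount q i := by
  rcases Nat.eq_zero_or_pos i with rfl | hi0
  · rw [turns_zero, ceilCount_zero]
  rw [ceilCount_eq_floor hi]
  have hf1 : ((⌊(i : ℚ) * q⌋ : ℤ) : ℝ) ≤ i * q := by
    exact_mod_cast Int.floor_le ((i : ℚ) * q)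
  have hf2 : (i : ℝ) * q < (⌊(i : ℚ) * q⌋ : ℤ) + 1 := by
    exact_mod_cast Int.lt_floor_add_one ((i : ℚ) * q)
  rw [turns, Int.floor_eq_iff]
  set k := ⌊(i : ℚ) * q⌋
  constructor
  · by_contra! h1
    have h2 : i * L.translationNumber ≤ k := mul_translationNumber_le (x := 0) (by linarith)
    rw [hq] at h2
    obtain ⟨j, hj, -⟩ := exists_of_mul_eq (le_antisymm h2 hf1)
    rcases Nat.eq_zero_or_pos j with rfl | hj0
    · omega
    · have := Nat.le_mul_of_pos_right q.den hj0
      omega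
  · by_contra! h1
    have h2 : ((k + 1 : ℤ) : ℝ) ≤ i * L.translationNumber :=
      le_mul_translationNumber (x := 0) (by push_cast; linarith)
    rw [hq] at h2
    push_cast at h2
    linarith

include h hq hc in
theorem turns_den_succ : turns L (q.den + 1) = q.num := by
  obtain ⟨h1, h2⟩ := return_mem h.lift (h.meetsArc hc) hq
  rw [turns, lift_pow_succ, h.lift.map_eq_of_flat h1 h2, Int.floor_add_intCast,
    show ⌊L 0⌋ = 0 by simpa [turns] using h.lift.turns_one, zero_add]

include h hq hc in
/-- The coordinate of the first return of `â` to `γ`. -/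
theorem iterate_den_eq : f^[q.den] a = a + 2 * (b - a) * (q.num - (L ^ q.den) 0) := by
  obtain ⟨h1, h2⟩ := return_mem h.lift (h.meetsArc hc) hq
  have h3 := h.liftCoord_pow q.den (t := 0) fun j hj => h.pow_not_mem_liftArc hq hj
  rw [liftCoord_zero] at h3
  rw [← h3]
  have h4 := h.lift.half_le
  have h5 : (L ^ q.den) 0 = ((L ^ q.den) 0 - q.num + 1) + ((q.num - 1 : ℤ) : ℝ) := by
    push_cast; ring
  rw [h5, liftCoord_add_int, liftCoord_of_half_le (by linarith) (by linarith)]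
  push_cast
  ring

include h hq hc hq0 hq2 in
-- The coordinate of â is periodic, so s has period n. Its block differs from the rotation coding
-- only at place n - 1: the orbit reaches m exactly at time n, whereas the open count is m - 1, and
-- this turns that symbol from 0 into 1.
theorem kneading_eq_lhe (hr : (L ^ q.den) 0 = q.num) : kneading f b c = lhe q := by
  have h2 := two_le_den hq0 hq2
  have hper : f^[q.den] a = a := by rw [h.iterate_den_eq hc hq, hr]; ring
  have hden : turns L q.den = q.num := by rw [turns, hr, Int.floor_intCast]
  have hsym : ∀ i < q.den, ((kneading f b c (i + 1) : ℕ) : ℤ) = turns L (i + 2) - turns L i :=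
    fun i hi => h.kneading_succ fun j hj => h.pow_not_mem_liftArc hq (by omega)
  have hkn : kneading f b c q.den = 1 := by
    have h1 := hsym (q.den - 1) (by omega)
    have h3 := rotSeq_succ hq0 hq2 (q.den - 1)
    rw [show q.den - 1 + 1 = q.den by omega] at h1 h3
    rw [show q.den - 1 + 2 = q.den + 1 by omega] at h1 h3
    rw [h.turns_den_succ hc hq, turns_eq_ceilCount hq (by omega)] at h1
    rw [rotSeq_den hq0 hq2, ceilCount_den_succ hq0 hq2, ← h1] at h3
    exact Fin.ext (by exact_mod_cast h3.symm)
  have hperiod : ∀ i, kneading f b c (i + q.den) = kneading f b c i := by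
    intro i
    rcases i with _ | i
    · rw [zero_add, hkn, h.kneading_zero]
    · rw [show i + 1 + q.den = i + (q.den + 1) by ring, h.kneading_add_succ, hper,
        show i + 1 = i + (0 + 1) by ring, h.kneading_add_succ]
      rfl
  funext i
  induction i using Nat.strong_induction_on with
  | _ i ih =>
    rcases lt_or_ge i q.den with hi | hi
    · rcases i with _ | i
      · rw [h.kneading_zero]
        rw [lhe_of_lt hq0 hq2 (by omega), rotSeq_zero]
      · have h1 := hsym i (by omega)
        rcases lt_or_ge (i + 1) (q.den - 1) with hi' | hi'
        · rw [lhe_of_lt hq0 hq2 hi']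
          rw [turns_eq_ceilCount hq (by omega), turns_eq_ceilCount hq (by omega),
            ← rotSeq_succ hq0 hq2] at h1
          exact Fin.ext (by exact_mod_cast h1)
        · have hi2 : i + 2 = q.den := by omega
          have h3 := rotSeq_succ hq0 hq2 i
          have h4 := rotSeq_den_sub_one hq0 hq2
          rw [show q.den - 1 = i + 1 by omega] at h4
          rw [h4, hi2, ceilCount_den] at h3
          rw [hi2, hden, turns_eq_ceilCount hq (by omega)] at h1
          have h5 := lhe_den_sub_one (q := q)
          rw [show q.den - 1 = i + 1 by omega] at h5
          rw [h5]
          apply Fin.ext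
          rw [Fin.val_one]
          simp at h3
          omega
    · obtain ⟨k, rfl⟩ := Nat.exists_eq_add_of_le' hi
      rw [hperiod, lhe_add]
      exact ih k (by omega)

include h hq hc hq0 hq2 in
-- If the return stops short of m, then the turns agree with the rotation counts up to time n + 1,
-- so s begins with c_q.
theorem kneading_prefix (hr : (L ^ q.den) 0 ≠ q.num) {i : ℕ} (hi : i ≤ q.den) :
    kneading f b c i = rotSeq q i := by
  obtain ⟨hr1, hr2⟩ := return_mem h.lift (h.meetsArc hc) hq
  have hden : turns L q.den = ceilCount q q.den := by
    rw [turns, ceilCount_den, Int.floor_eq_iff]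
    push_cast
    have := h.lift.P_pos
    exact ⟨by linarith, by linarith [lt_of_le_of_ne hr2 hr]⟩
  have heq : ∀ j ≤ q.den + 1, turns L j = ceilCount q j := by
    intro j hj
    rcases lt_or_ge j q.den with h1 | h1
    · exact turns_eq_ceilCount hq h1
    · rcases h1.eq_or_lt with rfl | h1
      · exact hden
      · obtain rfl : j = q.den + 1 := by omega
        rw [h.turns_den_succ hc hq, ceilCount_den_succ hq0 hq2]
  rcases i with _ | i
  · rw [h.kneading_zero, rotSeq_zero]
  · have h1 := h.kneading_succ (i := i) fun j hj => h.pow_not_mem_liftArc hq (by omega)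
    rw [heq _ (by omega), heq _ (by omega), ← rotSeq_succ hq0 hq2] at h1
    exact Fin.ext (by exact_mod_cast h1)

include h hq hc hq0 hq2 in
-- Let z be the return. On the decreasing branch z < p gives f(z) > f(p) = f(a). The itinerary of
-- f(a) is one block of the periodic tail of rhe(q) followed by that of f(z). So the latter exceeds
-- the periodic tail, and the odd prefix c_q 1 reverses the inequality.
theorem kneading_lt_rhe_of_ge (hr : (L ^ q.den) 0 ≠ q.num) (h1 : c ≤ f^[q.den] a)
    (h2 : f^[q.den] a < p) : ULt (kneading f b c) (rhe q) := by
  have hd := two_le_den hq0 hq2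
  have hpre : ∀ i ≤ q.den, kneading f b c i = rotSeq q i := fun i hi =>
    h.kneading_prefix hc hq0 hq2 hq hr hi
  have ha : a ∈ Icc a b := ⟨le_rfl, h.unimodal.lt.le⟩
  have hz := h.unimodal.iterate_mem ha q.den
  have hlast : kneading f b c (q.den + 1) = 1 := by
    rw [← zero_add (q.den + 1), h.kneading_add_succ, itinerary_eq_one]; exact h1
  have hlt : f a < f^[q.den + 1] a := by
    rw [Function.iterate_succ_apply', ← h.map_p]
    exact h.unimodal.strictAntiOn ⟨h1, hz.2⟩ ⟨h.lt_p.le, h.p_le⟩ h2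
  have hu := itinerary_lt h.unimodal hc (h.unimodal.mapsTo ha).1 hlt
    (h.unimodal.iterate_mem ha (q.den + 1)).2
  have hshift : ∀ j, itinerary f c (f a) j = kneading f b c (j + 2) := fun j => by
    rw [h.kneading_add_succ]; rfl
  have hu' := ULt.repeat_of_gt (s := itinerary f c (f a)) (N := fun j => rotSeq q (j + 2))
    (l := q.den) q.den_pos (fun j hj => by
      rw [hshift]
      rcases lt_or_ge (j + 2) (q.den + 1) with h3 | h3
      · exact hpre _ (by omega)
      · rw [show j + 2 = q.den + 1 by omega, hlast, rotSeq_den_add_one hq0 hq2])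
    (t := itinerary f c (f^[q.den + 1] a)) (fun j => by
      rw [hshift, ← h.kneading_add_succ]; congr 1)
    (fun j => by rw [show j + q.den + 2 = (j + 2) + q.den by ring, rotSeq_add_den _ (by omega)]) hu
  rw [rhe_eq_rotSeq hq0 hq2]
  refine ULt.of_prefix_of_odd (s := rotSeq q) (l := q.den + 2) (fun j hj => ?_)
    (odd_sum_of_prefix hq0 hq2 (fun _ _ => rfl) (rotSeq_den_add_one hq0 hq2)) ?_
  · rcases lt_or_ge j (q.den + 1) with h3 | h3
    · rw [hpre j (by omega)]
    · rw [show j = q.den + 1 by omega, hlast, rotSeq_den_add_one hq0 hq2]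
  · convert hu' using 2 with j j
    · rw [show j + (q.den + 2) = (j + 2) + q.den by ring, rotSeq_add_den _ (by omega)]
    · exact h.kneading_add_succ j (q.den + 1)

include h hq hc hq0 hq2 in
-- Since f(p) = f(a), the sequence repeats from index 2 on with period n, as the rotation coding
-- does.
theorem kneading_eq_rhe (hr : (L ^ q.den) 0 ≠ q.num) (hp : f^[q.den] a = p) :
    kneading f b c = rhe q := by
  rw [rhe_eq_rotSeq hq0 hq2]
  have hd := two_le_den hq0 hq2
  have hpre : ∀ i ≤ q.den, kneading f b c i = rotSeq q i := fun i hi =>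
    h.kneading_prefix hc hq0 hq2 hq hr hi
  funext i
  induction i using Nat.strong_induction_on with
  | _ i ih =>
    rcases lt_or_ge i (q.den + 1) with hi | hi
    · exact hpre i (by omega)
    · rcases hi.eq_or_lt with rfl | hi
      · rw [rotSeq_den_add_one hq0 hq2, ← zero_add (q.den + 1), h.kneading_add_succ,
          itinerary_eq_one, hp]
        exact h.lt_p.le
      · obtain ⟨k, rfl⟩ := Nat.exists_eq_add_of_le' (show q.den + 2 ≤ i by omega)
        have h1 : kneading f b c (k + (q.den + 2)) = kneading f b c (k + 2) := by
          rw [h.kneading_add_succ k (q.den + 1), h.kneading_add_succ k 1,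
            Function.iterate_succ_apply', hp, h.map_p]
          rfl
        rw [h1, show k + (q.den + 2) = (k + 2) + q.den by ring, rotSeq_add_den _ (by omega)]
        exact ih _ (by omega)

include h hq hc hq0 hq2 in
theorem kneading_lt_of_lt (hr : (L ^ q.den) 0 ≠ q.num) (h1 : f^[q.den] a < c) :
    ULt (kneading f b c) (NBT q) := by
  have hd := two_le_den hq0 hq2
  refine lt_of_prefix_zero hq0 hq2 (fun i hi => h.kneading_prefix hc hq0 hq2 hq hr hi) ?_
    (fun i hi => NBT_of_le hq0 hq2 hi) NBT_den_add_one
  rw [← zero_add (q.den + 1), h.kneading_add_succ, itinerary_eq_zero]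
  exact h1

include h hq hc hq0 hq2 in
-- The return at c is followed by b, so after c_q 1 the kneading sequence starts afresh.
theorem kneading_eq_NBT (hr : (L ^ q.den) 0 ≠ q.num) (h1 : f^[q.den] a = c) :
    kneading f b c = NBT q := by
  have hpre : ∀ i ≤ q.den, kneading f b c i = rotSeq q i := fun i hi =>
    h.kneading_prefix hc hq0 hq2 hq hr hi
  funext i
  induction i using Nat.strong_induction_on with
  | _ i ih =>
    rcases lt_or_ge i (q.den + 1) with hi | hi
    · rw [hpre i (by omega), NBT_of_le hq0 hq2 (by omega)]
    · rcases hi.eq_or_lt with rfl | hi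
      · rw [NBT_den_add_one, ← zero_add (q.den + 1), h.kneading_add_succ, itinerary_eq_one, h1]
        exact le_rfl
      · obtain ⟨k, rfl⟩ := Nat.exists_eq_add_of_le' (show q.den + 2 ≤ i by omega)
        rw [h.kneading_add_succ k (q.den + 1), Function.iterate_succ_apply', h1,
          h.unimodal.map_turning, NBT_add, ← ih k (by omega)]
        rfl

include h hq hc hq0 hq2 in
theorem NBT_lt_kneading_of_gt (hr : (L ^ q.den) 0 ≠ q.num) (h1 : c < f^[q.den] a) :
    ULt (NBT q) (kneading f b c) := by
  have hpre : ∀ i ≤ q.den, kneading f b c i = rotSeq q i := fun i hi =>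
    h.kneading_prefix hc hq0 hq2 hq hr hi
  have ha : a ∈ Icc a b := ⟨le_rfl, h.unimodal.lt.le⟩
  have hlast : kneading f b c (q.den + 1) = 1 := by
    rw [← zero_add (q.den + 1), h.kneading_add_succ, itinerary_eq_one]; exact h1.le
  have hlt : f^[q.den + 1] a < b := by
    rw [Function.iterate_succ_apply']
    exact h.unimodal.map_lt (h.unimodal.iterate_mem ha _) h1.ne'
  have hu := itinerary_lt h.unimodal hc (h.unimodal.iterate_mem ha (q.den + 1)).1 hlt le_rfl
  have hagree : ∀ j < q.den + 2, kneading f b c j = NBT q j := fun j hj => by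
    rcases lt_or_ge j (q.den + 1) with hj' | hj'
    · rw [hpre j (by omega), NBT_of_le hq0 hq2 (by omega)]
    · obtain rfl : j = q.den + 1 := by omega
      rw [hlast, NBT_den_add_one]
  have hu' := ULt.repeat_of_lt (s := kneading f b c) (N := NBT q) (l := q.den + 2) (by omega) hagree
    (fun j => h.kneading_add_succ j _) NBT_add hu
  refine ULt.of_prefix_of_odd hagree (odd_sum_of_prefix hq0 hq2 hpre hlast) ?_
  simp only [NBT_add]
  convert hu' using 2 with j
  exact h.kneading_add_succ j (q.den + 1)

include h hq hc hq0 hq2 in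
theorem lhe_lt_kneading (hr : (L ^ q.den) 0 ≠ q.num) : ULt (lhe q) (kneading f b c) :=
  lhe_lt_of_prefix hq0 hq2 fun _ hi => h.kneading_prefix hc hq0 hq2 hq hr hi.le

include h hq hc in
theorem iterate_den_le : f^[q.den] a ≤ p := by
  obtain ⟨h1, -⟩ := return_mem h.lift (h.meetsArc hc) hq
  rw [h.iterate_den_eq hc hq, ← add_mul_halfScale h.unimodal.lt p]
  have := sub_pos.2 h.unimodal.lt
  nlinarith

include h hq hc in
theorem iterate_den_eq_left_iff : f^[q.den] a = a ↔ (L ^ q.den) 0 = q.num := by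
  rw [h.iterate_den_eq hc hq]
  have := sub_pos.2 h.unimodal.lt
  constructor
  · intro h1
    have : 2 * (b - a) * (q.num - (L ^ q.den) 0) = 0 := by linarith
    rcases mul_eq_zero.1 this with h2 | h2 <;> linarith
  · intro h1; rw [h1]; ring

include h hq hc in
theorem iterate_den_eq_p_iff :
    f^[q.den] a = p ↔ (L ^ q.den) 0 = q.num + (1 - halfScale a b p) - 1 := by
  rw [h.iterate_den_eq hc hq]
  have hab := h.unimodal.lt
  have hs := add_mul_halfScale hab p
  have := sub_pos.2 hab
  constructor
  · intro h1
    have h2 := mul_left_cancel₀ (by positivity : (2 * (b - a)) ≠ 0)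
      (add_left_cancel (h1.trans hs.symm))
    linarith
  · intro h1
    rw [h1]
    linear_combination hs

include h hq hc hq0 hq2 in
theorem kneading_le_rhe : kneading f b c = rhe q ∨ ULt (kneading f b c) (rhe q) := by
  by_cases hr : (L ^ q.den) 0 = q.num
  · right
    rw [h.kneading_eq_lhe hc hq0 hq2 hq hr]
    exact lhe_lt_rhe hq0 hq2
  · rcases lt_or_ge (f^[q.den] a) c with h1 | h1
    · exact Or.inr ((h.kneading_lt_of_lt hc hq0 hq2 hq hr h1).trans (NBT_lt_rhe hq0 hq2))
    · rcases (h.iterate_den_le hc hq).eq_or_lt with h2 | h2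
      · exact Or.inl (h.kneading_eq_rhe hc hq0 hq2 hq hr h2)
      · exact Or.inr (h.kneading_lt_rhe_of_ge hc hq0 hq2 hq hr h1 h2)

end Rational

/-! ### Height as rotation number. -/

theorem translationNumber_nonneg (h : IsLiftOf f a b c p L) : 0 ≤ L.translationNumber := by
  have := le_mul_translationNumber (L := L) (i := 1) (k := 0) (x := 0) (by
    simpa using h.lift.map_zero_nonneg)
  simpa using this

theorem translationNumber_le_half (h : IsLiftOf f a b c p L) : L.translationNumber ≤ 1 / 2 := by
  have h1 := h.lift.map_map_lt_one le_rfl h.lift.C_pos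
  have := mul_translationNumber_le (L := L) (i := 2) (k := 1) (x := 0) (by
    rw [lift_pow_succ, pow_one]; push_cast; linarith)
  push_cast at this
  linarith

/-- For an irrational rotation number the orbit of â never meets γ, so its turns code s at all times
and outnumber those of q. For a rational one r the coding may break at the return, but s is at most
rhe(r), which is below NBT(q). -/
theorem kneading_lt_NBT (h : IsLiftOf f a b c p L) (hc : HitsTurningPoint f a b c) (hq0 : 0 < q)
    (hq : q < L.translationNumber) : ULt (kneading f b c) (NBT q) := by
  classical
  have H := h.lift
  have hhalf := h.translationNumber_le_half
  have hq2 : q ≤ 1 / 2 := by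
    have : (q : ℝ) ≤ ((1 / 2 : ℚ) : ℝ) := by push_cast; linarith
    exact_mod_cast this
  by_cases hrat : ∃ r : ℚ, L.translationNumber = r
  · obtain ⟨r, hr⟩ := hrat
    have hqr : q < r := by rw [hr] at hq; exact_mod_cast hq
    have hr2 : r ≤ 1 / 2 := by
      have : (r : ℝ) ≤ ((1 / 2 : ℚ) : ℝ) := by push_cast; linarith
      exact_mod_cast this
    have h1 := rotSeq_lt_NBT hq0 hr2 hqr
    rw [← rhe_eq_rotSeq (hq0.trans hqr) hr2] at h1
    rcases h.kneading_le_rhe hc (hq0.trans hqr) hr2 hr with h2 | h2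
    · rwa [h2]
    · exact h2.trans h1
  · have hvalid : ∀ j, (L ^ j) 0 ∉ liftArc (1 - halfScale a b p) := by
      intro j
      rcases Nat.eq_zero_or_pos j with rfl | hj0
      · have := int_not_mem_liftArc H.P_pos 0
        simpa using this
      · rintro ⟨k, h1, h2⟩
        have h3 := H.mul_translationNumber_of_return hj0 h1.le h2.le
        refine hrat ⟨k / j, ?_⟩
        have hj' : (j : ℝ) ≠ 0 := by exact_mod_cast hj0.ne'
        push_cast
        rw [← h3]
        field_simp
    have hle : ∀ i, ceilCount q i ≤ turns L i := by
      intro i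
      rcases Nat.eq_zero_or_pos i with rfl | hi
      · rw [turns_zero, ceilCount_zero]
      · rw [turns, Int.le_floor]
        by_contra! h1
        have h2 : i * L.translationNumber ≤ ceilCount q i :=
          mul_translationNumber_le (x := 0) (by linarith)
        have h3 := ceilCount_lt (q := q) hi
        have hi' : (0 : ℝ) < i := by exact_mod_cast hi
        nlinarith
    have hlt : ceilCount q q.den < turns L q.den := by
      rw [ceilCount_den]
      have : q.num ≤ turns L q.den := by
        rw [turns, Int.le_floor]
        by_contra! h1
        have h2 : q.den * L.translationNumber ≤ q.num :=
          mul_translationNumber_le (x := 0) (by linarith)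
        rw [← cast_mul_den] at h2
        have hd : (0 : ℝ) < q.den := by exact_mod_cast q.den_pos
        nlinarith
      omega
    have hex : ∃ i, ceilCount q i < turns L i := ⟨_, hlt⟩
    have hI : Nat.find hex ≤ q.den := Nat.find_min' hex hlt
    refine ULt.of_counts (x := ceilCount q) (y := turns L) (I := Nat.find hex)
      (by rw [NBT_of_le hq0 hq2 (by omega), rotSeq_zero]) h.kneading_zero rfl
      (ceilCount_one hq0 hq2) turns_zero H.turns_one (ceilCount_monotone hq0) ?_ ?_ ?_
      (Nat.find_spec hex)
    · intro i hi
      rw [NBT_of_le hq0 hq2 (by omega), rotSeq_succ hq0 hq2]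
    · intro i _
      exact h.kneading_succ fun j _ => hvalid j
    · intro i hi
      have := Nat.find_min hex hi
      have := hle i
      omega

/-- The height of the kneading sequence is the rotation number. -/
theorem height_kneading (h : IsLiftOf f a b c p L) (hc : HitsTurningPoint f a b c) :
    height (kneading f b c) = L.translationNumber := by
  have hhalf := h.translationNumber_le_half
  unfold height
  set S : Set ℝ := {r : ℝ | ∃ q : ℚ, 0 < q ∧ q ≤ 1 / 2 ∧
    (q = 1 / 2 ∨ ULt (NBT q) (kneading f b c)) ∧ r = (q : ℝ)} with hS
  have hmem : (1 / 2 : ℝ) ∈ S := ⟨1 / 2, by norm_num, le_rfl, Or.inl rfl, by norm_num⟩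
  have hlow : ∀ r ∈ S, L.translationNumber ≤ r := by
    rintro r ⟨q, hq0, hq2, hq, rfl⟩
    rcases hq with rfl | hq
    · push_cast; exact hhalf
    · by_contra! hlt
      exact ULt.asymm hq (h.kneading_lt_NBT hc hq0 hlt)
  refine le_antisymm ?_ (le_csInf ⟨_, hmem⟩ hlow)
  rcases hhalf.eq_or_lt with he | hlt
  · rw [he]
    exact csInf_le ⟨_, hlow⟩ hmem
  -- Every rational strictly between the rotation number and 1/2 belongs to the set, so the infimum
  -- cannot exceed the rotation number.
  · refine le_of_forall_gt_imp_ge_of_dense fun r hr => ?_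
    obtain ⟨q, hq1, hq2⟩ := exists_rat_btwn (lt_min hr hlt)
    have hq0 : 0 < q := by
      have := h.translationNumber_nonneg.trans_lt hq1
      exact_mod_cast this
    have hq2' : q ≤ 1 / 2 := by
      have : (q : ℝ) ≤ ((1 / 2 : ℚ) : ℝ) := by
        push_cast; exact (hq2.trans_le (min_le_right _ _)).le
      exact_mod_cast this
    have : (q : ℝ) ∈ S := ⟨q, hq0, hq2', Or.inr (h.NBT_lt_kneading hc hq0 hq2' hq1), rfl⟩
    exact (csInf_le ⟨_, hlow⟩ this).trans (hq2.trans_le (min_le_left _ _)).le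

end IsLiftOf

end Kneading

/-! ### The outside map on the circle -/

/-- The point of the circle with lift `t`. -/
noncomputable def circlePt (t : ℝ) : Circle := Circle.exp (Real.pi * (2 * t - 1))

section CircleMap

variable {f : ℝ → ℝ} {a b c p : ℝ} {L : CircleDeg1Lift} {q : ℚ}

theorem circlePt_eq_iff {t t' : ℝ} : circlePt t = circlePt t' ↔ ∃ k : ℤ, t = t' + k := by
  unfold circlePt
  rw [Circle.exp_eq_exp]
  have hpi := Real.pi_ne_zero
  refine exists_congr fun k => ?_
  constructor
  · intro h
    have h1 : Real.pi * (2 * t - 1) = Real.pi * (2 * (t' + k) - 1) := by rw [h]; ring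
    linarith [mul_left_cancel₀ hpi h1]
  · rintro rfl; ring

theorem circlePt_add_int (t : ℝ) (k : ℤ) : circlePt (t + k) = circlePt t :=
  circlePt_eq_iff.2 ⟨k, rfl⟩

theorem circlePt_sub_int (t : ℝ) (k : ℤ) : circlePt (t - k) = circlePt t :=
  circlePt_eq_iff.2 ⟨-k, by push_cast; ring⟩

theorem circlePt_surjective : Function.Surjective circlePt := by
  intro z
  refine ⟨(Complex.arg z / Real.pi + 1) / 2, ?_⟩
  unfold circlePt
  rw [← Circle.exp_arg z]
  congr 1
  have := Real.pi_ne_zero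
  rw [Circle.exp_arg z]
  field_simp
  ring

theorem upper_eq_circlePt (hab : a < b) (x : ℝ) : upper a b x = circlePt (1 - halfScale a b x) := by
  unfold upper circlePt halfScale
  congr 1
  have : b - a ≠ 0 := (sub_pos.2 hab).ne'
  field_simp
  ring

theorem lower_eq_circlePt (hab : a < b) (x : ℝ) : lower a b x = circlePt (halfScale a b x) := by
  unfold lower circlePt halfScale
  congr 1
  have : b - a ≠ 0 := (sub_pos.2 hab).ne'
  field_simp
  ring

theorem hatA_eq_circlePt (hab : a < b) : hatA a b = circlePt 0 := by
  rw [hatA, upper_eq_circlePt hab, halfScale_left]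
  exact circlePt_eq_iff.2 ⟨1, by norm_num⟩

theorem hatB_eq_circlePt (hab : a < b) : hatB a b = circlePt (1 / 2) := by
  rw [hatB, upper_eq_circlePt hab, halfScale_right hab]; norm_num

theorem upper_injOn (hab : a < b) : InjOn (upper a b) (Icc a b) := by
  intro x hx y hy he
  rw [upper_eq_circlePt hab, upper_eq_circlePt hab, circlePt_eq_iff] at he
  obtain ⟨k, hk⟩ := he
  have h1 := halfScale_mem hab hx
  have h2 := halfScale_mem hab hy
  have h3 : (-1 : ℝ) < k := by linarith [h1.2, h2.1]
  have h4 : (k : ℝ) < 1 := by linarith [h1.1, h2.2]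
  have h5 : -1 < k := by exact_mod_cast h3
  have h6 : k < 1 := by exact_mod_cast h4
  obtain rfl : k = 0 := by omega
  exact (halfScale_strictMono hab).injective (by push_cast at hk; linarith)

theorem arg_circlePt {r : ℝ} (h0 : 0 < r) (h1 : r < 1) :
    Complex.arg (circlePt r) = Real.pi * (2 * r - 1) := by
  unfold circlePt
  have := Real.pi_pos
  exact Circle.arg_exp (by nlinarith) (by nlinarith)

theorem coordinate_circlePt {r : ℝ} (h0 : 0 < r) (h1 : r < 1) :
    coordinate a b (circlePt r) = liftCoord a b r := by
  unfold coordinate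
  rw [arg_circlePt h0 h1, abs_mul, abs_of_pos Real.pi_pos, mul_div_cancel_left₀ _ Real.pi_ne_zero]
  rcases le_total r (1 / 2) with h | h
  · rw [liftCoord_of_le_half h0.le h, abs_of_nonpos (by linarith)]; ring
  · rw [liftCoord_of_half_le h h1.le, abs_of_nonneg (by linarith)]; ring

namespace IsLiftOf

theorem theta_circlePt_of_unit (h : IsLiftOf f a b c p L) {r : ℝ} (h0 : 0 ≤ r) (h1 : r < 1) :
    (r ≤ 1 - halfScale a b p → theta f a b c p (circlePt r) = Sum.inl (circlePt (L r))) ∧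
    (1 - halfScale a b p < r → ∃ x, theta f a b c p (circlePt r) = Sum.inr x) := by
  have hab := h.unimodal.lt
  have hsm := halfScale_strictMono hab
  have H := h.lift
  have hC0 := H.C_pos
  have hC2 := H.C_lt
  have hP := H.half_le
  unfold theta
  simp only
  rcases h0.eq_or_lt with rfl | h0
  · rw [if_pos (hatA_eq_circlePt hab).symm]
    refine ⟨fun _ => ?_, fun h2 => by linarith⟩
    rw [lower_eq_circlePt hab, h.eq_left 0 ⟨le_rfl, hC0.le⟩, halfMap, mul_zero, add_zero]
  have hnA : circlePt r ≠ hatA a b := by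
    rw [hatA_eq_circlePt hab]
    intro he
    obtain ⟨k, hk⟩ := circlePt_eq_iff.1 he
    rw [zero_add] at hk
    have h2 : 0 < k := by rw [hk] at h0; exact_mod_cast h0
    have h3 : k < 1 := by rw [hk] at h1; exact_mod_cast h1
    omega
  rw [if_neg hnA]
  by_cases hr : r = 1 / 2
  · subst hr
    rw [if_pos (hatB_eq_circlePt hab).symm]
    refine ⟨fun _ => ?_, fun h2 => by linarith⟩
    rw [H.map_half, hatA_eq_circlePt hab]
    congr 1
    exact circlePt_eq_iff.2 ⟨-1, by norm_num⟩
  have hnB : circlePt r ≠ hatB a b := by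
    rw [hatB_eq_circlePt hab]
    intro he
    obtain ⟨k, hk⟩ := circlePt_eq_iff.1 he
    have h2 : (-1 : ℝ) < k := by linarith
    have h3 : (k : ℝ) < 1 := by linarith
    have h4 : -1 < k := by exact_mod_cast h2
    have h5 : k < 1 := by exact_mod_cast h3
    obtain rfl : k = 0 := by omega
    push_cast at hk
    exact hr (by linarith)
  rw [if_neg hnB, coordinate_circlePt h0 h1, arg_circlePt h0 h1]
  have hpi := Real.pi_pos
  rcases lt_or_gt_of_ne hr with hr | hr
  · have hneg : ¬ 0 < Real.pi * (2 * r - 1) := by nlinarith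
    have hcoord : liftCoord a b r = a + 2 * (b - a) * r := liftCoord_of_le_half h0.le hr.le
    have hcmp : halfScale a b (liftCoord a b r) = r := by rw [hcoord, halfScale_add_mul hab]
    rw [if_neg hneg]
    refine ⟨fun _ => ?_, fun h2 => by linarith⟩
    split_ifs with h3 h4
    · have h5 : r < halfScale a b c := by rw [← hcmp]; exact hsm h3
      rw [lower_eq_circlePt hab, h.eq_left r ⟨h0.le, h5.le⟩, halfMap, hcoord]
    · have h5 : r = halfScale a b c := by rw [← h4, hcmp]
      rw [h5, H.map_C, hatB_eq_circlePt hab]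
    · have h5 : halfScale a b c ≤ r := by rw [← hcmp]; exact hsm.monotone (not_lt.1 h3)
      rw [upper_eq_circlePt hab, h.eq_middle r ⟨h5, hr.le⟩, halfMap, hcoord]
  · have hpos : 0 < Real.pi * (2 * r - 1) := by apply mul_pos hpi; linarith
    have hcoord : liftCoord a b r = a + 2 * (b - a) * (1 - r) := liftCoord_of_half_le hr.le h1.le
    have hcmp : halfScale a b (liftCoord a b r) = 1 - r := by rw [hcoord, halfScale_add_mul hab]
    rw [if_pos hpos]
    constructor
    · intro h2
      have h3 : ¬ liftCoord a b r < p := fun h3 => by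
        have := hsm h3
        rw [hcmp] at this
        linarith
      rw [if_neg h3, lower_eq_circlePt hab, h.eq_right r ⟨hr.le, h2⟩, halfMap, hcoord]
      congr 1
      exact circlePt_eq_iff.2 ⟨-1, by push_cast; ring⟩
    · intro h2
      have h3 : liftCoord a b r < p := by
        rw [← hsm.lt_iff_lt, hcmp]; linarith
      exact ⟨_, if_pos h3⟩

theorem theta_circlePt (h : IsLiftOf f a b c p L) {t : ℝ}
    (ht : t ∉ liftArc (1 - halfScale a b p)) :
    theta f a b c p (circlePt t) = Sum.inl (circlePt (L t)) := by
  have h1 := (h.theta_circlePt_of_unit (Int.fract_nonneg t) (Int.fract_lt_one t)).1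
    (fract_le_of_not_mem_liftArc ht)
  have h2 : t = Int.fract t + ⌊t⌋ := (Int.fract_add_floor t).symm
  rw [h2, circlePt_add_int, L.map_add_int, circlePt_add_int]
  exact h1

theorem theta_circlePt_of_mem (h : IsLiftOf f a b c p L) {t : ℝ}
    (ht : t ∈ liftArc (1 - halfScale a b p)) :
    ∃ x, theta f a b c p (circlePt t) = Sum.inr x := by
  have h2 : t = Int.fract t + ⌊t⌋ := (Int.fract_add_floor t).symm
  rw [h2, circlePt_add_int]
  refine (h.theta_circlePt_of_unit (Int.fract_nonneg t) (Int.fract_lt_one t)).2 ?_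
  obtain ⟨k, h3, h4⟩ := ht
  have h5 : ⌊t⌋ = k - 1 := by
    rw [Int.floor_eq_iff]
    have := h.lift.P_pos
    push_cast
    constructor <;> linarith
  rw [Int.fract, h5]
  push_cast
  linarith

/-! ### Orbits of the outside map as projections of lifted orbits. -/

theorem thetaIter_succ (k : ℕ) (z : Circle) : thetaIter f a b c p (k + 1) z =
    Sum.elim (theta f a b c p) (fun x => Sum.inr (f x)) (thetaIter f a b c p k z) := by
  unfold thetaIter
  rw [Function.iterate_succ_apply']

theorem thetaIter_circlePt (h : IsLiftOf f a b c p L) {t : ℝ} (k : ℕ)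
    (ht : ∀ j < k, (L ^ j) t ∉ liftArc (1 - halfScale a b p)) :
    thetaIter f a b c p k (circlePt t) = Sum.inl (circlePt ((L ^ k) t)) := by
  induction k with
  | zero => simp [thetaIter]
  | succ k ih =>
    rw [thetaIter_succ, ih fun j hj => ht j (by omega), Sum.elim_inl,
      h.theta_circlePt (ht k k.lt_succ_self), lift_pow_succ]

/-- A point that has fallen into the interval never comes back, so being on the circle at time k
rules out γ at all earlier times. -/
theorem avoids_of_thetaIter (h : IsLiftOf f a b c p L) {t : ℝ} (k : ℕ) {w : Circle}
    (hw : thetaIter f a b c p k (circlePt t) = Sum.inl w) :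
    ∀ j < k, (L ^ j) t ∉ liftArc (1 - halfScale a b p) := by
  induction k generalizing w with
  | zero => intro j hj; omega
  | succ k ih =>
    rw [thetaIter_succ] at hw
    cases hk : thetaIter f a b c p k (circlePt t) with
    | inr x => rw [hk] at hw; simp at hw
    | inl w' =>
      have ih' := ih hk
      intro j hj
      rcases (Nat.lt_succ_iff.1 hj).eq_or_lt with rfl | hj
      · intro hmem
        rw [h.thetaIter_circlePt _ ih', Sum.elim_inl] at hw
        obtain ⟨x, hx⟩ := h.theta_circlePt_of_mem hmem
        rw [hx] at hw
        simp at hw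
      · exact ih' j hj

theorem circlePt_mem_staySet (h : IsLiftOf f a b c p L) {t : ℝ} :
    circlePt t ∈ staySet f a b c p ↔ t ∈ liftStay L (1 - halfScale a b p) := by
  constructor
  · intro ht i
    obtain ⟨w, hw⟩ := ht (i + 1)
    exact h.avoids_of_thetaIter _ hw i i.lt_succ_self
  · intro ht k
    exact ⟨_, h.thetaIter_circlePt k fun j _ => ht j⟩

theorem mem_liftArc_of_gammaArc (h : IsLiftOf f a b c p L) {t : ℝ}
    (ht : circlePt t ∈ gammaArc a b p) : t ∈ liftArc (1 - halfScale a b p) := by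
  have hab := h.unimodal.lt
  obtain ⟨x, hx, he⟩ := ht
  rw [upper_eq_circlePt hab] at he
  obtain ⟨k, hk⟩ := circlePt_eq_iff.1 he.symm
  have h1 := halfScale_strictMono hab hx.1
  have h2 := halfScale_strictMono hab hx.2
  rw [halfScale_left] at h1
  exact ⟨k + 1, by push_cast; linarith, by push_cast; linarith⟩

theorem circlePt_return (h : IsLiftOf f a b c p L) (hc : HitsTurningPoint f a b c)
    (hq : L.translationNumber = q) : circlePt ((L ^ q.den) 0) = upper a b (f^[q.den] a) := by
  have hab := h.unimodal.lt
  rw [upper_eq_circlePt hab, h.iterate_den_eq hc hq, halfScale_add_mul hab]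
  exact circlePt_eq_iff.2 ⟨q.num - 1, by push_cast; ring⟩

/-- The periodic orbit of the outside map. -/
theorem exists_periodicOrbit (h : IsLiftOf f a b c p L) (hc : HitsTurningPoint f a b c)
    (hq : L.translationNumber = q) :
    ∃ A : Set Circle, A ⊆ staySet f a b c p ∧ IsPeriodicOrbit f a b c p q.den A ∧
      (∀ (k : ℕ) (Q : Set Circle), Q ⊆ staySet f a b c p → IsPeriodicOrbit f a b c p k Q → Q = A) ∧
      PermutedAsRotation f a b c p q.num q.den A ∧
      ∀ t ∈ liftPer L q ∩ liftStay L (1 - halfScale a b p), circlePt t ∈ A := by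
  obtain ⟨y, hy, hall⟩ := exists_unique_orbit h.lift (h.meetsArc hc) hq
  obtain ⟨o, ho, hoval, hoex⟩ := exists_orbit_enumeration hq hy.1
  have hiter : ∀ k : ℕ, thetaIter f a b c p k (circlePt y) = Sum.inl (circlePt ((L ^ k) y)) :=
    fun k => h.thetaIter_circlePt k fun j _ => hy.2 j
  have hmem : ∀ w : Circle, w ∈ range (fun j => circlePt (o j)) ↔
      ∃ k : ℕ, w = circlePt ((L ^ k) y) := by
    intro w
    constructor
    · rintro ⟨j, rfl⟩
      obtain ⟨i, k, rfl⟩ := hoex j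
      exact ⟨i, by simp only [hoval, circlePt_sub_int]⟩
    · rintro ⟨k, rfl⟩
      have := hoval k 0
      exact ⟨k * q.num - 0 * q.den, by simp only [this, circlePt_sub_int]⟩
  refine ⟨range fun j => circlePt (o j), ?_, ?_, ?_, ?_, ?_⟩
  · intro w hw
    obtain ⟨k, rfl⟩ := (hmem w).1 hw
    exact h.circlePt_mem_staySet.2 (liftStay_pow hy.2 k)
  · refine ⟨circlePt y, q.den_pos, ?_, ?_, ?_⟩
    · rw [hiter, show (L ^ q.den) y = y + q.num from hy.1, circlePt_add_int]
    · intro k hk hkn he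
      rw [hiter] at he
      obtain ⟨j, hj⟩ := circlePt_eq_iff.1 (Sum.inl_injective he)
      have h1 : k * L.translationNumber = j := by
        rw [← CircleDeg1Lift.translationNumber_pow]
        exact CircleDeg1Lift.translationNumber_of_eq_add_int _ hj
      rw [hq] at h1
      obtain ⟨r, hr, -⟩ := exists_of_mul_eq h1
      rcases Nat.eq_zero_or_pos r with rfl | hr0
      · omega
      · have := Nat.le_mul_of_pos_right q.den hr0
        omega
    · intro w
      rw [hmem]
      refine exists_congr fun k => ?_
      rw [hiter, Sum.inl.injEq, eq_comm]
  · rintro k Q hQ ⟨z, hk, hz, -, hQmem⟩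
    obtain ⟨t, rfl⟩ := circlePt_surjective z
    have hzQ : circlePt t ∈ Q := (hQmem _).2 ⟨0, by simp [thetaIter]⟩
    have ht := h.circlePt_mem_staySet.1 (hQ hzQ)
    have hiter' : ∀ k : ℕ, thetaIter f a b c p k (circlePt t) =
        Sum.inl (circlePt ((L ^ k) t)) := fun k => h.thetaIter_circlePt k fun j _ => ht j
    rw [hiter'] at hz
    obtain ⟨j, hj⟩ := circlePt_eq_iff.1 (Sum.inl_injective hz)
    have h1 : k * L.translationNumber = j := by
      rw [← CircleDeg1Lift.translationNumber_pow]
      exact CircleDeg1Lift.translationNumber_of_eq_add_int _ hj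
    rw [hq] at h1
    obtain ⟨r, rfl, rfl⟩ := exists_of_mul_eq h1
    have hr0 : 0 < r := Nat.pos_of_mul_pos_left hk
    -- The period of Q is a multiple rn. For a monotone degree one map, displacement rm after r
    -- applications of L^n forces displacement m after one.
    have hper : t ∈ liftPer L q := by
      push_cast at hj
      exact (pow_mul_eq_iff hr0).1 hj
    obtain ⟨i, k', hik⟩ := hall t ⟨hper, ht⟩
    ext w
    rw [hQmem, hmem]
    constructor
    · rintro ⟨k, hk⟩
      rw [hiter', Sum.inl.injEq] at hk
      refine ⟨k + i, ?_⟩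
      rw [← hk, hik, CircleDeg1Lift.map_sub_int, circlePt_sub_int, lift_pow_add]
    · rintro ⟨k, rfl⟩
      obtain ⟨d, hd⟩ : ∃ d, k + q.den * i = d + i := ⟨k + q.den * i - i, by
        have := Nat.le_mul_of_pos_left i q.den_pos; omega⟩
      refine ⟨d, ?_⟩
      rw [hiter', hik, CircleDeg1Lift.map_sub_int, circlePt_sub_int, ← lift_pow_add, ← hd,
        lift_pow_add, liftPer_pow_mul hy.1]
      have h2 := (L ^ k).map_add_int y (i * q.num)
      push_cast at h2
      rw [h2]
      have h3 := circlePt_add_int ((L ^ k) y) (i * q.num)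
      push_cast at h3
      rw [h3]
  · refine ⟨fun j => Real.pi * (2 * o j - 1), ?_, ?_, rfl, ?_⟩
    · intro j j' hj
      have := ho hj
      have hpi := Real.pi_pos
      simp only
      gcongr
    · intro j
      obtain ⟨i, k, rfl⟩ := hoex j
      have h1 := hoval i (k - 1)
      rw [show (i : ℤ) * q.num - (k - 1) * q.den = i * q.num - k * q.den + q.den by ring] at h1
      simp only [h1, hoval]
      push_cast
      ring
    · intro j
      obtain ⟨i, k, rfl⟩ := hoex j
      have h1 := hoval (i + 1) k
      rw [show ((i + 1 : ℕ) : ℤ) * q.num - k * q.den = i * q.num - k * q.den + q.num by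
        push_cast; ring] at h1
      have h2 : o (i * q.num - k * q.den) ∉ liftArc (1 - halfScale a b p) := by
        rw [hoval]
        exact liftStay_sub_int (liftStay_pow hy.2 i) k 0
      have h3 := h.theta_circlePt h2
      have h4 : L (o (i * q.num - k * q.den)) = o (i * q.num - k * q.den + q.num) := by
        rw [hoval, h1, L.map_sub_int, lift_pow_succ]
      rw [h4] at h3
      exact h3
  · intro t ht
    obtain ⟨i, k, rfl⟩ := hall t ht
    rw [hmem]
    exact ⟨i, circlePt_sub_int _ _⟩

/-- The orbits that end in `p_u`, when `â` is periodic. -/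
theorem stay_of_eventually_p (h : IsLiftOf f a b c p L)
    (hr : (L ^ q.den) 0 = q.num) {z : Circle} {i : ℕ}
    (hz : thetaIter f a b c p i z = Sum.inl (upper a b p)) : z ∈ staySet f a b c p := by
  have hP1 := h.lift.P_lt
  have hP0 := h.lift.P_pos
  obtain ⟨t, rfl⟩ := circlePt_surjective z
  have hav := h.avoids_of_thetaIter i hz
  rw [h.thetaIter_circlePt i hav, upper_eq_circlePt h.unimodal.lt, Sum.inl.injEq] at hz
  obtain ⟨k, hk⟩ := circlePt_eq_iff.1 hz
  rw [h.circlePt_mem_staySet]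
  intro j
  rcases lt_or_ge j i with hj | hj
  · exact hav j hj
  obtain ⟨r, rfl⟩ := Nat.exists_eq_add_of_le' hj
  rw [lift_pow_add, hk, CircleDeg1Lift.map_add_int, liftArc_add_int]
  have h0 : (0 : ℝ) ∈ liftPer L q := by
    change (L ^ q.den) 0 = 0 + q.num
    rw [hr, zero_add]
  rcases Nat.eq_zero_or_pos r with rfl | hr0
  · rintro ⟨m, h1, h2⟩
    simp only [pow_zero, CircleDeg1Lift.coe_one, id] at h1 h2
    have h3 : (0 : ℝ) < m := by linarith
    have h4 : (m : ℝ) < 1 := by linarith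
    have h5 : 0 < m := by exact_mod_cast h3
    have h6 : m < 1 := by exact_mod_cast h4
    omega
  -- One step after p_u the orbit coincides with that of â, which is periodic and avoids γ.
  · rw [h.lift.pow_eq_of_flat (k := 1) (by push_cast; linarith) (by push_cast; linarith) hr0,
      liftArc_add_int]
    exact liftPer_subset_liftStay h.lift (Or.inl hr) h0 r

/-- The orbits that end in `â`, when `p_u` is periodic. -/
theorem stay_of_eventually_hatA (h : IsLiftOf f a b c p L)
    (hr : (L ^ q.den) 0 = q.num + (1 - halfScale a b p) - 1) {z : Circle} {i : ℕ}
    (hz : thetaIter f a b c p i z = Sum.inl (hatA a b)) : z ∈ staySet f a b c p := by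
  have hP1 := h.lift.P_lt
  have hP0 := h.lift.P_pos
  obtain ⟨t, rfl⟩ := circlePt_surjective z
  have hav := h.avoids_of_thetaIter i hz
  rw [h.thetaIter_circlePt i hav, hatA_eq_circlePt h.unimodal.lt, Sum.inl.injEq] at hz
  obtain ⟨k, hk⟩ := circlePt_eq_iff.1 hz
  rw [h.circlePt_mem_staySet]
  intro j
  rcases lt_or_ge j i with hj | hj
  · exact hav j hj
  obtain ⟨r, rfl⟩ := Nat.exists_eq_add_of_le' hj
  rw [lift_pow_add, hk, CircleDeg1Lift.map_add_int, liftArc_add_int]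
  set P := 1 - halfScale a b p
  have hPper : P - 1 ∈ liftPer L q := by
    change (L ^ q.den) (P - 1) = P - 1 + q.num
    rw [h.lift.pow_eq_zero_of_flat le_rfl (by linarith) q.den_pos, hr]; ring
  rcases Nat.eq_zero_or_pos r with rfl | hr0
  · have := int_not_mem_liftArc hP0 0
    simpa using this
  · rw [← h.lift.pow_eq_zero_of_flat (t := P - 1) le_rfl (by linarith) hr0]
    exact liftPer_subset_liftStay h.lift (Or.inr hr) hPper r

end IsLiftOf

end CircleMap

/-! ### The first return and the points that stay in the circle -/

section Conclusion

variable {f : ℝ → ℝ} {a b c p : ℝ} {L : CircleDeg1Lift} {q : ℚ}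

namespace IsLiftOf

/-- The position of the first return of `â` to the closure of `γ` and the kneading sequence
determine each other. -/
theorem return_cases (h : IsLiftOf f a b c p L) (hc : HitsTurningPoint f a b c) (hq0 : 0 < q)
    (hq2 : q ≤ 1 / 2) (hq : L.translationNumber = q) :
    (f^[q.den] a = a ∧ kneading f b c = lhe q) ∨
    (f^[q.den] a ∈ Ioo a c ∧ ULt (lhe q) (kneading f b c) ∧ ULt (kneading f b c) (NBT q)) ∨
    (f^[q.den] a = c ∧ kneading f b c = NBT q) ∨
    (f^[q.den] a ∈ Ioo c p ∧ ULt (NBT q) (kneading f b c) ∧ ULt (kneading f b c) (rhe q)) ∨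
    (f^[q.den] a = p ∧ kneading f b c = rhe q) := by
  have hza : a ≤ f^[q.den] a := (h.unimodal.iterate_mem (left_mem_Icc.2 h.unimodal.lt.le) _).1
  have hzp := h.iterate_den_le hc hq
  rcases hza.eq_or_lt with hz | hz
  · exact Or.inl ⟨hz.symm,
      h.kneading_eq_lhe hc hq0 hq2 hq ((h.iterate_den_eq_left_iff hc hq).1 hz.symm)⟩
  have hr : (L ^ q.den) 0 ≠ q.num := fun hr =>
    hz.ne' ((h.iterate_den_eq_left_iff hc hq).2 hr)
  rcases lt_trichotomy (f^[q.den] a) c with hzc | hzc | hzc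
  · exact Or.inr (Or.inl ⟨⟨hz, hzc⟩, h.lhe_lt_kneading hc hq0 hq2 hq hr,
      h.kneading_lt_of_lt hc hq0 hq2 hq hr hzc⟩)
  · exact Or.inr (Or.inr (Or.inl ⟨hzc, h.kneading_eq_NBT hc hq0 hq2 hq hr hzc⟩))
  rcases hzp.eq_or_lt with hz' | hz'
  · exact Or.inr (Or.inr (Or.inr (Or.inr ⟨hz', h.kneading_eq_rhe hc hq0 hq2 hq hr hz'⟩)))
  · exact Or.inr (Or.inr (Or.inr (Or.inl ⟨⟨hzc, hz'⟩, h.NBT_lt_kneading_of_gt hc hq0 hq2 hq hr hzc,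
      h.kneading_lt_rhe_of_ge hc hq0 hq2 hq hr hzc.le hz'⟩)))

/-- The five positions exclude each other, and so do the five symbolic conditions because lhe ≺ NBT
≺ rhe; hence the one-way implications of `return_cases` reverse. -/
theorem return_iff (h : IsLiftOf f a b c p L) (hc : HitsTurningPoint f a b c) (hq0 : 0 < q)
    (hq2 : q ≤ 1 / 2) (hq : L.translationNumber = q) :
    (f^[q.den] a = a ↔ kneading f b c = lhe q) ∧
    (f^[q.den] a = c ↔ kneading f b c = NBT q) ∧
    (f^[q.den] a = p ↔ kneading f b c = rhe q) ∧
    (f^[q.den] a ∈ Ioo a c ↔ ULt (lhe q) (kneading f b c) ∧ ULt (kneading f b c) (NBT q)) ∧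
    (f^[q.den] a ∈ Ioo c p ↔ ULt (NBT q) (kneading f b c) ∧ ULt (kneading f b c) (rhe q)) := by
  have hac := h.unimodal.lt_left
  have hcp := h.lt_p
  have h12 := lhe_lt_NBT hq0 hq2
  have h23 := NBT_lt_rhe hq0 hq2
  have h13 := lhe_lt_rhe hq0 hq2
  rcases h.return_cases hc hq0 hq2 hq with ⟨hz, hs⟩ | ⟨hz, hs, hs'⟩ | ⟨hz, hs⟩ | ⟨hz, hs, hs'⟩ |
    ⟨hz, hs⟩
  · rw [hz, hs]
    simp [hac.ne, (hac.trans hcp).ne, h12.ne, h13.ne, ULt.irrefl, h12.asymm, hac.not_gt]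
  · simp [hz, hs, hs', hs.ne.symm, hz.1.ne', hz.2.ne, hs'.ne, (hz.2.trans hcp).ne, (hs'.trans h23).ne,
      hs'.asymm, hz.2.not_gt]
  · rw [hz, hs]
    simp [hac.ne', hcp.ne, h12.ne.symm, h23.ne, ULt.irrefl]
  · simp [hz, hs, hs', hs.ne.symm, hz.1.ne', hz.2.ne, hs'.ne, (hac.trans hz.1).ne', (h12.trans hs).ne.symm,
      hs.asymm, hz.1.not_gt]
  · rw [hz, hs]
    simp [(hac.trans hcp).ne', hcp.ne', h13.ne.symm, h23.ne.symm, ULt.irrefl, h23.asymm, hcp.not_gt]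

theorem staySet_eq (h : IsLiftOf f a b c p L) (hc : HitsTurningPoint f a b c) (hq0 : 0 < q)
    (hq2 : q ≤ 1 / 2) (hq : L.translationNumber = q) {A : Set Circle}
    (hA : A ⊆ staySet f a b c p)
    (hper : ∀ t ∈ liftPer L q ∩ liftStay L (1 - halfScale a b p), circlePt t ∈ A) :
    (ULt (lhe q) (kneading f b c) → ULt (kneading f b c) (rhe q) → staySet f a b c p = A) ∧
    (kneading f b c = lhe q → staySet f a b c p =
      A ∪ {z | ∃ i : ℕ, thetaIter f a b c p i z = Sum.inl (upper a b p)}) ∧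
    (kneading f b c = rhe q → staySet f a b c p =
      A ∪ {z | ∃ i : ℕ, thetaIter f a b c p i z = Sum.inl (hatA a b)}) := by
  obtain ⟨hl, -, hr, -, -⟩ := h.return_iff hc hq0 hq2 hq
  rw [h.iterate_den_eq_left_iff hc hq] at hl
  rw [h.iterate_den_eq_p_iff hc hq] at hr
  have h13 := lhe_lt_rhe hq0 hq2
  -- Each kind of non-periodic point in Λ fixes the return of â to one end of γ, and thereby fixes
  -- s.
  have hmem : ∀ z ∈ staySet f a b c p, z ∈ A ∨
      (kneading f b c = lhe q ∧ ∃ i : ℕ, thetaIter f a b c p i z = Sum.inl (upper a b p)) ∨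
      (kneading f b c = rhe q ∧ ∃ i : ℕ, thetaIter f a b c p i z = Sum.inl (hatA a b)) := by
    intro z hz
    obtain ⟨t, rfl⟩ := circlePt_surjective z
    rw [h.circlePt_mem_staySet] at hz
    by_cases ht : t ∈ liftPer L q
    · exact Or.inl (hper t ⟨ht, hz⟩)
    right
    rcases eventually_endpoint h.lift (h.meetsArc hc) hq hz ht with ⟨h1, i, k, hik⟩ | ⟨h1, i, k, hik⟩
    · refine Or.inl ⟨hl.1 h1, i, ?_⟩
      rw [h.thetaIter_circlePt i fun j _ => hz j, hik, upper_eq_circlePt h.unimodal.lt,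
        circlePt_add_int]
      exact congrArg Sum.inl (circlePt_eq_iff.2 ⟨-1, by push_cast; ring⟩)
    · refine Or.inr ⟨hr.1 h1, i, ?_⟩
      rw [h.thetaIter_circlePt i fun j _ => hz j, hik, hatA_eq_circlePt h.unimodal.lt]
      exact congrArg Sum.inl (circlePt_eq_iff.2 ⟨k, by ring⟩)
  refine ⟨fun h1 h2 => ?_, fun h1 => ?_, fun h1 => ?_⟩
  · refine Subset.antisymm (fun z hz => ?_) hA
    rcases hmem z hz with h3 | ⟨h3, -⟩ | ⟨h3, -⟩
    · exact h3
    · exact absurd h3 h1.ne.symm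
    · exact absurd h3 h2.ne
  · refine Subset.antisymm (fun z hz => ?_) (union_subset hA ?_)
    · rcases hmem z hz with h3 | ⟨-, h3⟩ | ⟨h3, -⟩
      · exact Or.inl h3
      · exact Or.inr h3
      · exact absurd (h1.symm.trans h3) h13.ne
    · rintro z ⟨i, hi⟩
      exact h.stay_of_eventually_p (hl.2 h1) hi
  · refine Subset.antisymm (fun z hz => ?_) (union_subset hA ?_)
    · rcases hmem z hz with h3 | ⟨h3, -⟩ | ⟨-, h3⟩
      · exact Or.inl h3
      · exact absurd (h3.symm.trans h1) h13.ne
      · exact Or.inr h3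
    · rintro z ⟨i, hi⟩
      exact h.stay_of_eventually_hatA (hr.2 h1) hi

end IsLiftOf

theorem upper_mem_closure_gammaArc (hap : a < p) {x : ℝ} (hx : x ∈ Icc a p) :
    upper a b x ∈ closure (gammaArc a b p) := by
  have hcont : Continuous (upper a b) := by unfold upper; fun_prop
  rw [← closure_Ioo hap.ne] at hx
  exact image_closure_subset_closure_image hcont (mem_image_of_mem _ hx)

end Conclusion

end OutsideDynamics

theorem mainTheorem5
    (T : OutsideDynamics.ThickInterval) (F : ℂ ≃ₜ ℂ)
    (hF : OutsideDynamics.IsThickIntervalMap T F) (hMIA : OutsideDynamics.IsMIA T F)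
    (f : ℝ → ℝ) (a b c p : ℝ)
    (hquot : OutsideDynamics.IsQuotient T F f a b)
    (hf : OutsideDynamics.IsUnimodal f a b c)
    (hcp : c < p) (hpb : p ≤ b) (hp : f p = f a)
    (s : OutsideDynamics.Seq) (hs : s = OutsideDynamics.kneading f b c)
    (q : ℚ) (hq : 0 < q) (hheight : OutsideDynamics.height s = (q : ℝ)) :
    (∀ i < q.den, ∃ z : Circle,
      OutsideDynamics.thetaIter f a b c p i (OutsideDynamics.hatA a b) = Sum.inl z ∧
        z ∉ OutsideDynamics.gammaArc a b p) ∧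
    (∃ v : Circle,
      OutsideDynamics.thetaIter f a b c p q.den (OutsideDynamics.hatA a b) = Sum.inl v ∧
      v ∈ closure (OutsideDynamics.gammaArc a b p) ∧
      (v = OutsideDynamics.hatA a b ↔ s = OutsideDynamics.lhe q) ∧
      (v = OutsideDynamics.upper a b c ↔ s = OutsideDynamics.NBT q) ∧
      (v = OutsideDynamics.upper a b p ↔ s = OutsideDynamics.rhe q) ∧
      (v ∈ OutsideDynamics.upper a b '' Set.Ioo a c ↔
        OutsideDynamics.ULt (OutsideDynamics.lhe q) s ∧
          OutsideDynamics.ULt s (OutsideDynamics.NBT q)) ∧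
      (v ∈ OutsideDynamics.upper a b '' Set.Ioo c p ↔
        OutsideDynamics.ULt (OutsideDynamics.NBT q) s ∧
          OutsideDynamics.ULt s (OutsideDynamics.rhe q))) ∧
    (∃ P : Set Circle,
      P ⊆ OutsideDynamics.staySet f a b c p ∧
      OutsideDynamics.IsPeriodicOrbit f a b c p q.den P ∧
      (∀ (k : ℕ) (Q : Set Circle), Q ⊆ OutsideDynamics.staySet f a b c p →
        OutsideDynamics.IsPeriodicOrbit f a b c p k Q → Q = P) ∧
      OutsideDynamics.PermutedAsRotation f a b c p q.num q.den P ∧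
      (OutsideDynamics.ULt (OutsideDynamics.lhe q) s →
        OutsideDynamics.ULt s (OutsideDynamics.rhe q) →
        OutsideDynamics.staySet f a b c p = P) ∧
      (s = OutsideDynamics.lhe q →
        OutsideDynamics.staySet f a b c p =
          P ∪ {z | ∃ i : ℕ, OutsideDynamics.thetaIter f a b c p i z =
            Sum.inl (OutsideDynamics.upper a b p)}) ∧
      (s = OutsideDynamics.rhe q →
        OutsideDynamics.staySet f a b c p =
          P ∪ {z | ∃ i : ℕ, OutsideDynamics.thetaIter f a b c p i z =
            Sum.inl (OutsideDynamics.hatA a b)})) := by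

  open OutsideDynamics in
  subst hs
  obtain ⟨A, hAf, hAm, hAd⟩ := hquot.exists_finite_invariant hF hMIA
  have hc : HitsTurningPoint f a b c := hf.hitsTurningPoint hAf hAm hAd
  obtain ⟨L, h1, h2, h3, h4⟩ := exists_outsideLift hf hcp hpb hp
  have h : IsLiftOf f a b c p L := ⟨h1, h2, h3, h4, hf, hcp, hpb, hp⟩
  have hqL : L.translationNumber = q := by rw [← h.height_kneading hc, hheight]
  -- The bound on q is inherited from the rotation number.
  have hq2 : q ≤ 1 / 2 := by
    have := h.translationNumber_le_half
    rw [hqL] at this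
    have h5 : (q : ℝ) ≤ ((1 / 2 : ℚ) : ℝ) := by push_cast; exact this
    exact_mod_cast h5
  have hab := hf.lt
  have hz : f^[q.den] a ∈ Icc a b := hf.iterate_mem (left_mem_Icc.2 hab.le) _
  have hzp := h.iterate_den_le hc hqL
  have hcb : c ∈ Icc a b := ⟨hf.lt_left.le, hf.lt_right.le⟩
  have hpab : p ∈ Icc a b := ⟨(hf.lt_left.trans hcp).le, hpb⟩
  have hav : ∀ i < q.den, (L ^ i) 0 ∉ liftArc (1 - halfScale a b p) := fun i hi =>
    h.pow_not_mem_liftArc hqL hi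
  have hiter : ∀ i ≤ q.den,
      thetaIter f a b c p i (hatA a b) = Sum.inl (circlePt ((L ^ i) 0)) := fun i hi => by
    rw [hatA_eq_circlePt hab, h.thetaIter_circlePt i fun j hj => hav j (hj.trans_le hi)]
  have hinj := upper_injOn hab
  obtain ⟨r1, r2, r3, r4, r5⟩ := h.return_iff hc hq hq2 hqL
  refine ⟨fun i hi => ⟨_, hiter i hi.le, fun hg => hav i hi (h.mem_liftArc_of_gammaArc hg)⟩,
    ⟨upper a b (f^[q.den] a), ?_, ?_, ?_, ?_, ?_, ?_, ?_⟩, ?_⟩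
  · rw [hiter _ le_rfl, h.circlePt_return hc hqL]
  · exact upper_mem_closure_gammaArc (hf.lt_left.trans hcp) ⟨hz.1, hzp⟩
  · rw [← r1]; exact hinj.eq_iff hz (left_mem_Icc.2 hab.le)
  · rw [← r2]; exact hinj.eq_iff hz hcb
  · rw [← r3]; exact hinj.eq_iff hz hpab
  · rw [← r4]
    exact hinj.mem_image_iff (Ioo_subset_Icc_self.trans (Icc_subset_Icc_right hcb.2)) hz
  · rw [← r5]
    exact hinj.mem_image_iff (Ioo_subset_Icc_self.trans (Icc_subset_Icc hcb.1 hpb)) hz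
  · obtain ⟨B, hB, hB1, hB2, hB3, hB4⟩ := h.exists_periodicOrbit hc hqL
    exact ⟨B, hB, hB1, hB2, hB3, h.staySet_eq hc hq hq2 hqL hB hB4⟩
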